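/- Let $M$ be a smooth manifold. A quaternionic vector bundle over $M$ is a smooth real vector bundle $E$ of rank $4k$, $k\ge 1$, with structural group $\mathrm{Sp}(1)\cdot\mathrm{GL}(k,\mathbb H)$ acting on $\mathbb H^k$ by $q\mapsto aqA^{-1}$. Conjugating by admissible frames the left multiplications of $\mathbb H^k$ by elements of $\mathrm{Im}\,\mathbb H$ gives an oriented Riemannian vector bundle $Q\subseteq\mathrm{End}(E)$ of rank three, whose unit sphere bundle $\pi:Z\to M$ is the bundle of admissible linear complex structures of $E$. An almost $f$-quaternionic structure on $M$ is a pair $(E,V)$, where $E$ is a quaternionic vector bundle over $M$, with vector subbundles $V,TM\subseteq E$ such that $E=V\oplus TM$ and $JV\subseteq TM$ for every $J\in Z$. Let $\rho:E\to TM$ be the corresponding projection; then $(E,\rho)$ is an almost co-CR quaternionic structure on $M$. Let $D$ be a connection on $M$ compatible with $(E,V)$ and let $\nabla$ be the connection which it induces on $E$; that is, $\nabla$ is a connection on $E$ which is compatible with the structural group $\mathrm{Sp}(1)\cdot\mathrm{GL}(k,\mathbb H)$ and preserves $V$ and $TM$, and $\nabla=D^V\oplus D$, where $D^V$ is the connection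 induced on $V$. Let $T$ be the torsion of $D$ and let $R^Q$ be the curvature form of the connection induced by $\nabla$ on $Q$; we extend $\rho$, $T$, $R^Q$ and the Riemannian structure of $Q$ complex (multi)linearly. For $J\in Z$ let $E^J=\ker(J+\mathrm i)\subseteq E^{\mathbb C}$. Let $\mathcal C=(\ker \mathrm d\pi)^{0,1}\oplus\mathcal B$ be the complex distribution on $Z$ where, for $J\in Z$, $\mathcal B_J$ is the horizontal lift of $\rho(E^J)$ with respect to $\nabla$, and the complex structure of the fibres of $\pi$ is given by $K\mapsto JK$, for $K\in J^{\perp}=T_JZ_{\pi(J)}$. The triple $(E,\rho,\nabla)$ is called integrable if the space of (local) sections of $\mathcal C$ is closed under the Lie bracket. Then $(E,\rho,\nabla)$ is integrable if and only if, for every $J\in Z$, $$T\bigl(\Lambda^2(\rho(E^J))\bigr)\subseteq\rho(E^J)\qquad\text{and}\qquad R^Q\bigl(\Lambda^2(\rho(E^J))\bigr)(J)\subseteq(J'+\mathrm iJ'')^{\perp},$$ where $J',J''\in Z$ are such that $(J,J',J'')$ is a positive orthonormal frame of $Q$ (for any choice of such $J',J''$), and $\perp$ is taken with respect to the complex-bilinear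 extension of the Riemannian structure of $Q$. -/

import Mathlib

open Bundle Set
open scoped Manifold ContDiff Quaternion

noncomputable section

/-! ## Complexifications

A vector `v + i w` of the complexification of a real vector space `V` is written as the pair
`(v, w) : V × V` of its real and imaginary parts. -/

/-- Complex-linear extension of a real linear map. -/
def cMap {V W : Type*} (f : V → W) (v : V × V) : W × W := (f v.1, f v.2)

/-- Complex-bilinear extension of a real bilinear map. -/
def cBilin {V V' W : Type*} [AddCommGroup W] (B : V → V' → W) (v : V × V) (w : V' × V') : W × W :=
  (B v.1 w.1 - B v.2 w.2, B v.1 w.2 + B v.2 w.1)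

/-! ## The linear model `ℍ^k` and the group `Sp(1)·GL(k,ℍ)` -/

/-- The typical fibre `ℍ^k`, as row vectors. -/
abbrev HVec (k : ℕ) : Type := Fin k → ℍ[ℝ]

/-- Left multiplication `ξ ↦ aξ` on `ℍ^k`. -/
def leftMul (k : ℕ) (a : ℍ[ℝ]) : HVec k →L[ℝ] HVec k where
  toFun ξ := fun i => a * ξ i
  map_add' ξ η := by funext i; simp [mul_add]
  map_smul' c ξ := by funext i; simp
  cont := by fun_prop

/-- `g` is the linear isomorphism `ξ ↦ a ξ A⁻¹` of `ℍ^k` given by some unit quaternion `a` and some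
`A ∈ GL(k,ℍ)`, that is, `g ∈ Sp(1)·GL(k,ℍ)`. -/
def IsQuaternionicIso {k : ℕ} (g : HVec k ≃L[ℝ] HVec k) : Prop :=
  ∃ (a : ℍ[ℝ]) (A : (Matrix (Fin k) (Fin k) ℍ[ℝ])ˣ), ‖a‖ = 1 ∧
    ∀ ξ : HVec k, g ξ = leftMul k a (Matrix.vecMul ξ (↑A⁻¹ : Matrix (Fin k) (Fin k) ℍ[ℝ]))

/-- `γ` is an element `ξ ↦ a ξ - ξ A` of the Lie algebra of `Sp(1)·GL(k,ℍ)`, acting on `ℍ^k`. -/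
def InQuaternionicLieAlgebra {k : ℕ} (γ : HVec k → HVec k) : Prop :=
  ∃ (a : ℍ[ℝ]) (A : Matrix (Fin k) (Fin k) ℍ[ℝ]), a.re = 0 ∧
    ∀ ξ : HVec k, γ ξ = leftMul k a ξ - Matrix.vecMul ξ A

/-- For a real linear isomorphism `u : ℍ^k ≃ V`, the endomorphism `u ∘ (left mult. by a) ∘ u⁻¹`
of `V`. -/
def frameConj {k : ℕ} {V : Type*} [AddCommGroup V] [Module ℝ V] [TopologicalSpace V]
    (u : HVec k ≃L[ℝ] V) (a : ℍ[ℝ]) : V →L[ℝ] V :=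
  ((u : HVec k →L[ℝ] V).comp (leftMul k a)).comp (u.symm : V →L[ℝ] HVec k)

section Bundles

variable {n k : ℕ} {M : Type*} [TopologicalSpace M] [ChartedSpace (EuclideanSpace ℝ (Fin n)) M]
  {E : M → Type*} [TopologicalSpace (TotalSpace (HVec k) E)]
  [∀ x, AddCommGroup (E x)] [∀ x, Module ℝ (E x)] [∀ x, TopologicalSpace (E x)]
  [∀ x, IsTopologicalAddGroup (E x)] [∀ x, ContinuousSMul ℝ (E x)]
  [FiberBundle (HVec k) E]

/-! ## Quaternionic vector bundles -/

variable (n k E) in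
/-- A quaternionic structure on a real vector bundle `E` of rank `4k`: a reduction of its structural
group to `Sp(1)·GL(k,ℍ)`, given by the set of admissible frames at each point. -/
structure QuaternionicStructure where
  /-- The admissible frames at `x`. -/
  frames : ∀ x : M, Set (HVec k ≃L[ℝ] E x)
  /-- The admissible frames at `x` form one orbit of the structural group. -/
  orbit : ∀ (x : M), ∀ u ∈ frames x, ∀ u' : HVec k ≃L[ℝ] E x,
    u' ∈ frames x ↔ ∃ g : HVec k ≃L[ℝ] HVec k, IsQuaternionicIso g ∧ u' = g.trans u
  /-- Near each point there are smooth local fields of admissible frames. -/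
  exists_local : ∀ x₀ : M, ∃ (U : Set M) (u : ∀ x, HVec k ≃L[ℝ] E x),
    IsOpen U ∧ x₀ ∈ U ∧ (∀ x ∈ U, u x ∈ frames x) ∧
    ∀ ξ : HVec k, ContMDiffOn (𝓡 n) ((𝓡 n).prod 𝓘(ℝ, HVec k)) ∞
      (fun x => TotalSpace.mk' (HVec k) x (u x ξ)) U

namespace QuaternionicStructure

variable (S : QuaternionicStructure n k E)

/-- `u` is, over the open set `U`, a smooth field of admissible frames (a local section of the
reduced frame bundle). -/
def IsLocalFrame (U : Set M) (u : ∀ x, HVec k ≃L[ℝ] E x) : Prop :=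
  IsOpen U ∧ (∀ x ∈ U, u x ∈ S.frames x) ∧
    ∀ ξ : HVec k, ContMDiffOn (𝓡 n) ((𝓡 n).prod 𝓘(ℝ, HVec k)) ∞
      (fun x => TotalSpace.mk' (HVec k) x (u x ξ)) U

/-- A choice of a local frame near `x₀`. -/
def chosenFrame (x₀ : M) : ∀ x, HVec k ≃L[ℝ] E x := (S.exists_local x₀).choose_spec.choose

/-- The fibre at `x` of the oriented Riemannian vector bundle `Q ⊆ End E` of rank three: it
corresponds to `Im ℍ` under any admissible frame. -/
def Q (x : M) : Set (E x →L[ℝ] E x) :=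
  {A | ∃ u ∈ S.frames x, ∃ a : ℍ[ℝ], a.re = 0 ∧ A = frameConj u a}

/-- The fibre at `x` of the bundle `Z` of admissible linear complex structures: it corresponds to
the sphere `{a ∈ ℍ | a² = -1}` of unit imaginary quaternions under any admissible frame. -/
def Z (x : M) : Set (E x →L[ℝ] E x) :=
  {J | ∃ u ∈ S.frames x, ∃ a : ℍ[ℝ], a * a = -1 ∧ J = frameConj u a}

/-- `(J, J', J'')` is a positive orthonormal frame of `Q` at `x`: it corresponds to `(i, j, k)` under
some admissible frame. -/
def IsPositiveOrthonormal {x : M} (J J' J'' : E x →L[ℝ] E x) : Prop :=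
  ∃ u ∈ S.frames x, J = frameConj u ⟨0, 1, 0, 0⟩ ∧ J' = frameConj u ⟨0, 0, 1, 0⟩ ∧
    J'' = frameConj u ⟨0, 0, 0, 1⟩

end QuaternionicStructure

/-- The Riemannian structure of `Q`, for which `⟨u a u⁻¹, u b u⁻¹⟩` is the Euclidean inner product
of `a, b ∈ Im ℍ` (see `qInner_frameConj`). -/
def qInner (k : ℕ) {V : Type*} [AddCommGroup V] [Module ℝ V] [TopologicalSpace V]
    (A B : V →L[ℝ] V) : ℝ :=
  -(LinearMap.trace ℝ V ((A.comp B : V →L[ℝ] V) : V →ₗ[ℝ] V)) / (4 * k)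

theorem trace_leftMul (k : ℕ) (c : ℍ[ℝ]) :
    LinearMap.trace ℝ (HVec k) (leftMul k c : HVec k →ₗ[ℝ] HVec k) = 4 * k * c.re := by
  let b : Module.Basis (Fin 4) ℝ ℍ[ℝ] := QuaternionAlgebra.basisOneIJK (-1 : ℝ) 0 (-1)
  have hb : ∀ (q : ℍ[ℝ]), ⇑(b.repr q) = ![q.re, q.imI, q.imJ, q.imK] := fun q => rfl
  have hv : ∀ j m, ![(b j).re, (b j).imI, (b j).imJ, (b j).imK] m = if j = m then 1 else 0 := by
    intro j m
    rw [← hb, b.repr_self, Finsupp.single_apply]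
  have key : (c * b 0).re + (c * b 1).imI + (c * b 2).imJ + (c * b 3).imK = 4 * c.re := by
    rw [Quaternion.re_mul, Quaternion.imI_mul, Quaternion.imJ_mul, Quaternion.imK_mul]
    have h00 : (b 0).re = 1 := hv 0 0
    have h01 : (b 0).imI = 0 := hv 0 1
    have h02 : (b 0).imJ = 0 := hv 0 2
    have h03 : (b 0).imK = 0 := hv 0 3
    have h10 : (b 1).re = 0 := hv 1 0
    have h11 : (b 1).imI = 1 := hv 1 1
    have h12 : (b 1).imJ = 0 := hv 1 2
    have h13 : (b 1).imK = 0 := hv 1 3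
    have h20 : (b 2).re = 0 := hv 2 0
    have h21 : (b 2).imI = 0 := hv 2 1
    have h22 : (b 2).imJ = 1 := hv 2 2
    have h23 : (b 2).imK = 0 := hv 2 3
    have h30 : (b 3).re = 0 := hv 3 0
    have h31 : (b 3).imI = 0 := hv 3 1
    have h32 : (b 3).imJ = 0 := hv 3 2
    have h33 : (b 3).imK = 1 := hv 3 3
    rw [h00, h01, h02, h03, h10, h11, h12, h13, h20, h21, h22, h23, h30, h31, h32, h33]
    ring
  rw [LinearMap.trace_eq_matrix_trace ℝ (Pi.basis fun _ : Fin k => b), Matrix.trace,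
    Fintype.sum_sigma]
  have : ∀ i : Fin k, ∑ j : Fin 4, (LinearMap.toMatrix (Pi.basis fun _ : Fin k => b)
      (Pi.basis fun _ : Fin k => b) (leftMul k c : HVec k →ₗ[ℝ] HVec k)).diag ⟨i, j⟩ = 4 * c.re := by
    intro i
    rw [← key]
    simp only [Matrix.diag_apply, LinearMap.toMatrix_apply, Pi.basis_repr, Pi.basis_apply,
      ContinuousLinearMap.coe_coe]
    have h : ∀ j, leftMul k c (Pi.single i (b j)) i = c * b j := by
      intro j; simp [leftMul]
    simp only [h, hb, Fin.sum_univ_four]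
    rfl
  simp only [this]
  simp
  ring

theorem qInner_frameConj {k : ℕ} [NeZero k] {V : Type*} [AddCommGroup V] [Module ℝ V]
    [TopologicalSpace V] (u : HVec k ≃L[ℝ] V) (a b : ℍ[ℝ]) (ha : a.re = 0) :
    qInner k (frameConj u a) (frameConj u b) = inner ℝ a b := by
  have e : (((frameConj u a).comp (frameConj u b) : V →L[ℝ] V) : V →ₗ[ℝ] V) =
      u.toLinearEquiv.conj (leftMul k (a * b) : HVec k →ₗ[ℝ] HVec k) := by
    ext v
    simp [frameConj, LinearEquiv.conj_apply, leftMul, mul_assoc]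
  have t := trace_leftMul k (a * b)
  have hk : (k : ℝ) ≠ 0 := by exact_mod_cast NeZero.ne k
  rw [qInner, e, LinearMap.trace_conj', t]
  have : inner ℝ a b = -(a * b).re := by
    rw [Quaternion.inner_def]; simp [ha]; ring
  rw [this]; field_simp

/-- The complex-bilinear extension of `qInner`. -/
def qInnerC (k : ℕ) {V : Type*} [AddCommGroup V] [Module ℝ V] [TopologicalSpace V]
    (A B : (V →L[ℝ] V) × (V →L[ℝ] V)) : ℂ :=
  ⟨(cBilin (qInner k) A B).1, (cBilin (qInner k) A B).2⟩

/-- The eigenspace `E^J = ker(J + i)` in the complexification of `V`: the equation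
`J(e₁ + i e₂) = -i(e₁ + i e₂)`. -/
def eigenJ {V : Type*} [AddCommGroup V] [Module ℝ V] [TopologicalSpace V] (J : V →L[ℝ] V) :
    Set (V × V) :=
  {e | cMap J e = (e.2, -e.1)}

/-! ## The connection induced on endomorphisms and on `Q`, and its curvature -/

section Connections

variable [IsManifold (𝓡 n) ∞ M] [VectorBundle ℝ (HVec k) E]
  [ContMDiffVectorBundle ∞ (HVec k) E (𝓡 n)]

variable (nabla : CovariantDerivative (𝓡 n) (HVec k) E)

open Classical in
/-- The covariant derivative at `x`, in the direction `X`, of a section `A` of `End E`, for the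
connection induced by `∇`: the endomorphism characterised by
`(D_X A)(σ) = ∇_X (A σ) - A (∇_X σ)` for all sections `σ` differentiable at `x`
(see `endDeriv_apply`; the value is `0` if there is no such endomorphism, which does not happen if
`A` is differentiable at `x`). -/
def endDeriv (A : ∀ y : M, E y →L[ℝ] E y) (x : M) (X : TangentSpace (𝓡 n) x) : E x →L[ℝ] E x :=
  if h : TensorialAt (𝓡 n) (HVec k)
      (fun σ : ∀ y, E y => nabla (fun y => A y (σ y)) x X - A x (nabla σ x X)) x then
    haveI : ContMDiffVectorBundle 1 (HVec k) E (𝓡 n) := ContMDiffVectorBundle.of_le (n := ∞) (by simp)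
    TensorialAt.mkHom
      (fun σ : ∀ y, E y => nabla (fun y => A y (σ y)) x X - A x (nabla σ x X)) x h
  else 0

theorem endDeriv_apply (A : ∀ y : M, E y →L[ℝ] E y) (x : M) (X : TangentSpace (𝓡 n) x)
    (hA : ∀ σ : ∀ y, E y,
      MDifferentiableAt (𝓡 n) ((𝓡 n).prod 𝓘(ℝ, HVec k))
        (fun y => TotalSpace.mk' (HVec k) y (σ y)) x →
      MDifferentiableAt (𝓡 n) ((𝓡 n).prod 𝓘(ℝ, HVec k))
        (fun y => TotalSpace.mk' (HVec k) y (A y (σ y))) x)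
    (σ : ∀ y, E y)
    (hσ : MDifferentiableAt (𝓡 n) ((𝓡 n).prod 𝓘(ℝ, HVec k))
        (fun y => TotalSpace.mk' (HVec k) y (σ y)) x) :
    endDeriv nabla A x X (σ x) = nabla (fun y => A y (σ y)) x X - A x (nabla σ x X) := by
  have h : TensorialAt (𝓡 n) (HVec k)
      (fun σ : ∀ y, E y => nabla (fun y => A y (σ y)) x X - A x (nabla σ x X)) x := by
    constructor
    · intro f σ hf hσ
      have e : (fun y => A y ((f • σ) y)) = f • (fun y => A y (σ y)) := by
        funext y; simp
      simp only [e]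
      rw [nabla.isCovariantDerivativeOnUniv.leibniz (hA σ hσ) hf,
        nabla.isCovariantDerivativeOnUniv.leibniz hσ hf]
      simp [smul_sub]
    · intro σ τ hσ hτ
      have e : (fun y => A y ((σ + τ) y)) = (fun y => A y (σ y)) + (fun y => A y (τ y)) := by
        funext y; simp
      simp only [e]
      rw [nabla.isCovariantDerivativeOnUniv.add (hA σ hσ) (hA τ hτ),
        nabla.isCovariantDerivativeOnUniv.add hσ hτ]
      simp only [add_apply, map_add]
      abel
  have : ContMDiffVectorBundle 1 (HVec k) E (𝓡 n) :=
    ContMDiffVectorBundle.of_le (n := ∞) (by simp)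
  rw [endDeriv, dif_pos h]
  exact TensorialAt.mkHom_apply h hσ

/-- The curvature operator `D_X D_Y A - D_Y D_X A - D_{[X,Y]} A` at `x`, for vector fields `X`, `Y`
and a section `A` of `End E`. -/
def endCurv (X Y : ∀ y : M, TangentSpace (𝓡 n) y) (A : ∀ y : M, E y →L[ℝ] E y) (x : M) :
    E x →L[ℝ] E x :=
  endDeriv nabla (fun y => endDeriv nabla A y (Y y)) x (X x)
    - endDeriv nabla (fun y => endDeriv nabla A y (X y)) x (Y x)
    - endDeriv nabla A x (VectorField.mlieBracket (𝓡 n) X Y x)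

/-- The curvature form `R^Q(X, Y) J` of the connection induced on `Q ⊆ End E`. By tensoriality it may
be computed with any smooth local extensions of `X`, `Y` to vector fields and of `J ∈ Q_x` to a
section of `Q`; we use those that are constant in local frames. -/
def QuaternionicStructure.curvQ (S : QuaternionicStructure n k E) {x : M}
    (X Y : TangentSpace (𝓡 n) x) (J : E x →L[ℝ] E x) : E x →L[ℝ] E x :=
  endCurv nabla
    (FiberBundle.extend (EuclideanSpace ℝ (Fin n)) X)
    (FiberBundle.extend (EuclideanSpace ℝ (Fin n)) Y)
    (fun y =>
      let τ : E x ≃L[ℝ] E y := (S.chosenFrame x x).symm.trans (S.chosenFrame x y)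
      ((τ : E x →L[ℝ] E y).comp J).comp (τ.symm : E y →L[ℝ] E x)) x

/-- `∇` is compatible with the quaternionic structure: with respect to any smooth local field of
admissible frames, its connection form takes values in the Lie algebra of `Sp(1)·GL(k,ℍ)`. -/
def QuaternionicStructure.IsCompatible (S : QuaternionicStructure n k E) : Prop :=
  ∀ (U : Set M) (u : ∀ x, HVec k ≃L[ℝ] E x), S.IsLocalFrame U u →
    ∀ x ∈ U, ∀ X : TangentSpace (𝓡 n) x,
      InQuaternionicLieAlgebra (fun ξ : HVec k => (u x).symm (nabla (fun y => u y ξ) x X))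

/-! ## The complex distribution on `Z` and its integrability

A smooth local field `u` of admissible frames over `U` trivialises `Z` over `U`, through
`U × S² → Z`, `(x, a) ↦ u_x a u_x⁻¹`, where `S² = {a ∈ ℍ | a² = -1}`. In these trivialisations the
tangent vectors to `Z` are the vectors `(X, w)` tangent to `U × S² ⊆ M × ℍ`. -/

/-- The component of a tangent vector `ζ = (X, w)` to `Z` along the fibre of `Z`, with respect to the
connection induced by `∇`: it vanishes if and only if `ζ` is horizontal. -/
def verticalPart (u : ∀ x, HVec k ≃L[ℝ] E x) (p : M × ℍ[ℝ])
    (ζ : TangentSpace ((𝓡 n).prod 𝓘(ℝ, ℍ[ℝ])) p) : E p.1 →L[ℝ] E p.1 :=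
  frameConj (u p.1) (NormedSpace.fromTangentSpace p.2
      (mfderiv ((𝓡 n).prod 𝓘(ℝ, ℍ[ℝ])) 𝓘(ℝ, ℍ[ℝ]) Prod.snd p ζ))
    + endDeriv nabla (fun y => frameConj (u y) p.2) p.1
      (mfderiv ((𝓡 n).prod 𝓘(ℝ, ℍ[ℝ])) (𝓡 n) Prod.fst p ζ)

/-- The `(0,1)`-vectors at `J` of the fibre `Z_x`, which is an oriented Euclidean two-sphere: the
vectors `K + i 𝒥K`, with `K ∈ T_J Z_x = J^⊥ ⊆ Q_x`, where the complex structure `𝒥` of `T_J Z_x` is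
`K ↦ J ∘ K`, the rotation by `π/2` with `(J, K, 𝒥K)` positively oriented. -/
def QuaternionicStructure.zeroOne (S : QuaternionicStructure n k E) {x : M} (J : E x →L[ℝ] E x) :
    Set ((E x →L[ℝ] E x) × (E x →L[ℝ] E x)) :=
  {K | K.1 ∈ S.Q x ∧ qInner k J K.1 = 0 ∧ K.2 = J.comp K.1}

/-- The complex distribution `𝒞 = (ker dπ)^{0,1} ⊕ 𝓑` on `Z`, where `𝓑_J` is the horizontal lift of
`ρ(E^J)`, in the trivialisation of `Z` given by `u`: the complex tangent vectors at `(x, a)` which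
project into `ρ(E^J)` and whose vertical part is of type `(0,1)`. -/
def QuaternionicStructure.coCRDistribution (S : QuaternionicStructure n k E)
    (ρ : ∀ x, E x →L[ℝ] TangentSpace (𝓡 n) x) (u : ∀ x, HVec k ≃L[ℝ] E x) (p : M × ℍ[ℝ]) :
    Set (TangentSpace ((𝓡 n).prod 𝓘(ℝ, ℍ[ℝ])) p × TangentSpace ((𝓡 n).prod 𝓘(ℝ, ℍ[ℝ])) p) :=
  {ζ | cMap (mfderiv ((𝓡 n).prod 𝓘(ℝ, ℍ[ℝ])) (𝓡 n) Prod.fst p) ζ ∈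
        cMap (ρ p.1) '' eigenJ (frameConj (u p.1) p.2) ∧
      cMap (verticalPart nabla u p) ζ ∈ S.zeroOne (frameConj (u p.1) p.2)}

/-- `(E, ρ, ∇)` is integrable: the distribution `𝒞` on `Z` is closed under the Lie bracket of
(complex, local, smooth) vector fields. This is a local condition, formulated in each of the
trivialisations `U × S²` of `Z`. As `S²` is a closed submanifold of `ℍ`, any local vector field on
`U × S²` is the restriction of a local vector field on `U × ℍ`, and brackets may be computed with any
such extensions. Real and imaginary parts: `[A₁ + iA₂, B₁ + iB₂]` is
`([A₁,B₁] - [A₂,B₂]) + i([A₁,B₂] + [A₂,B₁])`. -/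
def QuaternionicStructure.IsIntegrable (S : QuaternionicStructure n k E)
    (ρ : ∀ x, E x →L[ℝ] TangentSpace (𝓡 n) x) : Prop :=
  ∀ (U : Set M) (u : ∀ x, HVec k ≃L[ℝ] E x), S.IsLocalFrame U u →
  ∀ W : Set (M × ℍ[ℝ]), IsOpen W → (∀ p ∈ W, p.1 ∈ U) →
  ∀ A₁ A₂ B₁ B₂ : ∀ p : M × ℍ[ℝ], TangentSpace ((𝓡 n).prod 𝓘(ℝ, ℍ[ℝ])) p,
    (∀ V ∈ ({A₁, A₂, B₁, B₂} : Set (∀ p : M × ℍ[ℝ], TangentSpace ((𝓡 n).prod 𝓘(ℝ, ℍ[ℝ])) p)),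
      ContMDiffOn ((𝓡 n).prod 𝓘(ℝ, ℍ[ℝ])) ((𝓡 n).prod 𝓘(ℝ, ℍ[ℝ])).tangent ∞
        (fun p => (⟨p, V p⟩ : TangentBundle ((𝓡 n).prod 𝓘(ℝ, ℍ[ℝ])) (M × ℍ[ℝ]))) W) →
    (∀ p ∈ W, p.2 * p.2 = -1 → (A₁ p, A₂ p) ∈ S.coCRDistribution nabla ρ u p) →
    (∀ p ∈ W, p.2 * p.2 = -1 → (B₁ p, B₂ p) ∈ S.coCRDistribution nabla ρ u p) →
    ∀ p ∈ W, p.2 * p.2 = -1 →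
      cBilin (fun A B => VectorField.mlieBracket ((𝓡 n).prod 𝓘(ℝ, ℍ[ℝ])) A B p) (A₁, A₂) (B₁, B₂)
        ∈ S.coCRDistribution nabla ρ u p

end Connections

/-! ## Almost `f`-quaternionic structures -/

variable (n k E) in
/-- An almost `f`-quaternionic structure on `M`: a quaternionic vector bundle `E` with subbundles
`V, TM ⊆ E` such that `E = V ⊕ TM` and `J V ⊆ TM` for every admissible `J`. The inclusion of `TM` is
`ι`, and the complementary subbundle `V` is given as the kernel of the projection `ρ`, a smooth
morphism of vector bundles with `ρ ∘ ι = id`. -/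
structure AlmostFQuaternionicStructure [IsManifold (𝓡 n) ∞ M] extends
    QuaternionicStructure n k E where
  /-- The inclusion `TM → E`. -/
  ι : ∀ x : M, TangentSpace (𝓡 n) x →L[ℝ] E x
  /-- The projection `E → TM`, with kernel `V`. -/
  ρ : ∀ x : M, E x →L[ℝ] TangentSpace (𝓡 n) x
  smooth_ι : ContMDiff (𝓡 n).tangent ((𝓡 n).prod 𝓘(ℝ, HVec k)) ∞
    (fun v : TangentBundle (𝓡 n) M => TotalSpace.mk' (HVec k) v.1 (ι v.1 v.2))
  smooth_ρ : ContMDiff ((𝓡 n).prod 𝓘(ℝ, HVec k)) (𝓡 n).tangent ∞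
    (fun e : TotalSpace (HVec k) E => (⟨e.1, ρ e.1 e.2⟩ : TangentBundle (𝓡 n) M))
  ρ_ι : ∀ x v, ρ x (ι x v) = v
  J_V_subset : ∀ x, ∀ J ∈ toQuaternionicStructure.Z x, ∀ v : E x, ρ x v = 0 → J v ∈ range (ι x)

/-- `D` is a connection on `M` compatible with the almost `f`-quaternionic structure, and `∇` is the
connection which it induces on `E`: `∇` is compatible with the group of `f`-quaternionic linear
isomorphisms (that is, with the quaternionic structure of `E` and with the subbundles `V` and `TM`),
and `∇ = D^V ⊕ D`, where `D^V` is the restriction of `∇` to `V`. -/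
structure AlmostFQuaternionicStructure.IsInducedConnection [IsManifold (𝓡 n) ∞ M]
    [VectorBundle ℝ (HVec k) E]
    (S : AlmostFQuaternionicStructure n k E)
    (D : CovariantDerivative (𝓡 n) (EuclideanSpace ℝ (Fin n)) (TangentSpace (𝓡 n) : M → Type _))
    (nabla : CovariantDerivative (𝓡 n) (HVec k) E) : Prop where
  compatible : S.toQuaternionicStructure.IsCompatible nabla
  on_TM : ∀ (x : M) (Y : ∀ y : M, TangentSpace (𝓡 n) y),
    MDifferentiableAt (𝓡 n) (𝓡 n).tangent (fun y => (⟨y, Y y⟩ : TangentBundle (𝓡 n) M)) x →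
    ∀ X : TangentSpace (𝓡 n) x, nabla (fun y => S.ι y (Y y)) x X = S.ι x (D Y x X)
  on_V : ∀ (x : M) (σ : ∀ y : M, E y),
    MDifferentiableAt (𝓡 n) ((𝓡 n).prod 𝓘(ℝ, HVec k)) (fun y => TotalSpace.mk' (HVec k) y (σ y)) x →
    (∀ y, S.ρ y (σ y) = 0) → ∀ X : TangentSpace (𝓡 n) x, S.ρ x (nabla σ x X) = 0

/-- The complex subspace `ρ(E^J)` of the complexified tangent space. -/
def AlmostFQuaternionicStructure.rhoE [IsManifold (𝓡 n) ∞ M]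
    (S : AlmostFQuaternionicStructure n k E) {x : M} (J : E x →L[ℝ] E x) :
    Set (TangentSpace (𝓡 n) x × TangentSpace (𝓡 n) x) :=
  cMap (S.ρ x) '' eigenJ J

end Bundles

end

noncomputable section

open Filter Topology

set_option linter.unusedSectionVars false

/-! ## Left multiplication on `ℍ^k` -/

section LeftMul

variable {k : ℕ}

/-! A local admissible frame `u` turns `Z` into `U × S²`, where `S²` is the set of `b ∈ ℍ` with `b²
= -1`. There the induced connection on `Q` is an `ℍ`-valued form `α` acting by commutators. The
vertical part of a vector `(X, w)` at `(x, b)` is `w + [α(X), b]`. It is tangent to `S²` exactly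
when it anticommutes with `b`, and `V₁ + iV₂` is of type `(0,1)` exactly when moreover `V₂ = bV₁`.
Likewise `ξ₁ + iξ₂` lies in `E^J` exactly when `ξ₂ = bξ₁`.

Two structure equations drive the proof. If `A`, `B` project to `ρ(ξ)`, `ρ(η)`, then the projection
of `[A,B]` is `ρ(∇_A η - ∇_B ξ) - T(ρξ, ρη)` (`lieBracket_fst_anchor`), and its vertical part is
`∇_A V(B) - ∇_B V(A) - [F(A,B), b]`, with `F` the curvature of `α` (`formVertical_lieBracket`). For
sections of `𝒞`, differentiate `ξ₂ = bξ₁`, `V₂ = bV₁` and `bV₁ + V₁b = 0` along `U × S²`; the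
covariant derivative of `b` along `A` is `V(A)`. After complexification the products involving
`V(A)` and `V(B)` cancel, so the covariant terms again lie in `E^J`, respectively are of type
`(0,1)` (`IsAnchoredNear.lieBracket_fst`, `IsVerticalZeroOneNear.formVertical_bracket`). Hence,
modulo `𝒞`, the bracket has projection `-T` and vertical part `-R^Q(J)`. It belongs to `𝒞` if and
only if `T` takes its value in `ρ(E^J)` and `R^Q(J)`, which is orthogonal to `J`, is of type
`(0,1)`. Since `J' + iJ''` is isotropic and spans the `(0,1)` line of `J^⊥`, the latter is
orthogonality to `J' + iJ''` (`qInnerC_eq_zero_iff`). This pointwise equivalence is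
`IsDistributionSection.bracket_mem_iff`.

The `f`-quaternionic structure enters twice. Because `JV ⊆ TM`, the lift to `E^J` of a vector of
`ρ(E^J)` is given by an explicit formula, so a smooth section of `𝒞` has a differentiable lift
(`IsDistributionSection.isAnchoredNear`). Because `∇ = D^V ⊕ D`, one has `ρ ∘ ∇ = D ∘ ρ`, so the
torsion in the first structure equation is that of `D` (`torsion_eq_formTorsion`). For necessity,
every vector of `ρ(E^J)` is the value of a horizontal section of `𝒞`
(`isDistributionSection_horizontalField`). -/

theorem leftMul_add (a b : ℍ[ℝ]) : leftMul k (a + b) = leftMul k a + leftMul k b := by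
  ext ξ i : 2
  simp [leftMul, add_mul]

theorem leftMul_smul (c : ℝ) (a : ℍ[ℝ]) : leftMul k (c • a) = c • leftMul k a := by
  ext ξ i : 2
  simp [leftMul]

theorem leftMul_mul (a b : ℍ[ℝ]) (ξ : HVec k) :
    leftMul k (a * b) ξ = leftMul k a (leftMul k b ξ) := by
  funext i
  simp [leftMul, mul_assoc]

theorem leftMul_one (ξ : HVec k) : leftMul k 1 ξ = ξ := by
  funext i
  simp [leftMul]

theorem leftMul_neg (a : ℍ[ℝ]) : leftMul k (-a) = -leftMul k a := by
  ext ξ i : 2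
  simp [leftMul]

theorem leftMul_sub (a b : ℍ[ℝ]) : leftMul k (a - b) = leftMul k a - leftMul k b := by
  rw [sub_eq_add_neg, leftMul_add, leftMul_neg, sub_eq_add_neg]

theorem leftMul_leftMul_of_sq {b : ℍ[ℝ]} (hb : b * b = -1) (ξ : HVec k) :
    leftMul k b (leftMul k b ξ) = -ξ := by
  rw [← leftMul_mul, hb, leftMul_neg, neg_apply, leftMul_one]

theorem leftMul_injective [NeZero k] : Function.Injective (leftMul k) := by
  intro a b h
  have := congrFun (congrArg (fun f : HVec k →L[ℝ] HVec k => f (fun _ => 1)) h) 0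
  simpa [leftMul] using this

variable (k) in
/-- Left multiplication as a continuous bilinear map. -/
def leftMulL : ℍ[ℝ] →L[ℝ] HVec k →L[ℝ] HVec k :=
  LinearMap.toContinuousLinearMap
    { toFun := leftMul k
      map_add' := leftMul_add
      map_smul' := leftMul_smul }

theorem HasFDerivAt.leftMul {G : Type*} [NormedAddCommGroup G] [NormedSpace ℝ G] {p : G}
    {c : G → ℍ[ℝ]} {ξ : G → HVec k} {c' : G →L[ℝ] ℍ[ℝ]} {ξ' : G →L[ℝ] HVec k}
    (hc : HasFDerivAt c c' p) (hξ : HasFDerivAt ξ ξ' p) :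
    HasFDerivAt (fun q => _root_.leftMul k (c q) (ξ q))
      ((leftMulL k (c p)).comp ξ' + ((leftMulL k).flip (ξ p)).comp c') p := by
  have := (leftMulL k).hasFDerivAt_of_bilinear hc hξ
  convert! this using 1

theorem DifferentiableAt.leftMul {G : Type*} [NormedAddCommGroup G] [NormedSpace ℝ G] {p : G}
    {c : G → ℍ[ℝ]} {ξ : G → HVec k} (hc : DifferentiableAt ℝ c p) (hξ : DifferentiableAt ℝ ξ p) :
    DifferentiableAt ℝ (fun q => _root_.leftMul k (c q) (ξ q)) p :=
  (HasFDerivAt.leftMul hc.hasFDerivAt hξ.hasFDerivAt).differentiableAt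

theorem fderiv_leftMul {G : Type*} [NormedAddCommGroup G] [NormedSpace ℝ G] {p : G}
    {c : G → ℍ[ℝ]} {ξ : G → HVec k} (hc : DifferentiableAt ℝ c p) (hξ : DifferentiableAt ℝ ξ p)
    (v : G) : fderiv ℝ (fun q => _root_.leftMul k (c q) (ξ q)) p v =
      _root_.leftMul k (c p) (fderiv ℝ ξ p v) + _root_.leftMul k (fderiv ℝ c p v) (ξ p) := by
  rw [(HasFDerivAt.leftMul hc.hasFDerivAt hξ.hasFDerivAt).fderiv]
  rfl

end LeftMul

/-! ## Unit imaginary quaternions -/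

/-- The imaginary part of `b²` is `2 Re(b) Im(b)`. If `Re b ≠ 0`, then `b` would be real with square
`-1`. -/
theorem re_eq_zero_of_mul_self {b : ℍ[ℝ]} (hb : b * b = -1) : b.re = 0 := by
  have h0 := congrArg QuaternionAlgebra.re hb
  have h1 := congrArg QuaternionAlgebra.imI hb
  have h2 := congrArg QuaternionAlgebra.imJ hb
  have h3 := congrArg QuaternionAlgebra.imK hb
  rw [Quaternion.re_mul] at h0
  rw [Quaternion.imI_mul] at h1
  rw [Quaternion.imJ_mul] at h2
  rw [Quaternion.imK_mul] at h3
  simp at h0 h1 h2 h3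
  by_contra hr
  have e1 : b.imI = 0 := mul_left_cancel₀ hr (by linarith)
  have e2 : b.imJ = 0 := mul_left_cancel₀ hr (by linarith)
  have e3 : b.imK = 0 := mul_left_cancel₀ hr (by linarith)
  rw [e1, e2, e3] at h0
  nlinarith [mul_self_nonneg b.re]

theorem mul_self_eq_neg_normSq {w : ℍ[ℝ]} (hw : w.re = 0) :
    w * w = -((Quaternion.normSq w : ℝ) : ℍ[ℝ]) := by
  have : star w = -w := by
    rw [Quaternion.star_eq_neg]; exact hw
  rw [← Quaternion.self_mul_star, this]; simp

/-- The quaternions anticommuting with a unit imaginary `b` are the imaginary ones orthogonal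
to `b`. -/
theorem anticomm_iff {b w : ℍ[ℝ]} (hb : b * b = -1) :
    b * w + w * b = 0 ↔ w.re = 0 ∧ inner ℝ b w = 0 := by
  have hre := re_eq_zero_of_mul_self hb
  rw [Quaternion.inner_def]
  constructor
  · intro h
    have h1 : b * (b * w + w * b) + (b * w + w * b) * b = 0 := by rw [h]; simp
    have h2 : b * (b * w + w * b) + (b * w + w * b) * b = (b * b) * w + w * (b * b)
      + (b * w * b + b * w * b) := by noncomm_ring
    have h3 : b * (b * w + w * b) = (b * b) * w + b * w * b := by noncomm_ring
    rw [h, mul_zero, hb] at h3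
    -- Multiplying the anticommutation relation by `b` gives `w = bwb`; since the real part is
    -- invariant under cyclic permutation, `Re w = Re(b²w) = -Re w`.
    have h4 : w = b * w * b := by
      have : 0 = -w + b * w * b := by simpa using h3
      exact (neg_add_eq_zero.mp this.symm)
    have h5 : w.re = (b * w * b).re := congrArg _ h4
    have h6 : (b * w * b).re = (b * b * w).re := by
      simp only [Quaternion.re_mul, Quaternion.imI_mul, Quaternion.imJ_mul, Quaternion.imK_mul]
      ring
    have h8 : (b * b * w).re = -w.re := by rw [hb]; simp
    have hw : w.re = 0 := by linarith
    refine ⟨hw, ?_⟩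
    have h7 := congrArg QuaternionAlgebra.re h
    simp only [Quaternion.re_add, Quaternion.re_mul, Quaternion.re_star,
      Quaternion.imI_star, Quaternion.imJ_star, Quaternion.imK_star] at h7 ⊢
    simp [hre, hw] at h7 ⊢
    linarith
  · rintro ⟨hw, h⟩
    simp only [Quaternion.re_mul, Quaternion.re_star,
      Quaternion.imI_star, Quaternion.imJ_star, Quaternion.imK_star] at h
    ext
    · simp only [Quaternion.re_add, Quaternion.re_mul]
      simp [hre, hw] at h ⊢
      linarith
    all_goals
      simp only [Quaternion.imI_add, Quaternion.imJ_add, Quaternion.imK_add,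
        Quaternion.imI_mul, Quaternion.imJ_mul, Quaternion.imK_mul, hre, hw]
      simp
      try ring

/-- Conjugation preserves `b² = -1`, so its infinitesimal action `[f, b]` is tangent to `S²` at `b`,
for any `f`. -/
theorem anticomm_commutator {b : ℍ[ℝ]} (hb : b * b = -1) (f : ℍ[ℝ]) :
    b * (f * b - b * f) + (f * b - b * f) * b = 0 := by
  have : b * (f * b - b * f) + (f * b - b * f) * b = f * (b * b) - (b * b) * f := by noncomm_ring
  rw [this, hb]; simp

/-! ## Functions vanishing on the sphere bundle -/

section Sphere

variable {G F : Type*} [NormedAddCommGroup G] [NormedSpace ℝ G] [NormedAddCommGroup F]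
  [NormedSpace ℝ F]

/-- The derivative of a function vanishing along `G × S²` vanishes in the directions tangent to
`G × S²`. -/
theorem fderiv_eq_zero_of_sphere {f : G × ℍ[ℝ] → F} {p : G × ℍ[ℝ]} (hp : p.2 * p.2 = -1)
    (hf : DifferentiableAt ℝ f p) (h0 : ∀ᶠ q in 𝓝 p, q.2 * q.2 = -1 → f q = 0)
    {v : G × ℍ[ℝ]} (hv : p.2 * v.2 + v.2 * p.2 = 0) : fderiv ℝ f p v = 0 := by
  obtain ⟨z, b⟩ := p
  obtain ⟨x, w⟩ := v
  simp only at hp hv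
  have hw : w.re = 0 := ((anticomm_iff hp).1 hv).1
  set N : ℝ := Quaternion.normSq w with hN
  have hN0 : 0 ≤ N := Quaternion.normSq_nonneg
  -- Since `w` anticommutes with `b`, `(b + tw)² = -(1 + t²N)`; dividing by the root gives a curve
  -- on `S²`. The factor has derivative `0` at `t = 0`, so the velocity there is still `w`.
  let r : ℝ → ℝ := fun t => (Real.sqrt (1 + t ^ 2 * N))⁻¹
  have hr : HasDerivAt r 0 0 := by
    have h1 : HasDerivAt (fun t : ℝ => 1 + t ^ 2 * N) 0 0 := by
      have := ((hasDerivAt_pow 2 (0 : ℝ)).mul_const N).const_add 1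
      simpa using this
    have h2 := (h1.sqrt (by norm_num)).inv (by norm_num)
    have h3 : HasDerivAt r _ 0 := h2
    convert h3 using 1
    simp
  let c : ℝ → G × ℍ[ℝ] := fun t => (z + t • x, r t • (b + t • w))
  have hr0 : r 0 = 1 := by simp [r]
  have hc : HasDerivAt c (x, w) 0 := by
    have h1 : HasDerivAt (fun t : ℝ => z + t • x) x 0 := by
      simpa using ((hasDerivAt_id (0 : ℝ)).smul_const x).const_add z
    have h2 : HasDerivAt (fun t : ℝ => b + t • w) w 0 := by
      simpa using ((hasDerivAt_id (0 : ℝ)).smul_const w).const_add b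
    have h3 := hr.smul h2
    simp only [hr0, one_smul, zero_smul, add_zero] at h3
    exact h1.prodMk h3
  have hc0 : c 0 = (z, b) := by simp [c, hr0]
  have hcs : ∀ t, (c t).2 * (c t).2 = -1 := by
    intro t
    have e : (c t).2 * (c t).2 = (r t * r t) • (b * b + t • (b * w + w * b) + (t ^ 2) • (w * w)) := by
      simp only [c, smul_mul_smul_comm]
      congr 1
      simp only [mul_add, add_mul, smul_add, mul_smul_comm, smul_mul_assoc, smul_smul, pow_two]
      abel
    have hpos : 0 < 1 + t ^ 2 * N := by positivity
    have hrr : r t * r t = (1 + t ^ 2 * N)⁻¹ := by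
      simp only [r]
      rw [← mul_inv, Real.mul_self_sqrt hpos.le]
    rw [e, hp, hv, mul_self_eq_neg_normSq hw, ← hN, hrr]
    have : (-1 : ℍ[ℝ]) + t • (0 : ℍ[ℝ]) + (t ^ 2) • -((N : ℝ) : ℍ[ℝ]) = (1 + t ^ 2 * N) • (-1) := by
      rw [smul_zero, add_zero, add_smul, one_smul, smul_neg, smul_neg]
      congr 2
      ext <;> simp
    rw [this, smul_smul, inv_mul_cancel₀ hpos.ne', one_smul]
  have hd : HasDerivAt (fun t => f (c t)) (fderiv ℝ f (z, b) (x, w)) 0 := by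
    have : HasFDerivAt f (fderiv ℝ f (z, b)) (c 0) := by rw [hc0]; exact hf.hasFDerivAt
    exact this.comp_hasDerivAt 0 hc
  have hz : (fun t => f (c t)) =ᶠ[𝓝 0] fun _ => 0 := by
    have hcc : Tendsto c (𝓝 0) (𝓝 (z, b)) := by
      have := hc.continuousAt.tendsto
      rwa [hc0] at this
    filter_upwards [hcc.eventually h0] with t ht using ht (hcs t)
  exact hd.unique ((hasDerivAt_const (0 : ℝ) (0 : F)).congr_of_eventuallyEq hz)

end Sphere

/-! ## Brackets of vector fields on `G × ℍ`, relative to an `Im ℍ`-valued connection form -/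

section Flat

variable {G : Type*} [NormedAddCommGroup G] [NormedSpace ℝ G]

instance quaternionForm.normedAddCommGroup : NormedAddCommGroup (G →L[ℝ] ℍ[ℝ]) :=
  ContinuousLinearMap.toNormedAddCommGroup

instance quaternionForm.normedSpace : NormedSpace ℝ (G →L[ℝ] ℍ[ℝ]) :=
  ContinuousLinearMap.toNormedSpace

/-- The vertical part of a tangent vector to `G × ℍ`, for the connection form `α`. -/
def formVertical (α : G → G →L[ℝ] ℍ[ℝ]) (p v : G × ℍ[ℝ]) : ℍ[ℝ] :=
  v.2 + (α p.1 v.1 * p.2 - p.2 * α p.1 v.1)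

/-- The curvature of the connection form `α`. -/
def formCurv (α : G → G →L[ℝ] ℍ[ℝ]) (z X Y : G) : ℍ[ℝ] :=
  fderiv ℝ α z X Y - fderiv ℝ α z Y X + (α z X * α z Y - α z Y * α z X)

variable {α : G → G →L[ℝ] ℍ[ℝ]} {p : G × ℍ[ℝ]}

theorem hasFDerivAt_form_apply (hα : DifferentiableAt ℝ α p.1) {A : G × ℍ[ℝ] → G}
    (hA : DifferentiableAt ℝ A p) :
    DifferentiableAt ℝ (fun q : G × ℍ[ℝ] => α q.1 (A q)) p ∧
    ∀ v, fderiv ℝ (fun q : G × ℍ[ℝ] => α q.1 (A q)) p v =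
      fderiv ℝ α p.1 v.1 (A p) + α p.1 (fderiv ℝ A p v) := by
  have h1 : HasFDerivAt (fun q : G × ℍ[ℝ] => α q.1)
      ((fderiv ℝ α p.1).comp (ContinuousLinearMap.fst ℝ G ℍ[ℝ])) p :=
    HasFDerivAt.comp (g := α) (f := Prod.fst) (g' := fderiv ℝ α p.1)
      (f' := ContinuousLinearMap.fst ℝ G ℍ[ℝ]) p hα.hasFDerivAt hasFDerivAt_fst
  have h2 := h1.clm_apply hA.hasFDerivAt
  refine ⟨h2.differentiableAt, fun v => ?_⟩
  rw [h2.fderiv]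
  simp [add_comm]

theorem differentiableAt_formVertical (hα : DifferentiableAt ℝ α p.1) {A : G × ℍ[ℝ] → G × ℍ[ℝ]}
    (hA : DifferentiableAt ℝ A p) : DifferentiableAt ℝ (fun q => formVertical α q (A q)) p := by
  have h1 := (hasFDerivAt_form_apply hα hA.fst).1
  have h2 : DifferentiableAt ℝ (fun q : G × ℍ[ℝ] => q.2) p := differentiableAt_snd
  exact hA.snd.add ((h1.mul h2).sub (h2.mul h1))

theorem fderiv_formVertical (hα : DifferentiableAt ℝ α p.1) {A : G × ℍ[ℝ] → G × ℍ[ℝ]}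
    (hA : DifferentiableAt ℝ A p) (v : G × ℍ[ℝ]) :
    fderiv ℝ (fun q => formVertical α q (A q)) p v =
      (fderiv ℝ A p v).2
      + ((fderiv ℝ α p.1 v.1 (A p).1 + α p.1 (fderiv ℝ A p v).1) * p.2
        - p.2 * (fderiv ℝ α p.1 v.1 (A p).1 + α p.1 (fderiv ℝ A p v).1))
      + (α p.1 (A p).1 * v.2 - v.2 * α p.1 (A p).1) := by
  obtain ⟨h1, h1'⟩ := hasFDerivAt_form_apply hα hA.fst
  have h2 : DifferentiableAt ℝ (fun q : G × ℍ[ℝ] => q.2) p := differentiableAt_snd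
  have e1 : ∀ v, fderiv ℝ (fun q => (A q).1) p v = (fderiv ℝ A p v).1 := by
    intro v; rw [hA.hasFDerivAt.fst.fderiv]; rfl
  have e2 := hA.hasFDerivAt.snd
  have e3 := e2.add ((h1.hasFDerivAt.mul' h2.hasFDerivAt).sub (h2.hasFDerivAt.mul' h1.hasFDerivAt))
  have e4 : fderiv ℝ (fun q => formVertical α q (A q)) p = _ := e3.fderiv
  rw [e4]
  simp [h1', e1, fderiv_snd]
  noncomm_ring

/-- The covariant derivative along `A` of the vertical part of `B`. -/
def formCov (α : G → G →L[ℝ] ℍ[ℝ]) (A B : G × ℍ[ℝ] → G × ℍ[ℝ]) (p : G × ℍ[ℝ]) : ℍ[ℝ] :=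
  fderiv ℝ (fun q => formVertical α q (B q)) p (A p)
    + (α p.1 (A p).1 * formVertical α p (B p) - formVertical α p (B p) * α p.1 (A p).1)

/-- The structure equation for the vertical part. By the product rule the derivatives of the fields
assemble into the bracket; the antisymmetrised derivative of `α`, together with the double
commutators (Jacobi identity), leaves the curvature acting on `b`. It holds on all of `G × ℍ`,
without tangency to the sphere. -/
theorem formVertical_lieBracket (hα : DifferentiableAt ℝ α p.1) {A B : G × ℍ[ℝ] → G × ℍ[ℝ]}
    (hA : DifferentiableAt ℝ A p) (hB : DifferentiableAt ℝ B p) :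
    formVertical α p (VectorField.lieBracket ℝ A B p) = formCov α A B p - formCov α B A p
      - (formCurv α p.1 (A p).1 (B p).1 * p.2 - p.2 * formCurv α p.1 (A p).1 (B p).1) := by
  rw [formCov, formCov, fderiv_formVertical hα hA, fderiv_formVertical hα hB,
    VectorField.lieBracket, formCurv]
  simp only [formVertical, Prod.fst_sub, Prod.snd_sub, map_sub]
  noncomm_ring

/-- The vertical part along a complex vector field that is, along `G × S²`, of type `(0,1)`
in the vertical direction. -/
structure IsVerticalZeroOneNear (α : G → G →L[ℝ] ℍ[ℝ]) (A₁ A₂ : G × ℍ[ℝ] → G × ℍ[ℝ])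
    (p : G × ℍ[ℝ]) : Prop where
  diff₁ : DifferentiableAt ℝ A₁ p
  diff₂ : DifferentiableAt ℝ A₂ p
  anticomm : ∀ᶠ q in 𝓝 p, q.2 * q.2 = -1 →
    q.2 * formVertical α q (A₁ q) + formVertical α q (A₁ q) * q.2 = 0
  eq_mul : ∀ᶠ q in 𝓝 p, q.2 * q.2 = -1 →
    formVertical α q (A₂ q) = q.2 * formVertical α q (A₁ q)

namespace IsVerticalZeroOneNear

variable {A₁ A₂ B₁ B₂ : G × ℍ[ℝ] → G × ℍ[ℝ]}

theorem anticomm₂ (hA : IsVerticalZeroOneNear α A₁ A₂ p) (hp : p.2 * p.2 = -1) :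
    p.2 * formVertical α p (A₂ p) + formVertical α p (A₂ p) * p.2 = 0 := by
  rw [hA.eq_mul.self_of_nhds hp]
  have := congrArg (p.2 * ·) (hA.anticomm.self_of_nhds hp)
  simpa [mul_add, mul_assoc] using this

/-- The vertical part differs from the `ℍ`-component by a commutator with `b`, which is tangent to
`S²` anyway. -/
theorem tangent_of_anticomm (hp : p.2 * p.2 = -1) {v : G × ℍ[ℝ]}
    (hv : p.2 * formVertical α p v + formVertical α p v * p.2 = 0) :
    p.2 * v.2 + v.2 * p.2 = 0 := by
  have := anticomm_commutator hp (α p.1 v.1)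
  rw [formVertical] at hv
  have e : p.2 * v.2 + v.2 * p.2 = (p.2 * (v.2 + (α p.1 v.1 * p.2 - p.2 * α p.1 v.1)) +
      (v.2 + (α p.1 v.1 * p.2 - p.2 * α p.1 v.1)) * p.2) -
      (p.2 * (α p.1 v.1 * p.2 - p.2 * α p.1 v.1) + (α p.1 v.1 * p.2 - p.2 * α p.1 v.1) * p.2) := by
    noncomm_ring
  rw [e, hv, this, sub_zero]

/-- Differentiating `V₂ = b V₁` and `b V₁ + V₁ b = 0` along `G × S²`. -/
theorem formCov_of_tangent (hα : DifferentiableAt ℝ α p.1) (hp : p.2 * p.2 = -1)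
    (hB : IsVerticalZeroOneNear α B₁ B₂ p) {A : G × ℍ[ℝ] → G × ℍ[ℝ]}
    (hA : p.2 * formVertical α p (A p) + formVertical α p (A p) * p.2 = 0) :
    formCov α A B₂ p = formVertical α p (A p) * formVertical α p (B₁ p) + p.2 * formCov α A B₁ p ∧
    p.2 * formCov α A B₁ p + formCov α A B₁ p * p.2 +
      (formVertical α p (A p) * formVertical α p (B₁ p)
        + formVertical α p (B₁ p) * formVertical α p (A p)) = 0 := by
  have ht := tangent_of_anticomm hp hA
  have d1 := (differentiableAt_formVertical hα hB.diff₁).hasFDerivAt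
  have d2 := (differentiableAt_formVertical hα hB.diff₂).hasFDerivAt
  have h2 : HasFDerivAt (fun q : G × ℍ[ℝ] => q.2) (ContinuousLinearMap.snd ℝ G ℍ[ℝ]) p :=
    hasFDerivAt_snd
  have e0 := hB.eq_mul.self_of_nhds hp
  have a0 := hB.anticomm.self_of_nhds hp
  have f1 := d2.sub (h2.mul' d1)
  -- The relations between the vertical parts are known only for `b ∈ S²`, so they may be
  -- differentiated only in directions tangent to `G × S²`, such as `A p`.
  have z1 := fderiv_eq_zero_of_sphere hp f1.differentiableAt
    (by filter_upwards [hB.eq_mul] with q hq hqs; simp [hq hqs]) ht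
  rw [f1.fderiv] at z1
  have f2 := (h2.mul' d1).add (d1.mul' h2)
  have z2 := fderiv_eq_zero_of_sphere hp f2.differentiableAt
    (by filter_upwards [hB.anticomm] with q hq hqs; simpa using hq hqs) ht
  rw [f2.fderiv] at z2
  simp only [sub_apply, add_apply, smul_apply, ContinuousLinearMap.coe_snd', smul_eq_mul,
    MulOpposite.smul_eq_mul_unop, MulOpposite.unop_op] at z1 z2
  set D1 := fderiv ℝ (fun q => formVertical α q (B₁ q)) p (A p)
  set D2 := fderiv ℝ (fun q => formVertical α q (B₂ q)) p (A p)
  set c := α p.1 (A p).1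
  set V := formVertical α p (B₁ p)
  have hV : formVertical α p (A p) = (A p).2 + (c * p.2 - p.2 * c) := rfl
  have z1' : D2 = p.2 * D1 + (A p).2 * V := by rw [← sub_eq_zero]; exact z1
  constructor
  · simp only [formCov, e0]
    rw [hV]
    change D2 + _ = _ + p.2 * (D1 + _)
    rw [z1']
    noncomm_ring
  · simp only [formCov]
    rw [hV]
    change p.2 * (D1 + (c * V - V * c)) + (D1 + (c * V - V * c)) * p.2 + _ = 0
    -- The terms in the connection form combine into the commutator of `c` with `bV + Vb`, which is
    -- zero.
    have e : p.2 * (D1 + (c * V - V * c)) + (D1 + (c * V - V * c)) * p.2 +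
        (((A p).2 + (c * p.2 - p.2 * c)) * V + V * ((A p).2 + (c * p.2 - p.2 * c))) =
        (p.2 * D1 + (A p).2 * V + (D1 * p.2 + V * (A p).2)) +
        (c * (p.2 * V + V * p.2) - (p.2 * V + V * p.2) * c) := by noncomm_ring
    rw [e, a0, mul_zero, zero_mul, sub_zero, add_zero, ← z2]
    abel

/-- The vertical part of the bracket of two complex vector fields whose vertical parts are of type
`(0,1)` is, up to such a vertical vector, given by the curvature. -/
theorem formVertical_bracket (hα : DifferentiableAt ℝ α p.1) (hp : p.2 * p.2 = -1)
    (hA : IsVerticalZeroOneNear α A₁ A₂ p) (hB : IsVerticalZeroOneNear α B₁ B₂ p) :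
    ∃ R : ℍ[ℝ], p.2 * R + R * p.2 = 0 ∧
      formVertical α p (cBilin (fun A B => VectorField.lieBracket ℝ A B p) (A₁, A₂) (B₁, B₂)).1 =
        R - ((cBilin (fun X Y => formCurv α p.1 X Y) ((A₁ p).1, (A₂ p).1)
              ((B₁ p).1, (B₂ p).1)).1 * p.2
          - p.2 * (cBilin (fun X Y => formCurv α p.1 X Y) ((A₁ p).1, (A₂ p).1)
              ((B₁ p).1, (B₂ p).1)).1) ∧
      formVertical α p (cBilin (fun A B => VectorField.lieBracket ℝ A B p) (A₁, A₂) (B₁, B₂)).2 =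
        p.2 * R - ((cBilin (fun X Y => formCurv α p.1 X Y) ((A₁ p).1, (A₂ p).1)
              ((B₁ p).1, (B₂ p).1)).2 * p.2
          - p.2 * (cBilin (fun X Y => formCurv α p.1 X Y) ((A₁ p).1, (A₂ p).1)
              ((B₁ p).1, (B₂ p).1)).2) := by
  have a1 := hA.anticomm.self_of_nhds hp
  have a2 := hA.anticomm₂ hp
  have b1 := hB.anticomm.self_of_nhds hp
  have b2 := hB.anticomm₂ hp
  obtain ⟨p1, q1⟩ := formCov_of_tangent hα hp hB a1
  obtain ⟨p2, q2⟩ := formCov_of_tangent hα hp hB a2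
  obtain ⟨r1, s1⟩ := formCov_of_tangent hα hp hA b1
  obtain ⟨r2, s2⟩ := formCov_of_tangent hα hp hA b2
  have ea := hA.eq_mul.self_of_nhds hp
  have eb := hB.eq_mul.self_of_nhds hp
  have add : ∀ v w, formVertical α p (v + w) = formVertical α p v + formVertical α p w := by
    intro v w; simp [formVertical]; noncomm_ring
  have sub : ∀ v w, formVertical α p (v - w) = formVertical α p v - formVertical α p w := by
    intro v w; simp [formVertical]; noncomm_ring
  set b := p.2
  set VA := formVertical α p (A₁ p)
  set VB := formVertical α p (B₁ p)
  rw [ea] at q2 p2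
  rw [eb] at s2 r2
  have hx : b * VA = -(VA * b) := eq_neg_of_add_eq_zero_left a1
  have hy : b * VB = -(VB * b) := eq_neg_of_add_eq_zero_left b1
  have bb : ∀ x : ℍ[ℝ], b * (b * x) = -x := by
    intro x; rw [← mul_assoc, hp]; simp
  -- `R` is the real part of the antisymmetrised covariant derivatives. In the imaginary part,
  -- `∇_A(bV) = V(A)V + b∇_A V` and `b² = -1` turn the corresponding expression into `bR`. That `R`
  -- anticommutes with `b` uses the derivatives of both relations.
  refine ⟨(formCov α A₁ B₁ p - formCov α B₁ A₁ p) - (formCov α A₂ B₂ p - formCov α B₂ A₂ p),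
    ?_, ?_, ?_⟩
  · rw [p2, r2]
    have q2' : b * formCov α A₂ B₁ p + formCov α A₂ B₁ p * b = -(b * VA * VB + VB * (b * VA)) :=
      eq_neg_of_add_eq_zero_left q2
    have s2' : b * formCov α B₂ A₁ p + formCov α B₂ A₁ p * b = -(b * VB * VA + VA * (b * VB)) :=
      eq_neg_of_add_eq_zero_left s2
    have q1' : b * formCov α A₁ B₁ p + formCov α A₁ B₁ p * b = -(VA * VB + VB * VA) :=
      eq_neg_of_add_eq_zero_left q1
    have s1' : b * formCov α B₁ A₁ p + formCov α B₁ A₁ p * b = -(VB * VA + VA * VB) :=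
      eq_neg_of_add_eq_zero_left s1
    have u : b * ((formCov α A₁ B₁ p - formCov α B₁ A₁ p) -
        (b * VA * VB + b * formCov α A₂ B₁ p - (b * VB * VA + b * formCov α B₂ A₁ p))) +
        ((formCov α A₁ B₁ p - formCov α B₁ A₁ p) -
        (b * VA * VB + b * formCov α A₂ B₁ p - (b * VB * VA + b * formCov α B₂ A₁ p))) * b =
        (b * formCov α A₁ B₁ p + formCov α A₁ B₁ p * b)
        - (b * formCov α B₁ A₁ p + formCov α B₁ A₁ p * b)
        - b * (b * formCov α A₂ B₁ p + formCov α A₂ B₁ p * b)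
        + b * (b * formCov α B₂ A₁ p + formCov α B₂ A₁ p * b)
        - (b * (b * (VA * VB)) + b * (VA * (VB * b)))
        + (b * (b * (VB * VA)) + b * (VB * (VA * b))) := by noncomm_ring
    rw [u, q1', s1', q2', s2']
    have c1 : VB * b = -(b * VB) := by rw [hy, neg_neg]
    have c2 : VA * b = -(b * VA) := by rw [hx, neg_neg]
    have c3 : ∀ x, VB * (b * x) = -(b * (VB * x)) := by
      intro x; rw [← mul_assoc, c1, neg_mul, mul_assoc]
    have c4 : ∀ x, VA * (b * x) = -(b * (VA * x)) := by
      intro x; rw [← mul_assoc, c2, neg_mul, mul_assoc]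
    simp only [mul_assoc, mul_add, mul_neg, c1, c2, c3, c4, bb, neg_neg]
    abel
  · simp only [cBilin, sub]
    rw [formVertical_lieBracket hα hA.diff₁ hB.diff₁, formVertical_lieBracket hα hA.diff₂ hB.diff₂]
    noncomm_ring
  · simp only [cBilin, add]
    rw [formVertical_lieBracket hα hA.diff₁ hB.diff₂, formVertical_lieBracket hα hA.diff₂ hB.diff₁,
      p1, p2, r1, r2]
    simp only [mul_assoc, mul_sub, mul_add, bb]
    noncomm_ring

end IsVerticalZeroOneNear

end Flat

/-! ## The horizontal part of brackets -/

section FlatHorizontal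

variable {G : Type*} [NormedAddCommGroup G] [NormedSpace ℝ G] {k : ℕ}

instance HVec.clmNormedAddCommGroup : NormedAddCommGroup (HVec k →L[ℝ] G) :=
  ContinuousLinearMap.toNormedAddCommGroup

instance HVec.clmNormedSpace : NormedSpace ℝ (HVec k →L[ℝ] G) :=
  ContinuousLinearMap.toNormedSpace

/-- The torsion of the fields `θ ξ`, `θ η`, for an anchor map `θ` and a connection form `Γ`. -/
def formTorsion (θ : G → HVec k →L[ℝ] G) (Γ : G → HVec k → HVec k) (z : G) (ξ η : HVec k) : G :=
  θ z (Γ (θ z ξ) η - Γ (θ z η) ξ) - (fderiv ℝ θ z (θ z ξ) η - fderiv ℝ θ z (θ z η) ξ)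

/-- The covariant derivative of `ξ` in the direction `v`. -/
def vecCov (Γ : G → HVec k → HVec k) (ξ : G × ℍ[ℝ] → HVec k) (p v : G × ℍ[ℝ]) : HVec k :=
  fderiv ℝ ξ p v + Γ v.1 (ξ p)

/-- The complex vector field `A₁ + i A₂` projects near `p` to the image under the anchor map `θ` of
a section `ξ₁ + i ξ₂` which lies in `ker (b + i)` at the points `(z, b)` with `b ∈ S²`. -/
structure IsAnchoredNear (θ : G → HVec k →L[ℝ] G) (A₁ A₂ : G × ℍ[ℝ] → G × ℍ[ℝ])
    (ξ₁ ξ₂ : G × ℍ[ℝ] → HVec k) (p : G × ℍ[ℝ]) : Prop where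
  diff₁ : DifferentiableAt ℝ ξ₁ p
  diff₂ : DifferentiableAt ℝ ξ₂ p
  anchor₁ : ∀ᶠ q in 𝓝 p, (A₁ q).1 = θ q.1 (ξ₁ q)
  anchor₂ : ∀ᶠ q in 𝓝 p, (A₂ q).1 = θ q.1 (ξ₂ q)
  eigen : ∀ᶠ q in 𝓝 p, q.2 * q.2 = -1 → ξ₂ q = leftMul k q.2 (ξ₁ q)

variable {θ : G → HVec k →L[ℝ] G} {Γ : G → HVec k → HVec k} {α : G → G →L[ℝ] ℍ[ℝ]}
  {p : G × ℍ[ℝ]}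

set_option synthInstance.maxHeartbeats 200000 in
theorem fderiv_anchor (hθ : DifferentiableAt ℝ θ p.1) {B : G × ℍ[ℝ] → G × ℍ[ℝ]}
    {ξ : G × ℍ[ℝ] → HVec k} (hB : DifferentiableAt ℝ B p) (hξ : DifferentiableAt ℝ ξ p)
    (h : ∀ᶠ q in 𝓝 p, (B q).1 = θ q.1 (ξ q)) (v : G × ℍ[ℝ]) :
    (fderiv ℝ B p v).1 = fderiv ℝ θ p.1 v.1 (ξ p) + θ p.1 (fderiv ℝ ξ p v) := by
  have h1 : HasFDerivAt (fun q : G × ℍ[ℝ] => θ q.1)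
      ((fderiv ℝ θ p.1).comp (ContinuousLinearMap.fst ℝ G ℍ[ℝ])) p :=
    HasFDerivAt.comp (g := θ) (f := Prod.fst) (g' := fderiv ℝ θ p.1)
      (f' := ContinuousLinearMap.fst ℝ G ℍ[ℝ]) p hθ.hasFDerivAt hasFDerivAt_fst
  have h2 := h1.clm_apply hξ.hasFDerivAt
  have h3 := h2.congr_of_eventuallyEq h
  have h4 := h3.unique hB.hasFDerivAt.fst
  have := congrArg (fun f : G × ℍ[ℝ] →L[ℝ] G => f v) h4
  simp only [ContinuousLinearMap.comp_apply, ContinuousLinearMap.coe_fst'] at this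
  rw [← this]
  simp [add_comm]

/-- The structure equation for the projection, obtained by differentiating `θ ξ` and `θ η`. The form
`Γ` is arbitrary here: its contributions to the covariant derivatives and to the torsion cancel. -/
theorem lieBracket_fst_anchor (hθ : DifferentiableAt ℝ θ p.1) {A B : G × ℍ[ℝ] → G × ℍ[ℝ]}
    {ξ η : G × ℍ[ℝ] → HVec k} (hA : DifferentiableAt ℝ A p) (hB : DifferentiableAt ℝ B p)
    (hξ : DifferentiableAt ℝ ξ p) (hη : DifferentiableAt ℝ η p)
    (h : ∀ᶠ q in 𝓝 p, (A q).1 = θ q.1 (ξ q)) (h' : ∀ᶠ q in 𝓝 p, (B q).1 = θ q.1 (η q)) :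
    (VectorField.lieBracket ℝ A B p).1 =
      θ p.1 (vecCov Γ η p (A p) - vecCov Γ ξ p (B p)) - formTorsion θ Γ p.1 (ξ p) (η p) := by
  rw [VectorField.lieBracket, Prod.fst_sub, fderiv_anchor hθ hB hη h', fderiv_anchor hθ hA hξ h,
    vecCov, vecCov, formTorsion, h.self_of_nhds, h'.self_of_nhds]
  simp only [map_sub, map_add]
  abel

variable {A₁ A₂ B₁ B₂ : G × ℍ[ℝ] → G × ℍ[ℝ]} {ξ₁ ξ₂ η₁ η₂ : G × ℍ[ℝ] → HVec k}

/-- This is the Leibniz rule for `η₂ = bη₁` along `G × S²`. By `hΓ`, commuting `Γ` past left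
multiplication adds `[α, b]` to the derivative of `b`, and together these are the vertical part of
`v`. -/
theorem IsAnchoredNear.vecCov_of_tangent
    (hΓ : ∀ X b η, Γ X (leftMul k b η) =
      leftMul k b (Γ X η) + leftMul k (α p.1 X * b - b * α p.1 X) η)
    (hp : p.2 * p.2 = -1) (hB : IsAnchoredNear θ B₁ B₂ η₁ η₂ p) {v : G × ℍ[ℝ]}
    (hv : p.2 * formVertical α p v + formVertical α p v * p.2 = 0) :
    vecCov Γ η₂ p v = leftMul k (formVertical α p v) (η₁ p) + leftMul k p.2 (vecCov Γ η₁ p v) := by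
  have ht := IsVerticalZeroOneNear.tangent_of_anticomm hp hv
  have h2 : DifferentiableAt ℝ (fun q : G × ℍ[ℝ] => q.2) p := differentiableAt_snd
  have d := hB.diff₂.sub (DifferentiableAt.leftMul h2 hB.diff₁)
  have z := fderiv_eq_zero_of_sphere hp d
    (by filter_upwards [hB.eigen] with q hq hqs; simp [hq hqs]) ht
  rw [fderiv_sub hB.diff₂ (DifferentiableAt.leftMul h2 hB.diff₁), sub_apply,
    fderiv_leftMul h2 hB.diff₁, fderiv_snd] at z
  rw [vecCov, vecCov, sub_eq_zero.1 z, hB.eigen.self_of_nhds hp, hΓ, formVertical, leftMul_add]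
  simp only [map_add, add_apply, ContinuousLinearMap.coe_snd']
  abel

/-- The projection to `G` of the bracket of two complex vector fields which project to
sections of the image under `θ` of `ker (b + i)` is, up to such a vector, given by the torsion. -/
theorem IsAnchoredNear.lieBracket_fst (hθ : DifferentiableAt ℝ θ p.1)
    (hΓ : ∀ X b η, Γ X (leftMul k b η) =
      leftMul k b (Γ X η) + leftMul k (α p.1 X * b - b * α p.1 X) η)
    (hp : p.2 * p.2 = -1) (hA : IsAnchoredNear θ A₁ A₂ ξ₁ ξ₂ p)
    (hB : IsAnchoredNear θ B₁ B₂ η₁ η₂ p) (vA : IsVerticalZeroOneNear α A₁ A₂ p)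
    (vB : IsVerticalZeroOneNear α B₁ B₂ p) :
    ∃ ζ : HVec k,
      (cBilin (fun A B => VectorField.lieBracket ℝ A B p) (A₁, A₂) (B₁, B₂)).1.1 =
        θ p.1 ζ - (cBilin (formTorsion θ Γ p.1) (ξ₁ p, ξ₂ p) (η₁ p, η₂ p)).1 ∧
      (cBilin (fun A B => VectorField.lieBracket ℝ A B p) (A₁, A₂) (B₁, B₂)).2.1 =
        θ p.1 (leftMul k p.2 ζ) - (cBilin (formTorsion θ Γ p.1) (ξ₁ p, ξ₂ p) (η₁ p, η₂ p)).2 := by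
  have a1 := vA.anticomm.self_of_nhds hp
  have a2 := vA.anticomm₂ hp
  have b1 := vB.anticomm.self_of_nhds hp
  have b2 := vB.anticomm₂ hp
  have p1 := hB.vecCov_of_tangent hΓ hp a1
  have p2 := hB.vecCov_of_tangent hΓ hp a2
  have r1 := hA.vecCov_of_tangent hΓ hp b1
  have r2 := hA.vecCov_of_tangent hΓ hp b2
  rw [vA.eq_mul.self_of_nhds hp] at p2
  rw [vB.eq_mul.self_of_nhds hp] at r2
  have L11 := lieBracket_fst_anchor (Γ := Γ) hθ vA.diff₁ vB.diff₁ hA.diff₁ hB.diff₁ hA.anchor₁ hB.anchor₁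
  have L12 := lieBracket_fst_anchor (Γ := Γ) hθ vA.diff₁ vB.diff₂ hA.diff₁ hB.diff₂ hA.anchor₁ hB.anchor₂
  have L21 := lieBracket_fst_anchor (Γ := Γ) hθ vA.diff₂ vB.diff₁ hA.diff₂ hB.diff₁ hA.anchor₂ hB.anchor₁
  have L22 := lieBracket_fst_anchor (Γ := Γ) hθ vA.diff₂ vB.diff₂ hA.diff₂ hB.diff₂ hA.anchor₂ hB.anchor₂
  -- `ζ` is the real part of `∇_A η - ∇_B ξ`. The previous Leibniz rule and `b² = -1` show that the
  -- imaginary part is `bζ`, so the covariant contribution stays in `ker (b + i)`.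
  refine ⟨(vecCov Γ η₁ p (A₁ p) - vecCov Γ ξ₁ p (B₁ p))
    - (vecCov Γ η₂ p (A₂ p) - vecCov Γ ξ₂ p (B₂ p)), ?_, ?_⟩
  · simp only [cBilin, Prod.fst_sub, L11, L22]
    simp only [map_sub]
    abel
  · simp only [cBilin, Prod.fst_add, L12, L21]
    rw [p1, p2, r1, r2]
    simp only [leftMul_mul, map_sub, map_add, leftMul_leftMul_of_sq hp, map_neg]
    abel

end FlatHorizontal

/-! ### The standard quaternion units. -/

/-- The quaternion `i`. -/
def quatI : ℍ[ℝ] := ⟨0, 1, 0, 0⟩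

/-- The quaternion `j`. -/
def quatJ : ℍ[ℝ] := ⟨0, 0, 1, 0⟩

/-- The quaternion `k`. -/
def quatK : ℍ[ℝ] := ⟨0, 0, 0, 1⟩

theorem quatI_re : quatI.re = 0 := rfl
theorem quatI_imI : quatI.imI = 1 := rfl
theorem quatI_imJ : quatI.imJ = 0 := rfl
theorem quatI_imK : quatI.imK = 0 := rfl
theorem quatJ_re : quatJ.re = 0 := rfl
theorem quatJ_imI : quatJ.imI = 0 := rfl
theorem quatJ_imJ : quatJ.imJ = 1 := rfl
theorem quatJ_imK : quatJ.imK = 0 := rfl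
theorem quatK_re : quatK.re = 0 := rfl
theorem quatK_imI : quatK.imI = 0 := rfl
theorem quatK_imJ : quatK.imJ = 0 := rfl
theorem quatK_imK : quatK.imK = 1 := rfl

attribute [local simp] quatI_re quatI_imI quatI_imJ quatI_imK quatJ_re quatJ_imI quatJ_imJ
  quatJ_imK quatK_re quatK_imI quatK_imJ quatK_imK

theorem quatI_mul_self : quatI * quatI = -1 := by
  ext <;> simp only [Quaternion.re_mul, Quaternion.imI_mul, Quaternion.imJ_mul,
    Quaternion.imK_mul] <;> simp

/-! ## Conjugation by frames -/

section FrameConj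

variable {k : ℕ} {V : Type*} [AddCommGroup V] [Module ℝ V] [TopologicalSpace V]
  (u : HVec k ≃L[ℝ] V)

theorem frameConj_apply (a : ℍ[ℝ]) (v : V) : frameConj u a v = u (leftMul k a (u.symm v)) := rfl

theorem frameConj_apply_apply (a : ℍ[ℝ]) (ξ : HVec k) :
    frameConj u a (u ξ) = u (leftMul k a ξ) := by
  simp [frameConj_apply]

theorem frameConj_comp (a b : ℍ[ℝ]) :
    (frameConj u a).comp (frameConj u b) = frameConj u (a * b) := by
  ext v
  simp [frameConj_apply, leftMul_mul]

theorem frameConj_injective [NeZero k] : Function.Injective (frameConj u) := by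
  intro a b h
  apply leftMul_injective (k := k)
  ext1 ξ
  have := congrArg (fun f : V →L[ℝ] V => u.symm (f (u ξ))) h
  simpa [frameConj_apply_apply] using this

variable [IsTopologicalAddGroup V]

theorem frameConj_add (a b : ℍ[ℝ]) : frameConj u (a + b) = frameConj u a + frameConj u b := by
  ext v
  simp [frameConj_apply, leftMul_add]

theorem frameConj_sub (a b : ℍ[ℝ]) : frameConj u (a - b) = frameConj u a - frameConj u b := by
  ext v
  simp [frameConj_apply, leftMul_sub]

end FrameConj

/-- Right multiplication by a matrix commutes with left multiplication by scalars, so only the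
`Sp(1)` factor is seen, by conjugation. -/
theorem IsQuaternionicIso.exists_conj {k : ℕ} {g : HVec k ≃L[ℝ] HVec k}
    (hg : IsQuaternionicIso g) : ∃ a : ℍ[ℝ], ‖a‖ = 1 ∧
      ∀ b ξ, g (leftMul k b ξ) = leftMul k (a * b * a⁻¹) (g ξ) := by
  obtain ⟨a, A, ha, h⟩ := hg
  have ha0 : a ≠ 0 := by rintro rfl; simp at ha
  refine ⟨a, ha, fun b ξ => ?_⟩
  have : Matrix.vecMul (leftMul k b ξ) (↑A⁻¹ : Matrix (Fin k) (Fin k) ℍ[ℝ]) =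
      leftMul k b (Matrix.vecMul ξ (↑A⁻¹ : Matrix (Fin k) (Fin k) ℍ[ℝ])) := by
    funext i
    simp [leftMul, Matrix.vecMul, dotProduct, Finset.mul_sum, mul_assoc]
  rw [h, h, this, ← leftMul_mul, ← leftMul_mul, inv_mul_cancel_right₀ ha0]

theorem isQuaternionicIso_of_unit {k : ℕ} (a : ℍ[ℝ]) (ha : ‖a‖ = 1) :
    ∃ g : HVec k ≃L[ℝ] HVec k, IsQuaternionicIso g ∧ ∀ ξ, g ξ = leftMul k a ξ := by
  have ha0 : a ≠ 0 := by rintro rfl; simp at ha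
  let g : HVec k ≃L[ℝ] HVec k := ContinuousLinearEquiv.equivOfInverse (leftMul k a) (leftMul k a⁻¹)
    (fun ξ => by rw [← leftMul_mul, inv_mul_cancel₀ ha0, leftMul_one])
    (fun ξ => by rw [← leftMul_mul, mul_inv_cancel₀ ha0, leftMul_one])
  refine ⟨g, ⟨a, 1, ha, fun ξ => ?_⟩, fun ξ => rfl⟩
  have : g ξ = leftMul k a ξ := rfl
  simp [this]

/-- The unit quaternions act transitively, by conjugation, on the unit imaginary ones. -/
theorem exists_conj_eq {b : ℍ[ℝ]} (hb : b * b = -1) :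
    ∃ a : ℍ[ℝ], ‖a‖ = 1 ∧ a * quatI * a⁻¹ = b := by
  suffices h : ∃ a : ℍ[ℝ], a ≠ 0 ∧ a * quatI = b * a by
    obtain ⟨a, ha, h⟩ := h
    have hn : ‖a‖ ≠ 0 := norm_ne_zero_iff.2 ha
    refine ⟨‖a‖⁻¹ • a, ?_, ?_⟩
    · rw [norm_smul, norm_inv, norm_norm, inv_mul_cancel₀ hn]
    · have h1 : ‖a‖⁻¹ • a ≠ 0 := smul_ne_zero (inv_ne_zero hn) ha
      rw [smul_mul_assoc, h, ← mul_smul_comm, mul_assoc, mul_inv_cancel₀ h1, mul_one]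
  -- The element `1 - bi` intertwines: `(1 - bi)i = i + b = b(1 - bi)`. It vanishes only for `b =
  -- -i`, and then `j` does the job.
  by_cases h : 1 - b * quatI = 0
  · refine ⟨quatJ, ?_, ?_⟩
    · intro h0
      have := congrArg QuaternionAlgebra.imJ h0
      simp at this
    · have hbi : b = -quatI := by
        have : b * (1 - b * quatI) = b + quatI := by
          rw [mul_sub, mul_one, ← mul_assoc, hb]; simp
        rw [h, mul_zero] at this
        exact eq_neg_of_add_eq_zero_left this.symm
      rw [hbi]
      ext <;> simp only [Quaternion.re_mul, Quaternion.imI_mul, Quaternion.imJ_mul,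
        Quaternion.imK_mul] <;> simp
  · refine ⟨1 - b * quatI, h, ?_⟩
    have e1 : (1 - b * quatI) * quatI = quatI - b * (quatI * quatI) := by noncomm_ring
    have e2 : b * (1 - b * quatI) = b - (b * b) * quatI := by noncomm_ring
    rw [e1, e2, quatI_mul_self, hb]
    noncomm_ring

/-- For `V₁, V₂ ⊥ i`, the vector `V₁ + i V₂` is orthogonal to `j + i k` if and only if it is of type
`(0,1)`. -/
theorem orthogonal_iff_eq_mul {V₁ V₂ : ℍ[ℝ]}
    (h₁ : quatI * V₁ + V₁ * quatI = 0)
    (h₂ : quatI * V₂ + V₂ * quatI = 0) :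
    (inner ℝ V₁ quatJ - inner ℝ V₂ quatK = 0 ∧
      inner ℝ V₁ quatK + inner ℝ V₂ quatJ = 0) ↔
    V₂ = quatI * V₁ := by
  obtain ⟨r1, s1⟩ := (anticomm_iff quatI_mul_self).1 h₁
  obtain ⟨r2, s2⟩ := (anticomm_iff quatI_mul_self).1 h₂
  rw [Quaternion.inner_def] at s1 s2
  simp only [Quaternion.re_mul, Quaternion.re_star, Quaternion.imI_star, Quaternion.imJ_star,
    Quaternion.imK_star] at s1 s2
  simp at s1 s2
  rw [Quaternion.ext_iff]
  simp only [Quaternion.inner_def, Quaternion.re_mul, Quaternion.re_star, Quaternion.imI_star,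
    Quaternion.imJ_star, Quaternion.imK_star, Quaternion.imI_mul, Quaternion.imJ_mul,
    Quaternion.imK_mul]
  simp [r1, r2, s1, s2]
  constructor
  · rintro ⟨h, h'⟩; constructor <;> linarith
  · rintro ⟨h, h'⟩; constructor <;> linarith

/-! ### The fibres of `Q` and `Z` in an admissible frame. -/

section Fibres

variable {n k : ℕ} {M : Type*} [TopologicalSpace M] [ChartedSpace (EuclideanSpace ℝ (Fin n)) M]
  {E : M → Type*} [TopologicalSpace (TotalSpace (HVec k) E)]
  [∀ x, AddCommGroup (E x)] [∀ x, Module ℝ (E x)] [∀ x, TopologicalSpace (E x)]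
  [∀ x, IsTopologicalAddGroup (E x)] [∀ x, ContinuousSMul ℝ (E x)]
  [FiberBundle (HVec k) E]

namespace QuaternionicStructure

variable (S : QuaternionicStructure n k E) {x : M} {u u' : HVec k ≃L[ℝ] E x}

/-- A change of admissible frame acts on quaternionic coordinates by conjugation with a unit
quaternion. Membership in `Q` and `Z` can therefore be tested in any one frame. -/
theorem exists_frameConj_eq (hu : u ∈ S.frames x) (hu' : u' ∈ S.frames x) :
    ∃ a : ℍ[ℝ], ‖a‖ = 1 ∧ ∀ b, frameConj u' b = frameConj u (a * b * a⁻¹) := by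
  obtain ⟨g, hg, rfl⟩ := (S.orbit x u hu u').1 hu'
  obtain ⟨a, ha, h⟩ := hg.exists_conj
  refine ⟨a, ha, fun b => ?_⟩
  ext v
  simp [frameConj_apply, h]

theorem conj_anticomm {a b w : ℍ[ℝ]} (ha : ‖a‖ = 1) :
    a * b * a⁻¹ * (a * w * a⁻¹) + a * w * a⁻¹ * (a * b * a⁻¹) = a * (b * w + w * b) * a⁻¹ := by
  have ha0 : a ≠ 0 := by rintro rfl; simp at ha
  have : ∀ c d : ℍ[ℝ], a * c * a⁻¹ * (a * d * a⁻¹) = a * (c * d) * a⁻¹ := by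
    intro c d
    simp only [mul_assoc, inv_mul_cancel_left₀ ha0]
  rw [this, this]
  noncomm_ring

theorem conj_mul {a c d : ℍ[ℝ]} (ha : ‖a‖ = 1) :
    a * c * a⁻¹ * (a * d * a⁻¹) = a * (c * d) * a⁻¹ := by
  have ha0 : a ≠ 0 := by rintro rfl; simp at ha
  simp only [mul_assoc, inv_mul_cancel_left₀ ha0]

theorem conj_re {a b : ℍ[ℝ]} (ha : ‖a‖ = 1) : (a * b * a⁻¹).re = b.re := by
  have ha0 : a ≠ 0 := by rintro rfl; simp at ha
  have : ∀ c d : ℍ[ℝ], (c * d).re = (d * c).re := by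
    intro c d; rw [Quaternion.re_mul, Quaternion.re_mul]; ring
  rw [this, inv_mul_cancel_left₀ ha0]

theorem mem_Z_iff (hu : u ∈ S.frames x) {J : E x →L[ℝ] E x} :
    J ∈ S.Z x ↔ ∃ a : ℍ[ℝ], a * a = -1 ∧ J = frameConj u a := by
  constructor
  · rintro ⟨u', hu', b, hb, rfl⟩
    obtain ⟨a, ha, h⟩ := S.exists_frameConj_eq hu hu'
    have ha0 : a ≠ 0 := by rintro rfl; simp at ha
    exact ⟨_, by rw [conj_mul ha, hb]; simp [ha0], h b⟩
  · rintro ⟨a, ha, rfl⟩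
    exact ⟨u, hu, a, ha, rfl⟩

theorem frameConj_mem_Q_iff [NeZero k] (hu : u ∈ S.frames x) {a : ℍ[ℝ]} :
    frameConj u a ∈ S.Q x ↔ a.re = 0 := by
  constructor
  · rintro ⟨u', hu', b, hb, e⟩
    obtain ⟨c, hc, h⟩ := S.exists_frameConj_eq hu hu'
    rw [h] at e
    rw [frameConj_injective u e, conj_re hc, hb]
  · intro ha
    exact ⟨u, hu, a, ha, rfl⟩

theorem frameConj_mem_zeroOne_iff [NeZero k] (hu : u ∈ S.frames x) {b V₁ V₂ : ℍ[ℝ]}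
    (hb : b * b = -1) :
    (frameConj u V₁, frameConj u V₂) ∈ S.zeroOne (frameConj u b) ↔
      b * V₁ + V₁ * b = 0 ∧ V₂ = b * V₁ := by
  rw [zeroOne, mem_ofPred_eq, S.frameConj_mem_Q_iff hu,
    qInner_frameConj _ _ _ (re_eq_zero_of_mul_self hb), anticomm_iff hb, frameConj_comp,
    (frameConj_injective u).eq_iff, and_assoc]

/-- Rotating the frame by a unit `a` with `a i a⁻¹ = b` gives an admissible frame in which the
structure is `i`. -/
theorem exists_isPositiveOrthonormal (hu : u ∈ S.frames x) {b : ℍ[ℝ]} (hb : b * b = -1) :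
    ∃ J' J'', S.IsPositiveOrthonormal (frameConj u b) J' J'' := by
  obtain ⟨a, ha, h⟩ := exists_conj_eq hb
  have ha0 : a ≠ 0 := by rintro rfl; simp at ha
  obtain ⟨g, hg, hga⟩ := isQuaternionicIso_of_unit (k := k) a ha
  refine ⟨_, _, g.trans u, (S.orbit x u hu _).2 ⟨g, hg, rfl⟩, ?_, rfl, rfl⟩
  change _ = frameConj (g.trans u) quatI
  ext v
  have e : ∀ ξ, g.symm ξ = leftMul k a⁻¹ ξ := by
    intro ξ
    rw [ContinuousLinearEquiv.symm_apply_eq, hga, ← leftMul_mul, mul_inv_cancel₀ ha0, leftMul_one]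
  have e' : (g.trans u).symm v = g.symm (u.symm v) := rfl
  rw [frameConj_apply, frameConj_apply, e', e, ContinuousLinearEquiv.trans_apply, hga,
    ← leftMul_mul, ← leftMul_mul, ← h, mul_assoc]

/-- In a frame adapted to `(J, J', J'')` this is `orthogonal_iff_eq_mul`: in the complexified plane
`J^⊥`, the isotropic vector `J' + iJ''` is orthogonal exactly to its own multiples, the `(0,1)`
vectors. The right-hand side does not involve `J'`, `J''`, so the condition is independent of their
choice. -/
theorem qInnerC_eq_zero_iff [NeZero k] (hu : u ∈ S.frames x) {b V₁ V₂ : ℍ[ℝ]}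
    (h₁ : b * V₁ + V₁ * b = 0) (h₂ : b * V₂ + V₂ * b = 0) {J' J'' : E x →L[ℝ] E x}
    (h : S.IsPositiveOrthonormal (frameConj u b) J' J'') :
    qInnerC k (frameConj u V₁, frameConj u V₂) (J', J'') = 0 ↔ V₂ = b * V₁ := by
  obtain ⟨u₀, hu₀, hJ, rfl, rfl⟩ : ∃ u₀ ∈ S.frames x, frameConj u b = frameConj u₀ quatI ∧
    J' = frameConj u₀ quatJ ∧ J'' = frameConj u₀ quatK := h
  obtain ⟨a, ha, h⟩ := S.exists_frameConj_eq hu₀ hu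
  have ha0 : a ≠ 0 := by rintro rfl; simp at ha
  rw [h] at hJ
  have hb := frameConj_injective u₀ hJ
  have e1 := conj_anticomm (a := a) (b := b) (w := V₁) ha
  have e2 := conj_anticomm (a := a) (b := b) (w := V₂) ha
  rw [h₁, hb, mul_zero, zero_mul] at e1
  rw [h₂, hb, mul_zero, zero_mul] at e2
  have r1 := ((anticomm_iff quatI_mul_self).1 e1).1
  have r2 := ((anticomm_iff quatI_mul_self).1 e2).1
  rw [qInnerC, Complex.ext_iff]
  simp only [cBilin, h, qInner_frameConj u₀ _ _ r1, qInner_frameConj u₀ _ _ r2, Complex.zero_re,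
    Complex.zero_im]
  rw [orthogonal_iff_eq_mul e1 e2, ← hb, conj_mul ha]
  constructor
  · intro e
    have := congrArg (fun c => a⁻¹ * c * a) e
    simpa [mul_assoc, ha0] using this
  · rintro rfl; rfl

end QuaternionicStructure

end Fibres

instance HVec.finiteDimensional (k : ℕ) : FiniteDimensional ℝ (HVec k) :=
  Module.Finite.pi

/-! ## Smoothness of families of linear maps -/

/-- Since `F₁` has finite dimension, a linear map is a finite tuple of its values on a basis. -/
theorem contMDiffAt_clm_of_apply {EN HN N F₁ F₂ : Type*} [NormedAddCommGroup EN] [NormedSpace ℝ EN]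
    [TopologicalSpace HN] {I : ModelWithCorners ℝ EN HN} [TopologicalSpace N] [ChartedSpace HN N]
    [NormedAddCommGroup F₁] [NormedSpace ℝ F₁] [FiniteDimensional ℝ F₁]
    [NormedAddCommGroup F₂] [NormedSpace ℝ F₂] {m : WithTop ℕ∞} {g : N → F₁ →L[ℝ] F₂} {x : N}
    (h : ∀ v, ContMDiffAt I 𝓘(ℝ, F₂) m (fun y => g y v) x) :
    ContMDiffAt I 𝓘(ℝ, F₁ →L[ℝ] F₂) m g x := by
  let d := Module.finrank ℝ F₁
  have hd : d = Module.finrank ℝ (Fin d → ℝ) := (Module.finrank_fin_fun ℝ).symm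
  let e₁ := ContinuousLinearEquiv.ofFinrankEq hd
  let e₂ := (e₁.arrowCongr (1 : F₂ ≃L[ℝ] F₂)).trans (ContinuousLinearEquiv.piRing (Fin d))
  have h2 : ContMDiffAt I 𝓘(ℝ, Fin d → F₂) m (fun y => e₂ (g y)) x := by
    rw [contMDiffAt_pi_space]
    intro i
    exact h _
  have h3 : g = fun y => e₂.symm (e₂ (g y)) := by
    funext y; simp
  rw [h3]
  exact (e₂.symm.contDiff.contMDiff (n := m)).contMDiffAt.comp x h2

/-! ### Smooth local frames of `E` and coordinates in them. -/

section Frames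

variable {n k : ℕ} {M : Type*} [TopologicalSpace M] [ChartedSpace (EuclideanSpace ℝ (Fin n)) M]
  {E : M → Type*} [TopologicalSpace (TotalSpace (HVec k) E)]
  [∀ x, AddCommGroup (E x)] [∀ x, Module ℝ (E x)] [∀ x, TopologicalSpace (E x)]
  [∀ x, IsTopologicalAddGroup (E x)] [∀ x, ContinuousSMul ℝ (E x)]
  [FiberBundle (HVec k) E] [VectorBundle ℝ (HVec k) E]

/-- The frame `u`, read in the trivialization of `E` at `x`. -/
def frameRep (u : ∀ y, HVec k ≃L[ℝ] E y) (x y : M) : HVec k →L[ℝ] HVec k :=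
  ((trivializationAt (HVec k) E x).continuousLinearMapAt ℝ y).comp (u y : HVec k →L[ℝ] E y)

theorem trivializationAt_frame (u : ∀ y, HVec k ≃L[ℝ] E y) {x y : M}
    (hy : y ∈ (trivializationAt (HVec k) E x).baseSet) (ξ : HVec k) :
    (trivializationAt (HVec k) E x ⟨y, u y ξ⟩).2 = frameRep u x y ξ := by
  simp [frameRep, Trivialization.coe_linearMapAt_of_mem _ hy]

theorem frameRep_inverse_apply (u : ∀ y, HVec k ≃L[ℝ] E y) {x y : M}
    (hy : y ∈ (trivializationAt (HVec k) E x).baseSet) (v : E y) :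
    (frameRep u x y).inverse (trivializationAt (HVec k) E x ⟨y, v⟩).2 = (u y).symm v := by
  let e' := (trivializationAt (HVec k) E x).continuousLinearEquivAt ℝ y hy
  have e : frameRep u x y = (((u y).trans e' : HVec k ≃L[ℝ] HVec k) : HVec k →L[ℝ] HVec k) := by
    ext ξ : 1
    rw [← trivializationAt_frame u hy]
    rfl
  rw [e, ContinuousLinearMap.inverse_equiv]
  have h1 : (trivializationAt (HVec k) E x ⟨y, v⟩).2 = e' v := rfl
  have h2 : ((((u y).trans e').symm : HVec k ≃L[ℝ] HVec k) : HVec k →L[ℝ] HVec k) (e' v) =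
    (u y).symm (e'.symm (e' v)) := rfl
  rw [h1, h2, ContinuousLinearEquiv.symm_apply_apply]

/-- `u` is a smooth local frame on the open set `U`. -/
def IsSmoothFrame (n : ℕ) [ChartedSpace (EuclideanSpace ℝ (Fin n)) M] (U : Set M)
    (u : ∀ x, HVec k ≃L[ℝ] E x) : Prop :=
  IsOpen U ∧ ∀ ξ : HVec k, ContMDiffOn (𝓡 n) ((𝓡 n).prod 𝓘(ℝ, HVec k)) ∞
      (fun x => TotalSpace.mk' (HVec k) x (u x ξ)) U

namespace IsSmoothFrame

variable {U : Set M} {u : ∀ x, HVec k ≃L[ℝ] E x} (hu : IsSmoothFrame n U u) {x : M}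
include hu

theorem contMDiffAt_frameRep (hx : x ∈ U) :
    ContMDiffAt (𝓡 n) 𝓘(ℝ, HVec k →L[ℝ] HVec k) ∞ (frameRep u x) x := by
  apply contMDiffAt_clm_of_apply
  intro ξ
  have h := (contMDiffAt_section x).1 ((hu.2 ξ).contMDiffAt (hu.1.mem_nhds hx))
  refine h.congr_of_eventuallyEq ?_
  filter_upwards [(trivializationAt (HVec k) E x).open_baseSet.mem_nhds
    (FiberBundle.mem_baseSet_trivializationAt' x)] with y hy
  exact (trivializationAt_frame u hy ξ).symm

/-- Inversion is smooth near an invertible operator; this makes the coordinates of a smooth section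
in a smooth frame smooth. -/
theorem contMDiffAt_frameRep_inverse (hx : x ∈ U) :
    ContMDiffAt (𝓡 n) 𝓘(ℝ, HVec k →L[ℝ] HVec k) ∞ (fun y => (frameRep u x y).inverse) x := by
  have hy := FiberBundle.mem_baseSet_trivializationAt' (F := HVec k) (E := E) x
  let e : HVec k ≃L[ℝ] HVec k := (u x).trans
      ((trivializationAt (HVec k) E x).continuousLinearEquivAt ℝ x hy)
  have he : frameRep u x x = (e : HVec k →L[ℝ] HVec k) := by
    ext ξ : 1
    rw [← trivializationAt_frame u hy]
    rfl
  have h1 : ContDiffAt ℝ ∞ (ContinuousLinearMap.inverse : (HVec k →L[ℝ] HVec k) → _)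
    (frameRep u x x) := by
    rw [he]; exact contDiffAt_map_inverse e
  exact h1.contMDiffAt.comp x (hu.contMDiffAt_frameRep hx)

section Maps

variable {EN HN N : Type*} [NormedAddCommGroup EN] [NormedSpace ℝ EN]
    [TopologicalSpace HN] {I : ModelWithCorners ℝ EN HN} [TopologicalSpace N] [ChartedSpace HN N]
    {f : N → M} {p : N}

theorem eventually_baseSet (hf : ContinuousAt f p) :
    ∀ᶠ q in 𝓝 p, f q ∈ (trivializationAt (HVec k) E (f p)).baseSet :=
  hf.eventually ((trivializationAt (HVec k) E (f p)).open_baseSet.mem_nhds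
    (FiberBundle.mem_baseSet_trivializationAt' (f p)))

/-- A map `q ↦ u (f q) (ξ q)` is smooth if `f` and `ξ` are. -/
theorem contMDiffAt_apply (hp : f p ∈ U) (hf : ContMDiffAt I (𝓡 n) ∞ f p) {ξ : N → HVec k}
    (hξ : ContMDiffAt I 𝓘(ℝ, HVec k) ∞ ξ p) :
    ContMDiffAt I ((𝓡 n).prod 𝓘(ℝ, HVec k)) ∞
      (fun q => TotalSpace.mk' (HVec k) (E := E) (f q) (u (f q) (ξ q))) p := by
  rw [contMDiffAt_totalSpace]
  refine ⟨hf, ?_⟩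
  have h1 : ContMDiffAt I 𝓘(ℝ, HVec k →L[ℝ] HVec k) ∞ (fun q => frameRep u (f p) (f q)) p :=
    (hu.contMDiffAt_frameRep hp).comp p hf
  refine (h1.clm_apply hξ).congr_of_eventuallyEq ?_
  filter_upwards [hu.eventually_baseSet hf.continuousAt] with q hq
  exact trivializationAt_frame u hq _

theorem contMDiffAt_symm_apply (hp : f p ∈ U) {σ : ∀ q, E (f q)}
    (hσ : ContMDiffAt I ((𝓡 n).prod 𝓘(ℝ, HVec k)) ∞
      (fun q => TotalSpace.mk' (HVec k) (E := E) (f q) (σ q)) p) :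
    ContMDiffAt I 𝓘(ℝ, HVec k) ∞ (fun q => (u (f q)).symm (σ q)) p := by
  rw [contMDiffAt_totalSpace] at hσ
  obtain ⟨hf, hσ⟩ := hσ
  have h1 : ContMDiffAt I 𝓘(ℝ, HVec k →L[ℝ] HVec k) ∞
      (fun q => (frameRep u (f p) (f q)).inverse) p :=
    (hu.contMDiffAt_frameRep_inverse hp).comp p hf
  refine (h1.clm_apply hσ).congr_of_eventuallyEq ?_
  filter_upwards [hu.eventually_baseSet (f := f) hf.continuousAt] with q hq
  exact (frameRep_inverse_apply u hq _).symm

end Maps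

theorem mdifferentiableAt_apply (hx : x ∈ U) {ξ : M → HVec k}
    (hξ : MDifferentiableAt (𝓡 n) 𝓘(ℝ, HVec k) ξ x) :
    MDifferentiableAt (𝓡 n) ((𝓡 n).prod 𝓘(ℝ, HVec k))
      (fun y => TotalSpace.mk' (HVec k) y (u y (ξ y))) x := by
  rw [mdifferentiableAt_section]
  have h1 := (hu.contMDiffAt_frameRep hx).mdifferentiableAt (by simp)
  refine (h1.clm_apply hξ).congr_of_eventuallyEq ?_
  filter_upwards [hu.eventually_baseSet (f := id) continuousAt_id] with q hq
  exact trivializationAt_frame u hq _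

theorem mdifferentiableAt_symm_apply (hx : x ∈ U) {σ : ∀ y, E y}
    (hσ : MDifferentiableAt (𝓡 n) ((𝓡 n).prod 𝓘(ℝ, HVec k))
      (fun y => TotalSpace.mk' (HVec k) y (σ y)) x) :
    MDifferentiableAt (𝓡 n) 𝓘(ℝ, HVec k) (fun y => (u y).symm (σ y)) x := by
  rw [mdifferentiableAt_section] at hσ
  have h1 := (hu.contMDiffAt_frameRep_inverse hx).mdifferentiableAt (by simp)
  refine (h1.clm_apply hσ).congr_of_eventuallyEq ?_
  filter_upwards [hu.eventually_baseSet (f := id) continuousAt_id] with q hq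
  exact (frameRep_inverse_apply u hq _).symm

end IsSmoothFrame

end Frames

theorem mvfderiv_clm_comp {EN HN N F F' : Type*} [NormedAddCommGroup EN] [NormedSpace ℝ EN]
    [TopologicalSpace HN] {I : ModelWithCorners ℝ EN HN} [TopologicalSpace N] [ChartedSpace HN N]
    [NormedAddCommGroup F] [NormedSpace ℝ F] [NormedAddCommGroup F'] [NormedSpace ℝ F']
    (c : F →L[ℝ] F') {η : N → F} {x : N} (hη : MDifferentiableAt I 𝓘(ℝ, F) η x)
    (X : TangentSpace I x) :
    mvfderiv I (fun y => c (η y)) x X = c (mvfderiv I η x X) := by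
  have h1 := mfderiv_comp_apply x c.mdifferentiableAt hη X
  have h2 : mfderiv 𝓘(ℝ, F) 𝓘(ℝ, F') c (η x) = (c : F →L[ℝ] F') := by
    rw [mfderiv_eq_fderiv, c.fderiv]
  rw [h2] at h1
  exact h1

/-! ## The connection form in a local frame -/

section ConnectionForm

variable {n k : ℕ} [NeZero k] {M : Type*} [TopologicalSpace M]
  [ChartedSpace (EuclideanSpace ℝ (Fin n)) M] [IsManifold (𝓡 n) ∞ M]
  {E : M → Type*} [TopologicalSpace (TotalSpace (HVec k) E)]
  [∀ x, AddCommGroup (E x)] [∀ x, Module ℝ (E x)] [∀ x, TopologicalSpace (E x)]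
  [∀ x, IsTopologicalAddGroup (E x)] [∀ x, ContinuousSMul ℝ (E x)]
  [FiberBundle (HVec k) E] [VectorBundle ℝ (HVec k) E]
  [ContMDiffVectorBundle ∞ (HVec k) E (𝓡 n)]
  (nabla : CovariantDerivative (𝓡 n) (HVec k) E) (u : ∀ x, HVec k ≃L[ℝ] E x)

/-- The connection form of `∇` in the frame `u`. -/
def connForm (x : M) (X : TangentSpace (𝓡 n) x) (ξ : HVec k) : HVec k :=
  (u x).symm (nabla (fun y => u y ξ) x X)

/-- The entry of the connection form which describes how the first vector of the frame moves. -/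
def connEntry (q : ℍ[ℝ]) (x : M) : TangentSpace (𝓡 n) x →L[ℝ] ℍ[ℝ] :=
  ((ContinuousLinearMap.proj (R := ℝ) (φ := fun _ : Fin k => ℍ[ℝ]) 0).comp
    ((u x).symm : E x →L[ℝ] HVec k)).comp (nabla (fun y => u y (Pi.single 0 q)) x)

/-- Right multiplication by a quaternion. -/
def rightMulQuat (q : ℍ[ℝ]) : ℍ[ℝ] →L[ℝ] ℍ[ℝ] := (ContinuousLinearMap.mul ℝ ℍ[ℝ]).flip q

/-- The connection form of the connection induced on `Q`, as a form with values in `ℍ` (acting on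
`Im ℍ` by commutators). -/
def connFormQ (x : M) : TangentSpace (𝓡 n) x →L[ℝ] ℍ[ℝ] :=
  (1 / 4 : ℝ) • (connEntry nabla u 1 x - (rightMulQuat quatI).comp (connEntry nabla u quatI x)
    - (rightMulQuat quatJ).comp (connEntry nabla u quatJ x)
    - (rightMulQuat quatK).comp (connEntry nabla u quatK x))

omit [NeZero k] in
-- The reason is `a - iai - jaj - kak = 4 Re a`. The average recovers `c` from the map `q ↦ cq - qa`
-- up to a real number, which is central and so harmless in commutators.
theorem quat_average (c a : ℍ[ℝ]) :
    (1 / 4 : ℝ) • ((c * 1 - 1 * a) - (c * quatI - quatI * a) * quatI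
      - (c * quatJ - quatJ * a) * quatJ - (c * quatK - quatK * a) * quatK)
    = c - ((a.re : ℝ) : ℍ[ℝ]) := by
  ext <;>
    simp [quatI_re, quatI_imI, quatI_imJ, quatI_imK, quatJ_re, quatJ_imI, quatJ_imJ, quatJ_imK,
      quatK_re, quatK_imI, quatK_imJ, quatK_imK] <;> ring

variable {nabla u} {x : M} {X : TangentSpace (𝓡 n) x}

/-- The pair `(c, A)` in the Lie algebra condition is chosen separately at each point and for each
vector. The averaged form agrees with `c` up to a real number, yet is built linearly from `∇` and
hence varies smoothly. -/
theorem connFormQ_apply {c : ℍ[ℝ]} {A : Matrix (Fin k) (Fin k) ℍ[ℝ]}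
    (h : ∀ ξ, connForm nabla u x X ξ = leftMul k c ξ - Matrix.vecMul ξ A) :
    connFormQ nabla u x X = c - (((A 0 0).re : ℝ) : ℍ[ℝ]) := by
  have e : ∀ q, connEntry nabla u q x X = c * q - q * A 0 0 := by
    intro q
    have : connEntry nabla u q x X = connForm nabla u x X (Pi.single 0 q) 0 := rfl
    rw [this, h]
    simp [leftMul]
  rw [← quat_average, ← e, ← e, ← e, ← e]
  rfl

/-- The right action of `A` commutes with left multiplication by `b`, and the real part of `A 0 0`
commutes with `b`; so only the commutator with the `Q`-part survives. -/
theorem connForm_leftMul (h : InQuaternionicLieAlgebra (connForm nabla u x X)) (b : ℍ[ℝ])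
    (η : HVec k) :
    connForm nabla u x X (leftMul k b η) = leftMul k b (connForm nabla u x X η)
      + leftMul k (connFormQ nabla u x X * b - b * connFormQ nabla u x X) η := by
  obtain ⟨c, A, -, h⟩ := h
  have e : leftMul k b (Matrix.vecMul η A) = Matrix.vecMul (leftMul k b η) A := by
    funext i
    simp [leftMul, Matrix.vecMul, dotProduct, Finset.mul_sum, mul_assoc]
  have hr := Quaternion.coe_commutes (A 0 0).re b
  rw [connFormQ_apply h, h, h, map_sub, e, ← leftMul_mul, ← leftMul_mul, sub_mul, mul_sub, hr,
    sub_sub_sub_cancel_right, leftMul_sub]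
  simp only [sub_apply]
  abel

section Derivative

variable {U : Set M} (hu : IsSmoothFrame n U u) (hx : x ∈ U)
include hu hx

omit [NeZero k] [IsManifold (𝓡 n) ∞ M] [ContMDiffVectorBundle ∞ (HVec k) E (𝓡 n)] in
theorem IsSmoothFrame.mdifferentiableAt_const (ξ : HVec k) :
    MDifferentiableAt (𝓡 n) ((𝓡 n).prod 𝓘(ℝ, HVec k))
      (fun y => TotalSpace.mk' (HVec k) y (u y ξ)) x :=
  hu.mdifferentiableAt_apply hx _root_.mdifferentiableAt_const

set_option maxHeartbeats 800000 in
omit [NeZero k] [IsManifold (𝓡 n) ∞ M] [ContMDiffVectorBundle ∞ (HVec k) E (𝓡 n)] in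
/-- The covariant derivative of the section with coordinates `η` in the frame `u`. -/
theorem IsSmoothFrame.nabla_apply {η : M → HVec k} (hη : MDifferentiableAt (𝓡 n) 𝓘(ℝ, HVec k) η x) :
    nabla (fun y => u y (η y)) x X =
      u x (mvfderiv (𝓡 n) η x X + connForm nabla u x X (η x)) := by
  classical
  let b := Module.finBasis ℝ (HVec k)
  let c : Fin (Module.finrank ℝ (HVec k)) → HVec k →L[ℝ] ℝ :=
    fun i => (b.coord i).toContinuousLinearMap
  have e1 : ∀ v : HVec k, ∑ i, c i v • b i = v := fun v => b.sum_repr v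
  -- The section is a finite sum of functions times frame sections; additivity and the Leibniz rule
  -- are applied one basis vector at a time, carrying along the differentiability of the partial
  -- sums.
  have key : ∀ (η : M → HVec k) (_ : MDifferentiableAt (𝓡 n) 𝓘(ℝ, HVec k) η x)
      (s : Finset (Fin (Module.finrank ℝ (HVec k)))),
      MDifferentiableAt (𝓡 n) ((𝓡 n).prod 𝓘(ℝ, HVec k))
        (fun y => TotalSpace.mk' (HVec k) y (u y (∑ i ∈ s, c i (η y) • b i))) x ∧
      nabla (fun y => u y (∑ i ∈ s, c i (η y) • b i)) x X =
        ∑ i ∈ s, u x (c i (mvfderiv (𝓡 n) η x X) • b i + c i (η x) • connForm nabla u x X (b i)) := by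
    intro η hη s
    have hc : ∀ i, MDifferentiableAt (𝓡 n) 𝓘(ℝ, ℝ) (fun y => c i (η y)) x := fun i =>
      (c i).mdifferentiableAt.comp x hη
    have hd : ∀ i, mvfderiv (𝓡 n) (fun y => c i (η y)) x X = c i (mvfderiv (𝓡 n) η x X) :=
      fun i => mvfderiv_clm_comp (c i) hη X
    induction s using Finset.induction_on with
    | empty =>
      refine ⟨?_, ?_⟩
      · simpa using hu.mdifferentiableAt_const hx 0
      · have := nabla.isCovariantDerivativeOnUniv.zero (x := x)
        have e : (fun y => u y (∑ i ∈ (∅ : Finset (Fin (Module.finrank ℝ (HVec k)))),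
          c i (η y) • b i)) = 0 := by
          funext y; simp
        rw [e, this]; simp
    | insert i s hi ih =>
      have e : (fun y => u y (∑ i ∈ insert i s, c i (η y) • b i)) =
          ((fun y => c i (η y)) • fun y => u y (b i)) + fun y => u y (∑ i ∈ s, c i (η y) • b i) := by
        funext y; simp [Finset.sum_insert hi]
      have h1 := hu.mdifferentiableAt_const hx (b i)
      have h2 : MDifferentiableAt (𝓡 n) ((𝓡 n).prod 𝓘(ℝ, HVec k))
          (fun y => TotalSpace.mk' (HVec k) y (((fun y => c i (η y)) • fun y => u y (b i)) y)) x :=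
        (hc i).smul_section h1
      refine ⟨?_, ?_⟩
      · have := mdifferentiableAt_add_section h2 ih.1
        have e' := fun y => congrFun e y
        simp only [e']
        exact this
      · rw [e, nabla.isCovariantDerivativeOnUniv.add h2 ih.1, add_apply, ih.2,
          nabla.isCovariantDerivativeOnUniv.leibniz h1 (hc i), Finset.sum_insert hi]
        congr 1
        simp [hd, connForm, add_comm]
  have h1 := (key η hη Finset.univ).2
  -- For constant coordinates the derivative terms vanish, so this instance identifies the remaining
  -- sum with the connection form at `η x`.
  have h2 := (key (fun _ => η x) _root_.mdifferentiableAt_const Finset.univ).2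
  simp only [e1, mvfderiv_const, zero_apply, map_zero, zero_smul, zero_add] at h2
  simp only [e1, map_add, Finset.sum_add_distrib] at h1
  rw [h1, ← h2, ← map_sum, e1, map_add, connForm, ContinuousLinearEquiv.apply_symm_apply]

end Derivative

end ConnectionForm

/-! ## The induced connection on endomorphisms, in a local frame -/

/-- As `J² = -1`, `e₁ + ie₂` lies in `ker(J + i)` if and only if `e₂ = Je₁`; thus `E^J` is
parametrised by real parts. -/
theorem mem_image_eigenJ_iff {k : ℕ} {V W : Type*} [AddCommGroup V] [Module ℝ V]
    [TopologicalSpace V] {u : HVec k ≃L[ℝ] V} {b : ℍ[ℝ]} (hb : b * b = -1) {ρ : V → W}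
    {X : W × W} :
    X ∈ cMap ρ '' eigenJ (frameConj u b) ↔
      ∃ ξ : HVec k, X.1 = ρ (u ξ) ∧ X.2 = ρ (u (leftMul k b ξ)) := by
  constructor
  · rintro ⟨e, he, rfl⟩
    have h1 : frameConj u b e.1 = e.2 := congrArg Prod.fst he
    refine ⟨u.symm e.1, ?_, ?_⟩
    · rw [ContinuousLinearEquiv.apply_symm_apply]; rfl
    · rw [← frameConj_apply, h1]; rfl
  · rintro ⟨ξ, h1, h2⟩
    refine ⟨(u ξ, u (leftMul k b ξ)), ?_, Prod.ext h1.symm h2.symm⟩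
    refine Prod.ext ?_ ?_
    · exact frameConj_apply_apply _ _ _
    · change frameConj u b (u (leftMul k b ξ)) = -(u ξ)
      rw [frameConj_apply_apply, leftMul_leftMul_of_sq hb, map_neg]

section ConnectionForm

variable {n k : ℕ} [NeZero k] {M : Type*} [TopologicalSpace M]
  [ChartedSpace (EuclideanSpace ℝ (Fin n)) M] [IsManifold (𝓡 n) ∞ M]
  {E : M → Type*} [TopologicalSpace (TotalSpace (HVec k) E)]
  [∀ x, AddCommGroup (E x)] [∀ x, Module ℝ (E x)] [∀ x, TopologicalSpace (E x)]
  [∀ x, IsTopologicalAddGroup (E x)] [∀ x, ContinuousSMul ℝ (E x)]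
  [FiberBundle (HVec k) E] [VectorBundle ℝ (HVec k) E]
  [ContMDiffVectorBundle ∞ (HVec k) E (𝓡 n)]
  {nabla : CovariantDerivative (𝓡 n) (HVec k) E} {u : ∀ x, HVec k ≃L[ℝ] E x}
  {x : M} {X : TangentSpace (𝓡 n) x} {U : Set M}

/-- Left multiplication of a fixed vector, as a linear map. -/
def leftMulVec (ξ : HVec k) : ℍ[ℝ] →L[ℝ] HVec k :=
  LinearMap.toContinuousLinearMap
    { toFun := fun a => leftMul k a ξ
      map_add' := fun a b => by rw [leftMul_add]; rfl
      map_smul' := fun r a => by rw [leftMul_smul]; rfl }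

theorem leftMulVec_apply (ξ : HVec k) (a : ℍ[ℝ]) : leftMulVec ξ a = leftMul k a ξ := rfl

theorem mdifferentiableAt_leftMul {N EN HN : Type*} [NormedAddCommGroup EN] [NormedSpace ℝ EN]
    [TopologicalSpace HN] {I : ModelWithCorners ℝ EN HN} [TopologicalSpace N] [ChartedSpace HN N]
    {c : N → ℍ[ℝ]} {ξ : N → HVec k} {p : N} (hc : MDifferentiableAt I 𝓘(ℝ, ℍ[ℝ]) c p)
    (hξ : MDifferentiableAt I 𝓘(ℝ, HVec k) ξ p) :
    MDifferentiableAt I 𝓘(ℝ, HVec k) (fun q => leftMul k (c q) (ξ q)) p := by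
  have h1 : DifferentiableAt ℝ (fun v : ℍ[ℝ] × HVec k => leftMul k v.1 v.2) (c p, ξ p) :=
    DifferentiableAt.leftMul (G := ℍ[ℝ] × HVec k) (c := Prod.fst) (ξ := Prod.snd)
      differentiableAt_fst differentiableAt_snd
  exact h1.mdifferentiableAt.comp p (hc.prodMk_space hξ)

/-- Testing on sections with constant coordinates `ξ`, the derivative of the endomorphism is the
derivative of `c` plus the commutator of the connection form with left multiplication by `c`, which
`connForm_leftMul` computes. -/
theorem endDeriv_frameConj (hu : IsSmoothFrame n U u) (hx : x ∈ U)
    (h : InQuaternionicLieAlgebra (connForm nabla u x X)) {c : M → ℍ[ℝ]}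
    (hc : MDifferentiableAt (𝓡 n) 𝓘(ℝ, ℍ[ℝ]) c x) {A : ∀ y, E y →L[ℝ] E y}
    (hA : ∀ᶠ y in 𝓝 x, A y = frameConj (u y) (c y)) :
    endDeriv nabla A x X = frameConj (u x) (mvfderiv (𝓡 n) c x X
      + (connFormQ nabla u x X * c x - c x * connFormQ nabla u x X)) := by
  have hA' : ∀ σ : ∀ y, E y,
      MDifferentiableAt (𝓡 n) ((𝓡 n).prod 𝓘(ℝ, HVec k))
        (fun y => TotalSpace.mk' (HVec k) y (σ y)) x →
      MDifferentiableAt (𝓡 n) ((𝓡 n).prod 𝓘(ℝ, HVec k))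
        (fun y => TotalSpace.mk' (HVec k) y (A y (σ y))) x := by
    intro σ hσ
    have h1 := hu.mdifferentiableAt_apply hx
      (mdifferentiableAt_leftMul hc (hu.mdifferentiableAt_symm_apply hx hσ))
    refine h1.congr_of_eventuallyEq ?_
    filter_upwards [hA] with y hy
    rw [hy]; rfl
  ext v
  obtain ⟨ξ, rfl⟩ := (u x).surjective v
  have hσ := hu.mdifferentiableAt_const hx ξ
  have hl := mdifferentiableAt_leftMul hc (_root_.mdifferentiableAt_const (c := ξ))
  have h1 := endDeriv_apply nabla A x X hA' (fun y => u y ξ) hσ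
  have h2 := nabla.isCovariantDerivativeOnUniv.congr_of_eventuallyEq (hA' _ hσ)
    (hu.mdifferentiableAt_apply hx hl) univ_mem
    (by filter_upwards [hA] with y hy; rw [hy, frameConj_apply_apply])
  rw [h1, h2, hu.nabla_apply hx hl, hA.self_of_nhds, frameConj_apply_apply, frameConj_apply,
    connForm_leftMul h, show mvfderiv (𝓡 n) (fun q => leftMul k (c q) ξ) x X = _ from
      mvfderiv_clm_comp (leftMulVec ξ) hc X, leftMulVec_apply, leftMul_add]
  change _ - u x (leftMul k (c x) (connForm nabla u x X ξ)) = _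
  rw [← map_sub, add_apply]
  congr 1
  abel

theorem verticalPart_eq (hu : IsSmoothFrame n U u) {p : M × ℍ[ℝ]} (hp : p.1 ∈ U)
    (ζ : TangentSpace ((𝓡 n).prod 𝓘(ℝ, ℍ[ℝ])) p)
    (h : ∀ X, InQuaternionicLieAlgebra (connForm nabla u p.1 X)) :
    verticalPart nabla u p ζ = frameConj (u p.1) (ζ.2
      + (connFormQ nabla u p.1 ζ.1 * p.2 - p.2 * connFormQ nabla u p.1 ζ.1)) := by
  rw [verticalPart, endDeriv_frameConj hu hp (h _) (c := fun _ => p.2)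
    _root_.mdifferentiableAt_const (Eventually.of_forall fun _ => rfl), mvfderiv_const, mfderiv_fst,
    mfderiv_snd, ← frameConj_add, zero_apply, zero_add]
  rfl

/-- This removes `E` and `Q` from the definition of `𝒞`: in a frame, what remains is a vector `ξ` of
`ℍ^k` and the quaternionic equations for the `(0,1)` vectors of `S²`. -/
theorem mem_coCRDistribution_iff (S : QuaternionicStructure n k E)
    {ρ : ∀ x, E x →L[ℝ] TangentSpace (𝓡 n) x} (hu : S.IsLocalFrame U u)
    (h : S.IsCompatible nabla) {p : M × ℍ[ℝ]} (hp : p.1 ∈ U) (hb : p.2 * p.2 = -1)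
    {ζ : TangentSpace ((𝓡 n).prod 𝓘(ℝ, ℍ[ℝ])) p × TangentSpace ((𝓡 n).prod 𝓘(ℝ, ℍ[ℝ])) p} :
    ζ ∈ S.coCRDistribution nabla ρ u p ↔
      (∃ ξ : HVec k, ζ.1.1 = ρ p.1 (u p.1 ξ) ∧ ζ.2.1 = ρ p.1 (u p.1 (leftMul k p.2 ξ))) ∧
      ∃ V₁ V₂ : ℍ[ℝ],
        V₁ = ζ.1.2 + (connFormQ nabla u p.1 ζ.1.1 * p.2 - p.2 * connFormQ nabla u p.1 ζ.1.1) ∧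
        V₂ = ζ.2.2 + (connFormQ nabla u p.1 ζ.2.1 * p.2 - p.2 * connFormQ nabla u p.1 ζ.2.1) ∧
        p.2 * V₁ + V₁ * p.2 = 0 ∧ V₂ = p.2 * V₁ := by
  have hf : IsSmoothFrame n U u := ⟨hu.1, hu.2.2⟩
  rw [QuaternionicStructure.coCRDistribution, mem_ofPred_eq, mfderiv_fst, mem_image_eigenJ_iff hb]
  refine and_congr Iff.rfl ?_
  rw [cMap, verticalPart_eq hf hp _ (h U u hu _ hp), verticalPart_eq hf hp _ (h U u hu _ hp),
    S.frameConj_mem_zeroOne_iff (hu.2.1 _ hp) hb]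
  constructor
  · rintro ⟨h1, h2⟩
    exact ⟨_, _, rfl, rfl, h1, h2⟩
  · rintro ⟨_, _, rfl, rfl, h1, h2⟩
    exact ⟨h1, h2⟩

end ConnectionForm

/-! ## Tangent vectors in a chart -/

section TangentChart

variable {n : ℕ} {M : Type*} [TopologicalSpace M]
  [ChartedSpace (EuclideanSpace ℝ (Fin n)) M] [IsManifold (𝓡 n) ∞ M]

/-- The components of tangent vectors at `y` in the chart at `x`. -/
def toChart (x y : M) : TangentSpace (𝓡 n) y →L[ℝ] EuclideanSpace ℝ (Fin n) :=
  (trivializationAt (EuclideanSpace ℝ (Fin n)) (TangentSpace (𝓡 n)) x).continuousLinearMapAt ℝ y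

/-- The tangent vector at `y` with given components in the chart at `x`. -/
def ofChart (x y : M) : EuclideanSpace ℝ (Fin n) →L[ℝ] TangentSpace (𝓡 n) y :=
  (trivializationAt (EuclideanSpace ℝ (Fin n)) (TangentSpace (𝓡 n)) x).symmL ℝ y

variable {x y : M}

theorem mem_baseSet_iff :
    y ∈ (trivializationAt (EuclideanSpace ℝ (Fin n)) (TangentSpace (𝓡 n)) x).baseSet ↔
      y ∈ (chartAt (EuclideanSpace ℝ (Fin n)) x).source := by
  rw [TangentBundle.trivializationAt_baseSet]

theorem toChart_ofChart (hy : y ∈ (chartAt (EuclideanSpace ℝ (Fin n)) x).source)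
    (v : EuclideanSpace ℝ (Fin n)) : toChart x y (ofChart x y v) = v :=
  Trivialization.continuousLinearMapAt_symmL _ (mem_baseSet_iff.2 hy) v

theorem ofChart_toChart (hy : y ∈ (chartAt (EuclideanSpace ℝ (Fin n)) x).source)
    (v : TangentSpace (𝓡 n) y) : ofChart x y (toChart x y v) = v :=
  Trivialization.symmL_continuousLinearMapAt _ (mem_baseSet_iff.2 hy) v

theorem toChart_eq (hy : y ∈ (chartAt (EuclideanSpace ℝ (Fin n)) x).source)
    (v : TangentSpace (𝓡 n) y) : toChart x y v =
      (trivializationAt (EuclideanSpace ℝ (Fin n)) (TangentSpace (𝓡 n)) x ⟨y, v⟩).2 := by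
  rw [toChart, Trivialization.continuousLinearMapAt_apply,
    Trivialization.coe_linearMapAt_of_mem _ (mem_baseSet_iff.2 hy)]

theorem toChart_eq_mfderiv (hy : y ∈ (chartAt (EuclideanSpace ℝ (Fin n)) x).source) :
    toChart x y = mfderiv (𝓡 n) 𝓘(ℝ, EuclideanSpace ℝ (Fin n)) (extChartAt (𝓡 n) x) y :=
  TangentBundle.continuousLinearMapAt_trivializationAt hy

theorem toChart_self (v : TangentSpace (𝓡 n) x) : toChart x x v = v := by
  rw [toChart_eq_mfderiv (mem_chart_source _ x), mfderiv_extChartAt_self]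
  rfl

theorem ofChart_self (v : EuclideanSpace ℝ (Fin n)) : ofChart x x v = v := by
  have := toChart_ofChart (mem_chart_source _ x) v
  rwa [toChart_self] at this

theorem extend_eq_ofChart (hy : y ∈ (chartAt (EuclideanSpace ℝ (Fin n)) x).source)
    (v : TangentSpace (𝓡 n) x) :
    FiberBundle.extend (EuclideanSpace ℝ (Fin n)) v y = ofChart x y v := by
  have h : ∀ w : EuclideanSpace ℝ (Fin n), (trivializationAt (EuclideanSpace ℝ (Fin n))
      (TangentSpace (𝓡 n)) x).symm y w = ofChart x y w := fun w =>
    (Trivialization.symmL_apply _ (mem_baseSet_iff.2 hy) w).symm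
  rw [FiberBundle.extend, ← toChart_eq (mem_chart_source _ x), toChart_self]
  exact h v

theorem eventually_mem_source (x : M) :
    ∀ᶠ y in 𝓝 x, y ∈ (chartAt (EuclideanSpace ℝ (Fin n)) x).source :=
  chart_source_mem_nhds _ x

end TangentChart

/-! ### Smoothness of the connection form of `Q`. -/

section ConnectionForm

variable {n k : ℕ} [NeZero k] {M : Type*} [TopologicalSpace M]
  [ChartedSpace (EuclideanSpace ℝ (Fin n)) M] [IsManifold (𝓡 n) ∞ M]
  {E : M → Type*} [TopologicalSpace (TotalSpace (HVec k) E)]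
  [∀ x, AddCommGroup (E x)] [∀ x, Module ℝ (E x)] [∀ x, TopologicalSpace (E x)]
  [∀ x, IsTopologicalAddGroup (E x)] [∀ x, ContinuousSMul ℝ (E x)]
  [FiberBundle (HVec k) E] [VectorBundle ℝ (HVec k) E]
  [ContMDiffVectorBundle ∞ (HVec k) E (𝓡 n)]
  {nabla : CovariantDerivative (𝓡 n) (HVec k) E} {u : ∀ x, HVec k ≃L[ℝ] E x}
  {x : M} {U : Set M}

variable [T2Space M] [CovariantDerivative.ContMDiffCovariantDerivative nabla ∞]

/-- The covariant derivative of a local smooth section in the direction of a smooth field is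
smooth. -/
theorem contMDiffAt_nabla_apply (hU : IsOpen U) (hx : x ∈ U) {σ : ∀ y, E y}
    (hσ : ContMDiffOn (𝓡 n) ((𝓡 n).prod 𝓘(ℝ, HVec k)) ∞ (fun y => TotalSpace.mk' (HVec k) y (σ y)) U)
    {X : ∀ y : M, TangentSpace (𝓡 n) y}
    (hX : ContMDiffAt (𝓡 n) (𝓡 n).tangent ∞ (fun y => (⟨y, X y⟩ : TangentBundle (𝓡 n) M)) x) :
    ContMDiffAt (𝓡 n) ((𝓡 n).prod 𝓘(ℝ, HVec k)) ∞
      (fun y => TotalSpace.mk' (HVec k) y (nabla σ y (X y))) x := by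
  -- Smoothness of `∇` is applied to global sections. A bump function makes the section global
  -- without changing it near `x`, and `∇` is local.
  obtain ⟨f, -, hf⟩ := (SmoothBumpFunction.nhds_basis_tsupport (I := 𝓡 n) x).mem_iff.1
    (hU.mem_nhds hx)
  have h1 : ContMDiff (𝓡 n) ((𝓡 n).prod 𝓘(ℝ, HVec k)) ∞
      (fun y => TotalSpace.mk' (HVec k) y ((⇑f • σ) y)) :=
    ContMDiffOn.smul_section_of_tsupport f.contMDiff.contMDiffOn hU hf hσ
  have h2 := (CovariantDerivative.ContMDiffCovariantDerivative.contMDiff (cov := nabla)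
    (k := ∞)).contMDiff (σ := ⇑f • σ) (h1.contMDiffOn (s := univ))
  have h3 := ContMDiffAt.clm_bundle_apply (b := id) (h2.contMDiffAt univ_mem) hX
  refine h3.congr_of_eventuallyEq ?_
  filter_upwards [f.eventuallyEq_one.eventually_nhds, hU.mem_nhds hx] with y hy hyU
  have e1 : nabla (⇑f • σ) y = nabla σ y := by
    refine nabla.isCovariantDerivativeOnUniv.congr_of_eventuallyEq
      (h1.contMDiffAt.mdifferentiableAt (by simp))
      ((hσ.contMDiffAt (hU.mem_nhds hyU)).mdifferentiableAt (by simp)) univ_mem ?_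
    filter_upwards [hy] with z hz
    simp [hz]
  simp only [id, e1]

variable (nabla u) in
/-- The connection form on `Q`, in the chart at `x`. -/
def connFormQRep (x y : M) : EuclideanSpace ℝ (Fin n) →L[ℝ] ℍ[ℝ] :=
  (connFormQ nabla u y).comp (ofChart x y)

/-- The form is a fixed linear combination of entries of `∇` on frame vectors, each of them smooth
along fields with constant components in the chart. -/
theorem contMDiffAt_connFormQRep (hu : IsSmoothFrame n U u) (hx : x ∈ U) :
    ContMDiffAt (𝓡 n) 𝓘(ℝ, EuclideanSpace ℝ (Fin n) →L[ℝ] ℍ[ℝ]) ∞ (connFormQRep nabla u x) x := by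
  apply contMDiffAt_clm_of_apply
  intro v
  have h1 : ∀ q, ContMDiffAt (𝓡 n) 𝓘(ℝ, ℍ[ℝ]) ∞
      (fun y => connEntry nabla u q y (ofChart x y v)) x := by
    intro q
    have hX := FiberBundle.contMDiffAt_extend (k := ∞) (I := 𝓡 n) (F := EuclideanSpace ℝ (Fin n))
      (V := (TangentSpace (𝓡 n) : M → Type _)) (x := x) v
    have h2 := contMDiffAt_nabla_apply (nabla := nabla) hu.1 hx (hu.2 (Pi.single 0 q)) hX
    have h3 := hu.contMDiffAt_symm_apply hx (f := id) h2
    have h4 := contMDiffAt_pi_space.1 h3 0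
    refine h4.congr_of_eventuallyEq ?_
    filter_upwards [eventually_mem_source (n := n) x] with y hy
    exact congrArg (connEntry nabla u q y) (extend_eq_ofChart hy v).symm
  have h2 : ∀ q r, ContMDiffAt (𝓡 n) 𝓘(ℝ, ℍ[ℝ]) ∞
      (fun y => rightMulQuat r (connEntry nabla u q y (ofChart x y v))) x := fun q r =>
    (rightMulQuat r).contMDiff.contMDiffAt.comp x (h1 q)
  exact (contMDiffAt_const (c := (1 / 4 : ℝ)) (I' := 𝓘(ℝ, ℝ))).smul ((((h1 1).sub (h2 quatI quatI)).sub (h2 quatJ quatJ)).sub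
    (h2 quatK quatK))

end ConnectionForm

/-! ## Lie brackets in charts -/

section FieldRep

variable {EN HN N : Type*} [NormedAddCommGroup EN] [NormedSpace ℝ EN]
    [TopologicalSpace HN] {I : ModelWithCorners ℝ EN HN} [TopologicalSpace N] [ChartedSpace HN N]
    [IsManifold I 1 N] {p : N}

variable (I) in
/-- The vector field `A`, in the chart at `p`. -/
def fieldRep (A : ∀ q : N, TangentSpace I q) (p : N) (z : EN) : EN :=
  mfderiv I 𝓘(ℝ, EN) (extChartAt I p) ((extChartAt I p).symm z) (A ((extChartAt I p).symm z))

omit [IsManifold I 1 N] in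
theorem eventually_mem_target [I.Boundaryless] (p : N) :
    ∀ᶠ z in 𝓝 (extChartAt I p p), z ∈ (extChartAt I p).target :=
  extChartAt_target_mem_nhds p

theorem mpullbackWithin_eq_fieldRep (A : ∀ q : N, TangentSpace I q) {z : EN}
    (hz : z ∈ (extChartAt I p).target) :
    VectorField.mpullbackWithin 𝓘(ℝ, EN) I (extChartAt I p).symm A (range I) z = fieldRep I A p z := by
  rw [VectorField.mpullbackWithin, fieldRep, ContinuousLinearMap.inverse_eq
    (mfderivWithin_extChartAt_symm_comp_mfderiv_extChartAt hz)
    (mfderiv_extChartAt_comp_mfderivWithin_extChartAt_symm hz)]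
  rfl

/-- The bracket on a manifold is computed in the chart at `p` and carried back by its derivative,
which at `p` itself is the identity. -/
theorem mlieBracket_eq_lieBracket_fieldRep [I.Boundaryless] (A B : ∀ q : N, TangentSpace I q) :
    VectorField.mlieBracket I A B p =
      (VectorField.lieBracket ℝ (fieldRep I A p) (fieldRep I B p) (extChartAt I p p) : EN) := by
  have e : ∀ A : ∀ q : N, TangentSpace I q,
      (VectorField.mpullbackWithin 𝓘(ℝ, EN) I (extChartAt I p).symm A (range I) : EN → EN)
        =ᶠ[𝓝 (extChartAt I p p)] fieldRep I A p := fun A => by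
    filter_upwards [eventually_mem_target p] with z hz
    exact mpullbackWithin_eq_fieldRep A hz
  have h := (e A).lieBracket_vectorField_eq (𝕜 := ℝ) (e B)
  rw [← h, ← VectorField.mlieBracketWithin_univ, VectorField.mlieBracketWithin_apply,
    mfderiv_extChartAt_self, I.range_eq_univ, preimage_univ, inter_univ]
  have h' : ∀ w : EN, (ContinuousLinearMap.id ℝ EN).inverse w = w := fun w => by
    rw [ContinuousLinearMap.inverse_id]; rfl
  exact (h' _).trans (congrFun VectorField.lieBracketWithin_univ _)

theorem differentiableAt_comp_extChartAt_symm [I.Boundaryless] {F : Type*} [NormedAddCommGroup F]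
    [NormedSpace ℝ F] {f : N → F} (hf : MDifferentiableAt I 𝓘(ℝ, F) f p) :
    DifferentiableAt ℝ (fun z => f ((extChartAt I p).symm z)) (extChartAt I p p) := by
  rw [← mdifferentiableAt_iff_differentiableAt]
  have h1 : MDifferentiableAt 𝓘(ℝ, EN) I (extChartAt I p).symm (extChartAt I p p) := by
    have := mdifferentiableWithinAt_extChartAt_symm (I := I) (mem_extChartAt_target p)
    rwa [I.range_eq_univ, mdifferentiableWithinAt_univ] at this
  refine MDifferentiableAt.comp (I' := I) (extChartAt I p p) ?_ h1
  rwa [extChartAt_to_inv]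

theorem contDiffAt_comp_extChartAt_symm [IsManifold I ∞ N] [I.Boundaryless] {F : Type*} [NormedAddCommGroup F]
    [NormedSpace ℝ F] {f : N → F} (hf : ContMDiffAt I 𝓘(ℝ, F) ∞ f p) :
    ContDiffAt ℝ ∞ (fun z => f ((extChartAt I p).symm z)) (extChartAt I p p) := by
  rw [← contMDiffAt_iff_contDiffAt]
  have h1 : ContMDiffAt 𝓘(ℝ, EN) I ∞ (extChartAt I p).symm (extChartAt I p p) :=
    (contMDiffOn_extChartAt_symm p).contMDiffAt (extChartAt_target_mem_nhds p)
  refine ContMDiffAt.comp (I' := I) (extChartAt I p p) ?_ h1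
  rwa [extChartAt_to_inv]

theorem differentiableAt_fieldRep [I.Boundaryless] {A : ∀ q : N, TangentSpace I q}
    (hA : MDifferentiableAt I I.tangent (fun q => (⟨q, A q⟩ : TangentBundle I N)) p) :
    DifferentiableAt ℝ (fieldRep I A p) (extChartAt I p p) := by
  rw [ModelWithCorners.tangent, mdifferentiableAt_section] at hA
  have h1 := differentiableAt_comp_extChartAt_symm hA
  refine h1.congr_of_eventuallyEq ?_
  filter_upwards [eventually_mem_target (I := I) p] with z hz
  have hs : (extChartAt I p).symm z ∈ (chartAt HN p).source := by
    rw [← extChartAt_source I]; exact (extChartAt I p).map_target hz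
  have h2 : ∀ v : TangentSpace I ((extChartAt I p).symm z),
      (trivializationAt EN (TangentSpace I) p).continuousLinearMapAt ℝ ((extChartAt I p).symm z) v =
      (trivializationAt EN (TangentSpace I) p ⟨(extChartAt I p).symm z, v⟩).2 := fun v => by
    rw [Trivialization.continuousLinearMapAt_apply, Trivialization.coe_linearMapAt_of_mem _
      (by rwa [TangentBundle.trivializationAt_baseSet])]
  rw [fieldRep, ← TangentBundle.continuousLinearMapAt_trivializationAt hs]
  exact h2 _

end FieldRep

/-! ### Vector fields on `M` and `M × ℍ` in charts. -/

section Product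

variable {n : ℕ} {M : Type*} [TopologicalSpace M]
  [ChartedSpace (EuclideanSpace ℝ (Fin n)) M] [IsManifold (𝓡 n) ∞ M]

theorem fieldRep_eq_toChart (A : ∀ y : M, TangentSpace (𝓡 n) y) {x : M}
    {z : EuclideanSpace ℝ (Fin n)} (hz : z ∈ (extChartAt (𝓡 n) x).target) :
    fieldRep (𝓡 n) A x z = toChart x ((extChartAt (𝓡 n) x).symm z) (A ((extChartAt (𝓡 n) x).symm z)) := by
  have hs : (extChartAt (𝓡 n) x).symm z ∈ (chartAt (EuclideanSpace ℝ (Fin n)) x).source := by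
    rw [← extChartAt_source (𝓡 n)]; exact (extChartAt (𝓡 n) x).map_target hz
  rw [fieldRep, toChart_eq_mfderiv hs]
  rfl

theorem fieldRep_prod (A : ∀ q : M × ℍ[ℝ], TangentSpace ((𝓡 n).prod 𝓘(ℝ, ℍ[ℝ])) q) {p : M × ℍ[ℝ]}
    {z : EuclideanSpace ℝ (Fin n) × ℍ[ℝ]} (hz : z.1 ∈ (extChartAt (𝓡 n) p.1).target) :
    fieldRep ((𝓡 n).prod 𝓘(ℝ, ℍ[ℝ])) A p z =
      (toChart p.1 ((extChartAt (𝓡 n) p.1).symm z.1) (A ((extChartAt (𝓡 n) p.1).symm z.1, z.2)).1,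
        (A ((extChartAt (𝓡 n) p.1).symm z.1, z.2)).2) := by
  have hs : (extChartAt (𝓡 n) p.1).symm z.1 ∈ (chartAt (EuclideanSpace ℝ (Fin n)) p.1).source := by
    rw [← extChartAt_source (𝓡 n)]; exact (extChartAt (𝓡 n) p.1).map_target hz
  have e : ⇑(extChartAt ((𝓡 n).prod 𝓘(ℝ, ℍ[ℝ])) p) = Prod.map (extChartAt (𝓡 n) p.1) id := by
    rw [extChartAt_prod]; rfl
  have e' : (extChartAt ((𝓡 n).prod 𝓘(ℝ, ℍ[ℝ])) p).symm z =
      ((extChartAt (𝓡 n) p.1).symm z.1, z.2) := by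
    rw [extChartAt_prod]; rfl
  rw [fieldRep, e', e, toChart_eq_mfderiv hs]
  have h1 : HasMFDerivAt ((𝓡 n).prod 𝓘(ℝ, ℍ[ℝ])) 𝓘(ℝ, EuclideanSpace ℝ (Fin n))
      (fun q : M × ℍ[ℝ] => extChartAt (𝓡 n) p.1 q.1) ((extChartAt (𝓡 n) p.1).symm z.1, z.2) _ :=
    HasMFDerivAt.comp (g := extChartAt (𝓡 n) p.1) (f := Prod.fst) _
      (mdifferentiableAt_extChartAt hs).hasMFDerivAt (hasMFDerivAt_fst _)
  have h2 : HasMFDerivAt ((𝓡 n).prod 𝓘(ℝ, ℍ[ℝ])) 𝓘(ℝ, ℍ[ℝ])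
      (fun q : M × ℍ[ℝ] => q.2) ((extChartAt (𝓡 n) p.1).symm z.1, z.2) _ := hasMFDerivAt_snd _
  have h3 : HasMFDerivAt ((𝓡 n).prod 𝓘(ℝ, ℍ[ℝ])) 𝓘(ℝ, EuclideanSpace ℝ (Fin n) × ℍ[ℝ])
      (Prod.map (extChartAt (𝓡 n) p.1) (id : ℍ[ℝ] → ℍ[ℝ]))
      ((extChartAt (𝓡 n) p.1).symm z.1, z.2) _ := ⟨h1.1.prodMk h2.1, h1.2.prodMk h2.2⟩
  have h := h3.mfderiv
  exact congrArg (fun L => L (A ((extChartAt (𝓡 n) p.1).symm z.1, z.2))) h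

end Product

instance HVec.clmToNormedAddCommGroup {G : Type*} [NormedAddCommGroup G] [NormedSpace ℝ G] {k : ℕ} :
    NormedAddCommGroup (G →L[ℝ] HVec k) :=
  ContinuousLinearMap.toNormedAddCommGroup

instance HVec.clmToNormedSpace {G : Type*} [NormedAddCommGroup G] [NormedSpace ℝ G] {k : ℕ} :
    NormedSpace ℝ (G →L[ℝ] HVec k) :=
  ContinuousLinearMap.toNormedSpace

/-! ## The anchor and its lift in a frame and a chart -/

section Anchor

variable {n k : ℕ} {M : Type*} [TopologicalSpace M]
  [ChartedSpace (EuclideanSpace ℝ (Fin n)) M] [IsManifold (𝓡 n) ∞ M]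
  {E : M → Type*} [TopologicalSpace (TotalSpace (HVec k) E)]
  [∀ x, AddCommGroup (E x)] [∀ x, Module ℝ (E x)] [∀ x, TopologicalSpace (E x)]
  [∀ x, IsTopologicalAddGroup (E x)] [∀ x, ContinuousSMul ℝ (E x)]
  [FiberBundle (HVec k) E] [VectorBundle ℝ (HVec k) E]

/-- The anchor `ρ`, in the frame `u` and the chart at `x`. -/
def anchorRep (ρ : ∀ x, E x →L[ℝ] TangentSpace (𝓡 n) x) (u : ∀ x, HVec k ≃L[ℝ] E x) (x y : M) :
    HVec k →L[ℝ] EuclideanSpace ℝ (Fin n) :=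
  ((toChart x y).comp (ρ y)).comp (u y : HVec k →L[ℝ] E y)

/-- The inclusion `ι`, in the frame `u` and the chart at `x`. -/
def liftRep (ι : ∀ x, TangentSpace (𝓡 n) x →L[ℝ] E x) (u : ∀ x, HVec k ≃L[ℝ] E x) (x y : M) :
    EuclideanSpace ℝ (Fin n) →L[ℝ] HVec k :=
  (((u y).symm : E y →L[ℝ] HVec k).comp (ι y)).comp (ofChart x y)

variable {u : ∀ x, HVec k ≃L[ℝ] E x} {x y : M} {U : Set M}
  (S : AlmostFQuaternionicStructure n k E)

theorem anchorRep_apply (ξ : HVec k) : anchorRep S.ρ u x y ξ = toChart x y (S.ρ y (u y ξ)) := rfl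

theorem anchorRep_self (ξ : HVec k) : anchorRep S.ρ u x x ξ = S.ρ x (u x ξ) := by
  rw [anchorRep_apply, toChart_self]

theorem anchorRep_liftRep (hy : y ∈ (chartAt (EuclideanSpace ℝ (Fin n)) x).source)
    (v : EuclideanSpace ℝ (Fin n)) : anchorRep S.ρ u x y (liftRep S.ι u x y v) = v := by
  have h : anchorRep S.ρ u x y (liftRep S.ι u x y v) =
    toChart x y (S.ρ y (u y ((u y).symm (S.ι y (ofChart x y v))))) := rfl
  rw [h, ContinuousLinearEquiv.apply_symm_apply, S.ρ_ι, toChart_ofChart hy]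

theorem liftRep_anchorRep (hy : y ∈ (chartAt (EuclideanSpace ℝ (Fin n)) x).source) (ξ : HVec k) :
    liftRep S.ι u x y (anchorRep S.ρ u x y ξ) = (u y).symm (S.ι y (S.ρ y (u y ξ))) := by
  have h : liftRep S.ι u x y (anchorRep S.ρ u x y ξ) =
    (u y).symm (S.ι y (ofChart x y (toChart x y (S.ρ y (u y ξ))))) := rfl
  rw [h, ofChart_toChart hy]

/-- If `θ v = 0`, then `b v` lies in the image of the lift, for `b ∈ S²`. -/
theorem liftRep_anchorRep_leftMul (hy : y ∈ (chartAt (EuclideanSpace ℝ (Fin n)) x).source)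
    (hu : u y ∈ S.frames y) {b : ℍ[ℝ]} (hb : b * b = -1) {ξ : HVec k}
    (hξ : anchorRep S.ρ u x y ξ = 0) :
    liftRep S.ι u x y (anchorRep S.ρ u x y (leftMul k b ξ)) = leftMul k b ξ := by
  have h0 : S.ρ y (u y ξ) = 0 := by
    rw [← ofChart_toChart hy (S.ρ y (u y ξ)), ← anchorRep_apply, hξ, map_zero]
  obtain ⟨w, hw⟩ := S.J_V_subset y (frameConj (u y) b) ⟨u y, hu, b, hb, rfl⟩ _ h0
  rw [frameConj_apply_apply] at hw
  rw [liftRep_anchorRep S hy, ← hw, S.ρ_ι, hw, ContinuousLinearEquiv.symm_apply_apply]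

section Smooth

variable (hu : IsSmoothFrame n U u) (hx : x ∈ U)
include hu hx

theorem contMDiffAt_rho_frame (ξ : HVec k) :
    ContMDiffAt (𝓡 n) (𝓡 n).tangent ∞
      (fun y => (⟨y, S.ρ y (u y ξ)⟩ : TangentBundle (𝓡 n) M)) x :=
  (S.smooth_ρ.contMDiffAt (x := TotalSpace.mk' (HVec k) x (u x ξ))).comp x
    ((hu.2 ξ).contMDiffAt (hu.1.mem_nhds hx))

theorem contMDiffAt_anchorRep :
    ContMDiffAt (𝓡 n) 𝓘(ℝ, HVec k →L[ℝ] EuclideanSpace ℝ (Fin n)) ∞ (anchorRep S.ρ u x) x := by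
  apply contMDiffAt_clm_of_apply
  intro ξ
  have h := contMDiffAt_rho_frame S hu hx ξ
  rw [ModelWithCorners.tangent, contMDiffAt_section] at h
  refine h.congr_of_eventuallyEq ?_
  filter_upwards [eventually_mem_source (n := n) x] with y hy
  rw [anchorRep_apply, toChart_eq hy]

theorem contMDiffAt_liftRep :
    ContMDiffAt (𝓡 n) 𝓘(ℝ, EuclideanSpace ℝ (Fin n) →L[ℝ] HVec k) ∞ (liftRep S.ι u x) x := by
  apply contMDiffAt_clm_of_apply
  intro v
  have hX := FiberBundle.contMDiffAt_extend (k := ∞) (I := 𝓡 n) (F := EuclideanSpace ℝ (Fin n))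
      (V := (TangentSpace (𝓡 n) : M → Type _)) (x := x) v
  have h2 := (S.smooth_ι.contMDiffAt (x := ⟨x, FiberBundle.extend (EuclideanSpace ℝ (Fin n))
    (E := (TangentSpace (𝓡 n) : M → Type _)) (x := x) v x⟩)).comp x hX
  have h3 := hu.contMDiffAt_symm_apply hx (f := id) (p := x) h2
  refine h3.congr_of_eventuallyEq ?_
  filter_upwards [eventually_mem_source (n := n) x] with y hy
  exact congrArg (fun w => (u y).symm (S.ι y w)) (extend_eq_ofChart hy v).symm

theorem differentiableAt_anchorRep : DifferentiableAt ℝ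
    (fun z => anchorRep S.ρ u x ((extChartAt (𝓡 n) x).symm z)) (extChartAt (𝓡 n) x x) :=
  differentiableAt_comp_extChartAt_symm
    ((contMDiffAt_anchorRep S hu hx).mdifferentiableAt (by simp))

theorem differentiableAt_liftRep : DifferentiableAt ℝ
    (fun z => liftRep S.ι u x ((extChartAt (𝓡 n) x).symm z)) (extChartAt (𝓡 n) x x) :=
  differentiableAt_comp_extChartAt_symm
    ((contMDiffAt_liftRep S hu hx).mdifferentiableAt (by simp))

section Torsion

variable [ContMDiffVectorBundle ∞ (HVec k) E (𝓡 n)]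
  {D : CovariantDerivative (𝓡 n) (EuclideanSpace ℝ (Fin n)) (TangentSpace (𝓡 n) : M → Type _)}
  {nabla : CovariantDerivative (𝓡 n) (HVec k) E} (h : S.IsInducedConnection D nabla)
include h

/-- This is `ρ ∘ ∇ = D ∘ ρ`: split the frame section into its `V`-part, whose derivative is killed
by `ρ`, and its `TM`-part, on which `∇` is `D`. -/
theorem covariantDerivative_rho_frame (ξ : HVec k) (v : TangentSpace (𝓡 n) x) :
    D (fun y => S.ρ y (u y ξ)) x v = S.ρ x (u x (connForm nabla u x v ξ)) := by
  have h1 := (contMDiffAt_rho_frame S hu hx ξ).mdifferentiableAt (by simp)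
  have h2 : MDifferentiableAt (𝓡 n) ((𝓡 n).prod 𝓘(ℝ, HVec k))
      (fun y => TotalSpace.mk' (HVec k) y (S.ι y (S.ρ y (u y ξ)))) x :=
    (((S.smooth_ι.contMDiffAt (x := ⟨x, S.ρ x (u x ξ)⟩)).comp x
      (contMDiffAt_rho_frame S hu hx ξ))).mdifferentiableAt (by simp)
  have h3 := hu.mdifferentiableAt_const hx ξ
  have h4 : MDifferentiableAt (𝓡 n) ((𝓡 n).prod 𝓘(ℝ, HVec k))
      (fun y => TotalSpace.mk' (HVec k) y (u y ξ - S.ι y (S.ρ y (u y ξ)))) x :=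
    mdifferentiableAt_sub_section h3 h2
  have h5 := h.on_V x _ h4 (fun y => by rw [map_sub, S.ρ_ι, sub_self]) v
  have h6 := h.on_TM x _ h1 v
  have e : (fun y => u y ξ) = (fun y => u y ξ - S.ι y (S.ρ y (u y ξ)))
      + fun y => S.ι y (S.ρ y (u y ξ)) := by
    funext y; simp
  have h7 : nabla (fun y => u y ξ) x v = nabla (fun y => u y ξ - S.ι y (S.ρ y (u y ξ))) x v
      + S.ι x (D (fun y => S.ρ y (u y ξ)) x v) := by
    rw [← h6]
    conv_lhs => rw [e, nabla.isCovariantDerivativeOnUniv.add h4 h2, add_apply]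
  rw [connForm, ContinuousLinearEquiv.apply_symm_apply, h7, map_add, h5, S.ρ_ι, zero_add]

/-- The torsion of `D`, in a frame of `E` and a chart of `M`. -/
theorem torsion_eq_formTorsion (ξ η : HVec k) :
    D.torsion x (S.ρ x (u x ξ)) (S.ρ x (u x η)) =
      formTorsion (fun z => anchorRep S.ρ u x ((extChartAt (𝓡 n) x).symm z))
        (connForm nabla u x) (extChartAt (𝓡 n) x x) ξ η := by
  have h1 := fun ξ => (contMDiffAt_rho_frame S hu hx ξ).mdifferentiableAt (by simp)
  have e1 : ∀ ξ, fieldRep (𝓡 n) (fun y => S.ρ y (u y ξ)) x =ᶠ[𝓝 (extChartAt (𝓡 n) x x)]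
      fun z => anchorRep S.ρ u x ((extChartAt (𝓡 n) x).symm z) ξ := by
    intro ξ
    filter_upwards [eventually_mem_target (I := 𝓡 n) x] with z hz
    rw [fieldRep_eq_toChart _ hz, anchorRep_apply]
  have hθ := differentiableAt_anchorRep S hu hx
  have e2 : ∀ ξ v, fderiv ℝ (fun z => anchorRep S.ρ u x ((extChartAt (𝓡 n) x).symm z) ξ)
      (extChartAt (𝓡 n) x x) v =
      fderiv ℝ (fun z => anchorRep S.ρ u x ((extChartAt (𝓡 n) x).symm z))
        (extChartAt (𝓡 n) x x) v ξ := by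
    intro ξ v
    have := hθ.hasFDerivAt.clm_apply (hasFDerivAt_const ξ (extChartAt (𝓡 n) x x))
    rw [this.fderiv]
    simp
  -- By tensoriality the torsion is evaluated on the fields `ρ(uξ)`, `ρ(uη)`, with `ξ`, `η`
  -- constant: their covariant derivatives give the `Γ` terms, their bracket the derivatives of the
  -- anchor.
  rw [D.torsion_apply (h1 ξ) (h1 η), covariantDerivative_rho_frame S hu hx h,
    covariantDerivative_rho_frame S hu hx h, mlieBracket_eq_lieBracket_fieldRep,
    (e1 ξ).lieBracket_vectorField_eq (e1 η), VectorField.lieBracket, e2, e2]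
  have e3 : ∀ ξ, anchorRep S.ρ u x ((extChartAt (𝓡 n) x).symm (extChartAt (𝓡 n) x x)) ξ =
      S.ρ x (u x ξ) := fun ξ => by rw [extChartAt_to_inv]; exact anchorRep_self S ξ
  unfold formTorsion
  simp only [map_sub, e3]
  rfl

end Torsion

end Smooth

end Anchor

/-! ## The curvature of `Q` -/

section FlatCurv

variable {G : Type*} [NormedAddCommGroup G] [NormedSpace ℝ G] {α : G → G →L[ℝ] ℍ[ℝ]}
  {c : G → ℍ[ℝ]} {z : G}

/-- The covariant derivative in the direction `v` of the section `c` of `Im ℍ`, for the connection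
form `α`. -/
def formDeriv (α : G → G →L[ℝ] ℍ[ℝ]) (c : G → ℍ[ℝ]) (v z : G) : ℍ[ℝ] :=
  fderiv ℝ c z v + (α z v * c z - c z * α z v)

theorem hasFDerivAt_formDeriv (hα : DifferentiableAt ℝ α z) (hc : ContDiffAt ℝ 2 c z) (v : G) :
    DifferentiableAt ℝ (formDeriv α c v) z ∧ ∀ w, fderiv ℝ (formDeriv α c v) z w =
      fderiv ℝ (fderiv ℝ c) z w v + (fderiv ℝ α z w v * c z - c z * fderiv ℝ α z w v)
        + (α z v * fderiv ℝ c z w - fderiv ℝ c z w * α z v) := by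
  have h1 : DifferentiableAt ℝ (fderiv ℝ c) z :=
    (hc.fderiv_right (m := 1) (by norm_num)).differentiableAt (by norm_num)
  have h2 := h1.hasFDerivAt.clm_apply (hasFDerivAt_const v z)
  have h3 := hα.hasFDerivAt.clm_apply (hasFDerivAt_const v z)
  have h4 := (hc.differentiableAt (by norm_num)).hasFDerivAt
  have h5 := h2.add ((h3.mul' h4).sub (h4.mul' h3))
  have h6 : HasFDerivAt (formDeriv α c v) _ z := h5
  refine ⟨h6.differentiableAt, fun w => ?_⟩
  rw [h6.fderiv]
  simp
  noncomm_ring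

/-- The second derivatives of `c` cancel by symmetry, and the first-order terms in `c` cancel too,
so only the value of `c` at `z` remains. The directions are constant, so no bracket term occurs. -/
theorem formDeriv_comm (hα : DifferentiableAt ℝ α z) (hc : ContDiffAt ℝ 2 c z) (X Y : G) :
    formDeriv α (formDeriv α c Y) X z - formDeriv α (formDeriv α c X) Y z =
      formCurv α z X Y * c z - c z * formCurv α z X Y := by
  have hs := (hc.isSymmSndFDerivAt (by simp)).eq X Y
  have e : ∀ v w, formDeriv α (formDeriv α c v) w z = _ := fun v w => by
    rw [formDeriv, (hasFDerivAt_formDeriv hα hc v).2 w, formDeriv]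
  rw [e, e, hs, formCurv]
  noncomm_ring

end FlatCurv

section Curvature

variable {n k : ℕ} [NeZero k] {M : Type*} [TopologicalSpace M]
  [ChartedSpace (EuclideanSpace ℝ (Fin n)) M] [IsManifold (𝓡 n) ∞ M]
  {E : M → Type*} [TopologicalSpace (TotalSpace (HVec k) E)]
  [∀ x, AddCommGroup (E x)] [∀ x, Module ℝ (E x)] [∀ x, TopologicalSpace (E x)]
  [∀ x, IsTopologicalAddGroup (E x)] [∀ x, ContinuousSMul ℝ (E x)]
  [FiberBundle (HVec k) E] [VectorBundle ℝ (HVec k) E]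
  [ContMDiffVectorBundle ∞ (HVec k) E (𝓡 n)]
  {nabla : CovariantDerivative (𝓡 n) (HVec k) E} {u w : ∀ x, HVec k ≃L[ℝ] E x}
  {x : M} {U U' : Set M}

/-- The coordinates in the frame `u` of the section of `Q` with constant coordinates `a` in `w`. -/
def frameChange (u w : ∀ x, HVec k ≃L[ℝ] E x) (a : ℍ[ℝ]) (y : M) : ℍ[ℝ] :=
  (u y).symm (w y (leftMul k a ((w y).symm (u y (Pi.single 0 1))))) 0

/-- The conjugating quaternion `q` is chosen only pointwise, but `q a q⁻¹` is the first coordinate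
of the endomorphism applied to the frame vector `(1, 0, …, 0)`, an expression visibly smooth in the
point. -/
theorem frameConj_frameChange (S : QuaternionicStructure n k E) {y : M} (hu : u y ∈ S.frames y)
    (hw : w y ∈ S.frames y) (a : ℍ[ℝ]) :
    frameConj (w y) a = frameConj (u y) (frameChange u w a y) := by
  obtain ⟨q, -, hq⟩ := S.exists_frameConj_eq hu hw
  have e : frameChange u w a y = q * a * q⁻¹ := by
    have : frameChange u w a y = (u y).symm (frameConj (w y) a (u y (Pi.single 0 1))) 0 := rfl
    rw [this, hq, frameConj_apply_apply, ContinuousLinearEquiv.symm_apply_apply]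
    simp [leftMul]
  rw [hq, e]

theorem contMDiffAt_frameChange (hu : IsSmoothFrame n U u) (hw : IsSmoothFrame n U' w)
    (hx : x ∈ U) (hx' : x ∈ U') (a : ℍ[ℝ]) :
    ContMDiffAt (𝓡 n) 𝓘(ℝ, ℍ[ℝ]) ∞ (frameChange u w a) x := by
  have h1 := hw.contMDiffAt_symm_apply (f := id) (p := x) hx'
    ((hu.2 (Pi.single 0 1)).contMDiffAt (hu.1.mem_nhds hx))
  have h2 := (leftMul k a).contMDiff.contMDiffAt.comp x h1
  have h3 := hu.contMDiffAt_symm_apply (f := id) (p := x) hx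
    (hw.contMDiffAt_apply (f := id) (p := x) hx' contMDiffAt_id h2)
  exact contMDiffAt_pi_space.1 h3 0

/-- The derivative of a function, in terms of the chart at `x`. -/
theorem eventually_mvfderiv_ofChart {F : Type*} [NormedAddCommGroup F] [NormedSpace ℝ F] {c : M → F}
    (hc : ContMDiffAt (𝓡 n) 𝓘(ℝ, F) ∞ c x) :
    ∀ᶠ y in 𝓝 x, ∀ v, mvfderiv (𝓡 n) c y (ofChart x y v) =
      fderiv ℝ (fun z => c ((extChartAt (𝓡 n) x).symm z)) (extChartAt (𝓡 n) x y) v := by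
  have h1 : ∀ᶠ z in 𝓝 (extChartAt (𝓡 n) x x),
      DifferentiableAt ℝ (fun z => c ((extChartAt (𝓡 n) x).symm z)) z :=
    (((contDiffAt_comp_extChartAt_symm hc).of_le (m := 1) (by simp)).eventually (by simp)).mono
      fun z hz => hz.differentiableAt (by simp)
  filter_upwards [(continuousAt_extChartAt (I := 𝓡 n) x).eventually h1,
    (eventually_mem_source (n := n) x).eventually_nhds] with y hy hys v
  have hs := hys.self_of_nhds
  have h2 : HasMFDerivAt (𝓡 n) 𝓘(ℝ, F) ((fun z => c ((extChartAt (𝓡 n) x).symm z)) ∘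
      extChartAt (𝓡 n) x) y _ := HasMFDerivAt.comp y hy.hasFDerivAt.hasMFDerivAt
    (mdifferentiableAt_extChartAt (I := 𝓡 n) hs).hasMFDerivAt
  have h3 : c =ᶠ[𝓝 y] (fun z => c ((extChartAt (𝓡 n) x).symm z)) ∘ extChartAt (𝓡 n) x := by
    filter_upwards [hys] with y' hy'
    rw [Function.comp_apply, (extChartAt (𝓡 n) x).left_inv (by rwa [extChartAt_source])]
  have h4 := (h2.congr_of_eventuallyEq h3).mfderiv
  have h5 := congrArg (fun L => L (ofChart x y v)) h4
  refine h5.trans ?_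
  have h6 := toChart_ofChart hs v
  rw [toChart_eq_mfderiv hs] at h6
  exact congrArg (fderiv ℝ (fun z => c ((extChartAt (𝓡 n) x).symm z)) (extChartAt (𝓡 n) x y)) h6

/-- The extensions have constant components in the chart at `x`, so they commute. -/
theorem mlieBracket_extend (X Y : TangentSpace (𝓡 n) x) :
    VectorField.mlieBracket (𝓡 n) (FiberBundle.extend (EuclideanSpace ℝ (Fin n)) X)
      (FiberBundle.extend (EuclideanSpace ℝ (Fin n)) Y) x = 0 := by
  have e : ∀ X : TangentSpace (𝓡 n) x, fieldRep (𝓡 n) (FiberBundle.extend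
      (EuclideanSpace ℝ (Fin n)) X) x =ᶠ[𝓝 (extChartAt (𝓡 n) x x)] fun _ => X := by
    intro X
    filter_upwards [eventually_mem_target (I := 𝓡 n) x] with z hz
    have hs : (extChartAt (𝓡 n) x).symm z ∈ (chartAt (EuclideanSpace ℝ (Fin n)) x).source := by
      rw [← extChartAt_source (𝓡 n)]; exact (extChartAt (𝓡 n) x).map_target hz
    rw [fieldRep_eq_toChart _ hz, extend_eq_ofChart hs]
    exact toChart_ofChart hs X
  have h : ∀ v w : EuclideanSpace ℝ (Fin n),
      VectorField.lieBracket ℝ (fun _ => v) (fun _ => w) (extChartAt (𝓡 n) x x) = 0 := by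
    intro v w
    simp [VectorField.lieBracket]
  rw [mlieBracket_eq_lieBracket_fieldRep, (e X).lieBracket_vectorField_eq (e Y)]
  exact h X Y

variable [T2Space M] [CovariantDerivative.ContMDiffCovariantDerivative nabla ∞]

variable (nabla u) in
/-- The connection form on `Q`, as a form on the range of the chart at `x`. -/
def chartForm (x : M) (z : EuclideanSpace ℝ (Fin n)) : EuclideanSpace ℝ (Fin n) →L[ℝ] ℍ[ℝ] :=
  connFormQRep nabla u x ((extChartAt (𝓡 n) x).symm z)

omit [ContMDiffVectorBundle ∞ (HVec k) E (𝓡 n)] [T2Space M]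
  [CovariantDerivative.ContMDiffCovariantDerivative nabla ∞] in
theorem chartForm_extChartAt {y : M} (hy : y ∈ (chartAt (EuclideanSpace ℝ (Fin n)) x).source)
    (v : EuclideanSpace ℝ (Fin n)) :
    chartForm nabla u x (extChartAt (𝓡 n) x y) v = connFormQ nabla u y (ofChart x y v) := by
  rw [chartForm, (extChartAt (𝓡 n) x).left_inv (by rwa [extChartAt_source])]
  rfl

omit [ContMDiffVectorBundle ∞ (HVec k) E (𝓡 n)] [T2Space M]
  [CovariantDerivative.ContMDiffCovariantDerivative nabla ∞] in
theorem chartForm_extChartAt_self (X : TangentSpace (𝓡 n) x) :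
    chartForm nabla u x (extChartAt (𝓡 n) x x) X = connFormQ nabla u x X :=
  (chartForm_extChartAt (mem_chart_source _ x) X).trans
    (congrArg (connFormQ nabla u x) (ofChart_self X))

theorem differentiableAt_chartForm (hu : IsSmoothFrame n U u) (hx : x ∈ U) :
    DifferentiableAt ℝ (chartForm nabla u x) (extChartAt (𝓡 n) x x) :=
  differentiableAt_comp_extChartAt_symm
    ((contMDiffAt_connFormQRep (nabla := nabla) hu hx).mdifferentiableAt (by simp))

/-- The derivative of a section of `Q` in the direction of a field which is constant in the chart. -/
theorem eventually_endDeriv_extend (S : QuaternionicStructure n k E) (hS : S.IsCompatible nabla)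
    (hu : S.IsLocalFrame U u) (hx : x ∈ U) {c : M → ℍ[ℝ]}
    (hc : ContMDiffAt (𝓡 n) 𝓘(ℝ, ℍ[ℝ]) ∞ c x) {A : ∀ y, E y →L[ℝ] E y}
    (hA : ∀ᶠ y in 𝓝 x, A y = frameConj (u y) (c y)) (Y : TangentSpace (𝓡 n) x) :
    ∀ᶠ y in 𝓝 x, endDeriv nabla A y (FiberBundle.extend (EuclideanSpace ℝ (Fin n)) Y y) =
      frameConj (u y) (formDeriv (chartForm nabla u x)
        (fun z => c ((extChartAt (𝓡 n) x).symm z)) Y (extChartAt (𝓡 n) x y)) := by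
  have hf : IsSmoothFrame n U u := ⟨hu.1, hu.2.2⟩
  have hd : ∀ᶠ y in 𝓝 x, MDifferentiableAt (𝓡 n) 𝓘(ℝ, ℍ[ℝ]) c y :=
    ((contMDiffAt_iff_contMDiffAt_nhds (by simp)).1 (hc.of_le (m := 1) (by simp))).mono
      fun y hy => hy.mdifferentiableAt (by simp)
  filter_upwards [eventually_mvfderiv_ofChart hc, hd, hA.eventually_nhds,
    eventually_mem_source (n := n) x, hu.1.mem_nhds hx] with y h1 h2 h3 h4 h5
  rw [endDeriv_frameConj hf h5 (hS U u hu y h5 _) h2 h3, extend_eq_ofChart h4]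
  have h6 := h1 Y
  have h7 := chartForm_extChartAt (nabla := nabla) (u := u) h4 Y
  unfold formDeriv
  have h8 := (extChartAt (𝓡 n) x).left_inv (x := y) (by rwa [extChartAt_source])
  rw [h7, ← h6]
  beta_reduce
  rw [h8]

theorem mvfderiv_comp_extChartAt_self {F : Type*} [NormedAddCommGroup F] [NormedSpace ℝ F]
    {g : EuclideanSpace ℝ (Fin n) → F} (hg : DifferentiableAt ℝ g (extChartAt (𝓡 n) x x))
    (X : TangentSpace (𝓡 n) x) :
    MDifferentiableAt (𝓡 n) 𝓘(ℝ, F) (fun y => g (extChartAt (𝓡 n) x y)) x ∧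
    mvfderiv (𝓡 n) (fun y => g (extChartAt (𝓡 n) x y)) x X =
      fderiv ℝ g (extChartAt (𝓡 n) x x) X := by
  have h2 : HasMFDerivAt (𝓡 n) 𝓘(ℝ, F) (g ∘ extChartAt (𝓡 n) x) x _ :=
    HasMFDerivAt.comp x hg.hasFDerivAt.hasMFDerivAt
    (mdifferentiableAt_extChartAt (I := 𝓡 n) (mem_chart_source _ x)).hasMFDerivAt
  refine ⟨h2.mdifferentiableAt, ?_⟩
  refine (congrArg (fun L => L X) h2.mfderiv).trans ?_
  rw [mfderiv_extChartAt_self]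
  rfl

omit [NeZero k] [IsManifold (𝓡 n) ∞ M] [VectorBundle ℝ (HVec k) E]
  [ContMDiffVectorBundle ∞ (HVec k) E (𝓡 n)] [T2Space M] in
theorem QuaternionicStructure.isLocalFrame_chosenFrame (S : QuaternionicStructure n k E) (x : M) :
    ∃ U, x ∈ U ∧ S.IsLocalFrame U (S.chosenFrame x) :=
  ⟨_, (S.exists_local x).choose_spec.choose_spec.2.1,
    (S.exists_local x).choose_spec.choose_spec.1, (S.exists_local x).choose_spec.choose_spec.2.2⟩

/-- The curvature is defined through an extension constant in the chosen frame, which has variable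
coordinates in `u`. By `formDeriv_comm` only their value at `x` matters, so any admissible frame may
be used. -/
theorem curvQ_frameConj (S : QuaternionicStructure n k E) (hS : S.IsCompatible nabla)
    (hu : S.IsLocalFrame U u) (hx : x ∈ U) (X Y : TangentSpace (𝓡 n) x) (a : ℍ[ℝ]) :
    S.curvQ nabla X Y (frameConj (u x) a) = frameConj (u x)
      (formCurv (chartForm nabla u x) (extChartAt (𝓡 n) x x) X Y * a
        - a * formCurv (chartForm nabla u x) (extChartAt (𝓡 n) x x) X Y) := by
  have hf : IsSmoothFrame n U u := ⟨hu.1, hu.2.2⟩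
  obtain ⟨U', hx', hU', hw, hws⟩ := S.isLocalFrame_chosenFrame x
  have hwf : IsSmoothFrame n U' (S.chosenFrame x) := ⟨hU', hws⟩
  have hwx : S.chosenFrame x x ∈ S.frames x := hw x hx'
  obtain ⟨q, hq, hq'⟩ := S.exists_frameConj_eq hwx (hu.2.1 x hx)
  -- `q a q⁻¹` are the coordinates of the given endomorphism in the chosen frame; `c` expresses its
  -- extension in the frame `u`.
  set c := frameChange u (S.chosenFrame x) (q * a * q⁻¹) with hcdef
  have hc : ContMDiffAt (𝓡 n) 𝓘(ℝ, ℍ[ℝ]) ∞ c x := contMDiffAt_frameChange hf hwf hx hx' _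
  have hcx : c x = a := by
    apply frameConj_injective (u x)
    rw [← frameConj_frameChange S (hu.2.1 x hx) hwx, hq']
  obtain ⟨A, hcurv, hA⟩ : ∃ A : ∀ y, E y →L[ℝ] E y,
      S.curvQ nabla X Y (frameConj (u x) a) =
        endCurv nabla (FiberBundle.extend (EuclideanSpace ℝ (Fin n)) X)
          (FiberBundle.extend (EuclideanSpace ℝ (Fin n)) Y) A x ∧
      ∀ᶠ y in 𝓝 x, A y = frameConj (u y) (c y) := by
    refine ⟨_, rfl, ?_⟩
    filter_upwards [hu.1.mem_nhds hx, hU'.mem_nhds hx'] with y hy hy'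
    rw [← frameConj_frameChange S (hu.2.1 y hy) (hw y hy'), hq']
    ext v
    simp [frameConj]
  have hα := differentiableAt_chartForm (nabla := nabla) hf hx
  have hcd : ContDiffAt ℝ 2 (fun z => c ((extChartAt (𝓡 n) x).symm z)) (extChartAt (𝓡 n) x x) :=
    (contDiffAt_comp_extChartAt_symm hc).of_le
      (WithTop.coe_le_coe.2 (le_top : (2 : ℕ∞) ≤ ⊤))
  have e : ∀ X Y : TangentSpace (𝓡 n) x, endDeriv nabla (fun y => endDeriv nabla A y
      (FiberBundle.extend (EuclideanSpace ℝ (Fin n)) Y y)) x X = frameConj (u x)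
        (formDeriv (chartForm nabla u x) (formDeriv (chartForm nabla u x)
          (fun z => c ((extChartAt (𝓡 n) x).symm z)) Y) X (extChartAt (𝓡 n) x x)) := by
    intro X Y
    have h1 := eventually_endDeriv_extend S hS hu hx hc hA Y
    have h2 := mvfderiv_comp_extChartAt_self (hasFDerivAt_formDeriv hα hcd Y).1 X
    rw [endDeriv_frameConj hf hx (hS U u hu x hx _) h2.1 h1, h2.2]
    rw [← chartForm_extChartAt_self]
    rfl
  rw [hcurv, endCurv, mlieBracket_extend]
  rw [FiberBundle.extend_apply_self, FiberBundle.extend_apply_self, e, e,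
    endDeriv_frameConj hf hx (hS U u hu x hx _) (hc.mdifferentiableAt (by simp)) hA,
    ← frameConj_sub]
  have hz : frameConj (u x) (mvfderiv (𝓡 n) c x 0
      + (connFormQ nabla u x 0 * c x - c x * connFormQ nabla u x 0)) = 0 := by
    rw [map_zero, map_zero, zero_mul, mul_zero, sub_zero, add_zero]
    simpa using frameConj_sub (u x) 0 0
  rw [hz, sub_zero]
  refine congrArg (frameConj (u x)) ((formDeriv_comm hα hcd X Y).trans ?_)
  rw [extChartAt_to_inv, hcx]

end Curvature

/-! ## The distribution and its brackets in a frame and a chart -/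

section Distribution

variable {n k : ℕ} [NeZero k] {M : Type*} [TopologicalSpace M]
  [ChartedSpace (EuclideanSpace ℝ (Fin n)) M] [IsManifold (𝓡 n) ∞ M]
  {E : M → Type*} [TopologicalSpace (TotalSpace (HVec k) E)]
  [∀ x, AddCommGroup (E x)] [∀ x, Module ℝ (E x)] [∀ x, TopologicalSpace (E x)]
  [∀ x, IsTopologicalAddGroup (E x)] [∀ x, ContinuousSMul ℝ (E x)]
  [FiberBundle (HVec k) E] [VectorBundle ℝ (HVec k) E]
  [ContMDiffVectorBundle ∞ (HVec k) E (𝓡 n)]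
  {nabla : CovariantDerivative (𝓡 n) (HVec k) E} {u : ∀ x, HVec k ≃L[ℝ] E x}
  {U : Set M} {W : Set (M × ℍ[ℝ])} {p : M × ℍ[ℝ]}

theorem extChartAt_prod_apply (p q : M × ℍ[ℝ]) :
    extChartAt ((𝓡 n).prod 𝓘(ℝ, ℍ[ℝ])) p q = (extChartAt (𝓡 n) p.1 q.1, q.2) := by
  rw [extChartAt_prod]; rfl

theorem extChartAt_prod_symm_apply (p : M × ℍ[ℝ]) (z : EuclideanSpace ℝ (Fin n) × ℍ[ℝ]) :
    (extChartAt ((𝓡 n).prod 𝓘(ℝ, ℍ[ℝ])) p).symm z = ((extChartAt (𝓡 n) p.1).symm z.1, z.2) := by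
  rw [extChartAt_prod]; rfl

theorem eventually_chart_prod (hW : W ∈ 𝓝 p) :
    ∀ᶠ z in 𝓝 (extChartAt (𝓡 n) p.1 p.1, p.2), z.1 ∈ (extChartAt (𝓡 n) p.1).target ∧
      (extChartAt (𝓡 n) p.1).symm z.1 ∈ (chartAt (EuclideanSpace ℝ (Fin n)) p.1).source ∧
      ((extChartAt (𝓡 n) p.1).symm z.1, z.2) ∈ W := by
  have h1 : ∀ᶠ z : EuclideanSpace ℝ (Fin n) × ℍ[ℝ] in 𝓝 (extChartAt (𝓡 n) p.1 p.1, p.2),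
      z.1 ∈ (extChartAt (𝓡 n) p.1).target :=
    continuousAt_fst.eventually (eventually_mem_target (I := 𝓡 n) p.1)
  have h2 := (continuousAt_extChartAt_symm (I := (𝓡 n).prod 𝓘(ℝ, ℍ[ℝ])) p).preimage_mem_nhds
    (by rwa [extChartAt_to_inv])
  rw [extChartAt_prod_apply] at h2
  filter_upwards [h1, h2] with z hz hzW
  refine ⟨hz, ?_, ?_⟩
  · rw [← extChartAt_source (𝓡 n)]; exact (extChartAt (𝓡 n) p.1).map_target hz
  · rwa [mem_preimage, extChartAt_prod_symm_apply] at hzW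

/-- The fields `A₁`, `A₂` are the real and imaginary parts of a section of `𝒞` near `p`. -/
structure IsDistributionSection (nabla : CovariantDerivative (𝓡 n) (HVec k) E)
    (S : QuaternionicStructure n k E) (ρ : ∀ x, E x →L[ℝ] TangentSpace (𝓡 n) x)
    (u : ∀ x, HVec k ≃L[ℝ] E x)
    (W : Set (M × ℍ[ℝ])) (A₁ A₂ : ∀ p : M × ℍ[ℝ], TangentSpace ((𝓡 n).prod 𝓘(ℝ, ℍ[ℝ])) p) :
    Prop where
  smooth₁ : ContMDiffOn ((𝓡 n).prod 𝓘(ℝ, ℍ[ℝ])) ((𝓡 n).prod 𝓘(ℝ, ℍ[ℝ])).tangent ∞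
    (fun p => (⟨p, A₁ p⟩ : TangentBundle ((𝓡 n).prod 𝓘(ℝ, ℍ[ℝ])) (M × ℍ[ℝ]))) W
  smooth₂ : ContMDiffOn ((𝓡 n).prod 𝓘(ℝ, ℍ[ℝ])) ((𝓡 n).prod 𝓘(ℝ, ℍ[ℝ])).tangent ∞
    (fun p => (⟨p, A₂ p⟩ : TangentBundle ((𝓡 n).prod 𝓘(ℝ, ℍ[ℝ])) (M × ℍ[ℝ]))) W
  mem : ∀ p ∈ W, p.2 * p.2 = -1 → (A₁ p, A₂ p) ∈ S.coCRDistribution nabla ρ u p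

theorem differentiableAt_fieldRep_prod {A : ∀ p : M × ℍ[ℝ], TangentSpace ((𝓡 n).prod 𝓘(ℝ, ℍ[ℝ])) p}
    (hW : IsOpen W) (hp : p ∈ W)
    (hA : ContMDiffOn ((𝓡 n).prod 𝓘(ℝ, ℍ[ℝ])) ((𝓡 n).prod 𝓘(ℝ, ℍ[ℝ])).tangent ∞
      (fun p => (⟨p, A p⟩ : TangentBundle ((𝓡 n).prod 𝓘(ℝ, ℍ[ℝ])) (M × ℍ[ℝ]))) W) :
    DifferentiableAt ℝ (fieldRep ((𝓡 n).prod 𝓘(ℝ, ℍ[ℝ])) A p)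
      (extChartAt (𝓡 n) p.1 p.1, p.2) := by
  have := differentiableAt_fieldRep ((hA.contMDiffAt (hW.mem_nhds hp)).mdifferentiableAt (by simp))
  rwa [extChartAt_prod_apply] at this

/-- The vertical part of a vector field in the chart. -/
theorem formVertical_fieldRep (A : ∀ p : M × ℍ[ℝ], TangentSpace ((𝓡 n).prod 𝓘(ℝ, ℍ[ℝ])) p)
    {z : EuclideanSpace ℝ (Fin n) × ℍ[ℝ]} (hz : z.1 ∈ (extChartAt (𝓡 n) p.1).target)
    (hs : (extChartAt (𝓡 n) p.1).symm z.1 ∈ (chartAt (EuclideanSpace ℝ (Fin n)) p.1).source) :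
    formVertical (chartForm nabla u p.1) z (fieldRep ((𝓡 n).prod 𝓘(ℝ, ℍ[ℝ])) A p z) =
      (A ((extChartAt (𝓡 n) p.1).symm z.1, z.2)).2
      + (connFormQ nabla u ((extChartAt (𝓡 n) p.1).symm z.1)
          (A ((extChartAt (𝓡 n) p.1).symm z.1, z.2)).1 * z.2
        - z.2 * connFormQ nabla u ((extChartAt (𝓡 n) p.1).symm z.1)
          (A ((extChartAt (𝓡 n) p.1).symm z.1, z.2)).1) := by
  have h : chartForm nabla u p.1 z.1 (toChart p.1 ((extChartAt (𝓡 n) p.1).symm z.1)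
      (A ((extChartAt (𝓡 n) p.1).symm z.1, z.2)).1) =
      connFormQ nabla u ((extChartAt (𝓡 n) p.1).symm z.1)
        (A ((extChartAt (𝓡 n) p.1).symm z.1, z.2)).1 := by
    have h1 := ofChart_toChart hs (A ((extChartAt (𝓡 n) p.1).symm z.1, z.2)).1
    exact congrArg (connFormQ nabla u ((extChartAt (𝓡 n) p.1).symm z.1)) h1
  rw [fieldRep_prod A hz, formVertical]
  dsimp only
  rw [h]

variable {S : AlmostFQuaternionicStructure n k E}
  {A₁ A₂ B₁ B₂ : ∀ p : M × ℍ[ℝ], TangentSpace ((𝓡 n).prod 𝓘(ℝ, ℍ[ℝ])) p}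

theorem IsDistributionSection.isVerticalZeroOneNear
    (hS : S.toQuaternionicStructure.IsCompatible nabla)
    (hu : S.toQuaternionicStructure.IsLocalFrame U u) (hW : IsOpen W)
    (hWU : ∀ p ∈ W, p.1 ∈ U) (hp : p ∈ W)
    (hA : IsDistributionSection nabla S.toQuaternionicStructure S.ρ u W A₁ A₂) :
    IsVerticalZeroOneNear (chartForm nabla u p.1)
      (fieldRep ((𝓡 n).prod 𝓘(ℝ, ℍ[ℝ])) A₁ p) (fieldRep ((𝓡 n).prod 𝓘(ℝ, ℍ[ℝ])) A₂ p)
      (extChartAt (𝓡 n) p.1 p.1, p.2) := by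
  refine ⟨differentiableAt_fieldRep_prod hW hp hA.smooth₁,
    differentiableAt_fieldRep_prod hW hp hA.smooth₂, ?_, ?_⟩
  · filter_upwards [eventually_chart_prod (n := n) (hW.mem_nhds hp)] with z hz hb
    obtain ⟨-, V₁, V₂, h1, h2, h3, h4⟩ := (mem_coCRDistribution_iff S.toQuaternionicStructure hu hS
      (hWU _ hz.2.2) hb).1 (hA.mem _ hz.2.2 hb)
    rw [formVertical_fieldRep _ hz.1 hz.2.1, ← h1]
    exact h3
  · filter_upwards [eventually_chart_prod (n := n) (hW.mem_nhds hp)] with z hz hb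
    obtain ⟨-, V₁, V₂, h1, h2, h3, h4⟩ := (mem_coCRDistribution_iff S.toQuaternionicStructure hu hS
      (hWU _ hz.2.2) hb).1 (hA.mem _ hz.2.2 hb)
    rw [formVertical_fieldRep _ hz.1 hz.2.1, formVertical_fieldRep _ hz.1 hz.2.1, ← h1, ← h2]
    exact h4

/-- Membership in `𝒞` gives a lift to `E^J` only pointwise, and only over `S²`. The condition `JV ⊆
TM` determines the `V`-part of such a lift from its projection, which yields a differentiable
formula defined off `S²` as well. -/
theorem IsDistributionSection.isAnchoredNear
    (hS : S.toQuaternionicStructure.IsCompatible nabla)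
    (hu : S.toQuaternionicStructure.IsLocalFrame U u) (hW : IsOpen W)
    (hWU : ∀ p ∈ W, p.1 ∈ U) (hp : p ∈ W)
    (hA : IsDistributionSection nabla S.toQuaternionicStructure S.ρ u W A₁ A₂) :
    ∃ ξ₁ ξ₂, IsAnchoredNear (fun z => anchorRep S.ρ u p.1 ((extChartAt (𝓡 n) p.1).symm z))
      (fieldRep ((𝓡 n).prod 𝓘(ℝ, ℍ[ℝ])) A₁ p) (fieldRep ((𝓡 n).prod 𝓘(ℝ, ℍ[ℝ])) A₂ p)
      ξ₁ ξ₂ (extChartAt (𝓡 n) p.1 p.1, p.2) := by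
  have hf : IsSmoothFrame n U u := ⟨hu.1, hu.2.2⟩
  set θ := fun z => anchorRep S.ρ u p.1 ((extChartAt (𝓡 n) p.1).symm z) with hθ
  set τ := fun z => liftRep S.ι u p.1 ((extChartAt (𝓡 n) p.1).symm z) with hτ
  set X₁ := fun z => (fieldRep ((𝓡 n).prod 𝓘(ℝ, ℍ[ℝ])) A₁ p z).1
  set X₂ := fun z => (fieldRep ((𝓡 n).prod 𝓘(ℝ, ℍ[ℝ])) A₂ p z).1
  have hθd : DifferentiableAt ℝ (fun z : EuclideanSpace ℝ (Fin n) × ℍ[ℝ] => θ z.1)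
      (extChartAt (𝓡 n) p.1 p.1, p.2) :=
    DifferentiableAt.comp (g := θ) (f := Prod.fst) (extChartAt (𝓡 n) p.1 p.1, p.2)
      (differentiableAt_anchorRep S hf (hWU p hp)) differentiableAt_fst
  have hτd : DifferentiableAt ℝ (fun z : EuclideanSpace ℝ (Fin n) × ℍ[ℝ] => τ z.1)
      (extChartAt (𝓡 n) p.1 p.1, p.2) :=
    DifferentiableAt.comp (g := τ) (f := Prod.fst) (extChartAt (𝓡 n) p.1 p.1, p.2)
      (differentiableAt_liftRep S hf (hWU p hp)) differentiableAt_fst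
  have hX₁ : DifferentiableAt ℝ X₁ (extChartAt (𝓡 n) p.1 p.1, p.2) :=
    (differentiableAt_fieldRep_prod hW hp hA.smooth₁).fst
  have hX₂ : DifferentiableAt ℝ X₂ (extChartAt (𝓡 n) p.1 p.1, p.2) :=
    (differentiableAt_fieldRep_prod hW hp hA.smooth₂).fst
  have hb : DifferentiableAt ℝ (fun z : EuclideanSpace ℝ (Fin n) × ℍ[ℝ] => z.2)
    (extChartAt (𝓡 n) p.1 p.1, p.2) := differentiableAt_snd
  have hl₁ := DifferentiableAt.leftMul hb (hτd.clm_apply hX₁)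
  have hl₂ := DifferentiableAt.leftMul hb (hτd.clm_apply hX₂)
  -- Write `ζ = τX₁ + v₁` and `bζ = τX₂ + v₂` with `v₁, v₂ ∈ V`. As `bv₁` and `bv₂` lie in `TM`, the
  -- `V`-parts of these equations give `v₂` as the `V`-part of `bτX₁`, and `v₁` as minus the
  -- `V`-part of `bτX₂`.
  refine ⟨fun z => τ z.1 (X₁ z) - (leftMul k z.2 (τ z.1 (X₂ z))
      - τ z.1 (θ z.1 (leftMul k z.2 (τ z.1 (X₂ z))))),
    fun z => τ z.1 (X₂ z) + (leftMul k z.2 (τ z.1 (X₁ z))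
      - τ z.1 (θ z.1 (leftMul k z.2 (τ z.1 (X₁ z))))),
    (hτd.clm_apply hX₁).sub (hl₂.sub (hτd.clm_apply (hθd.clm_apply hl₂))),
    (hτd.clm_apply hX₂).add (hl₁.sub (hτd.clm_apply (hθd.clm_apply hl₁))), ?_, ?_, ?_⟩
  · filter_upwards [eventually_chart_prod (n := n) (hW.mem_nhds hp)] with z hz
    have e : ∀ v, θ z.1 (τ z.1 v) = v := anchorRep_liftRep S hz.2.1
    simp only [map_sub, e, sub_self, sub_zero]
    rfl
  · filter_upwards [eventually_chart_prod (n := n) (hW.mem_nhds hp)] with z hz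
    have e : ∀ v, θ z.1 (τ z.1 v) = v := anchorRep_liftRep S hz.2.1
    simp only [map_sub, map_add, e, sub_self, add_zero]
    rfl
  · filter_upwards [eventually_chart_prod (n := n) (hW.mem_nhds hp)] with z hz hb
    have hU := hWU _ hz.2.2
    obtain ⟨⟨ζ, h1, h2⟩, -⟩ := (mem_coCRDistribution_iff S.toQuaternionicStructure hu hS
      hU hb).1 (hA.mem _ hz.2.2 hb)
    have e : ∀ v, θ z.1 (τ z.1 v) = v := anchorRep_liftRep S hz.2.1
    have e' : ∀ v, θ z.1 v = 0 → τ z.1 (θ z.1 (leftMul k z.2 v)) = leftMul k z.2 v := fun v hv =>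
      liftRep_anchorRep_leftMul S hz.2.1 (hu.2.1 _ hU) hb hv
    have f1 : X₁ z = θ z.1 ζ := by
      have := fieldRep_prod A₁ hz.1
      change (fieldRep ((𝓡 n).prod 𝓘(ℝ, ℍ[ℝ])) A₁ p z).1 = _
      rw [this]
      exact congrArg (toChart p.1 _) h1
    have f2 : X₂ z = θ z.1 (leftMul k z.2 ζ) := by
      have := fieldRep_prod A₂ hz.1
      change (fieldRep ((𝓡 n).prod 𝓘(ℝ, ℍ[ℝ])) A₂ p z).1 = _
      rw [this]
      exact congrArg (toChart p.1 _) h2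
    -- The condition `bV ⊆ TM`, applied to the `V`-parts of `ζ` and `bζ`, shows that over `S²` the
    -- two formulas return `bζ` and `ζ`.
    have g1 := e' (ζ - τ z.1 (θ z.1 ζ)) (by rw [map_sub, e, sub_self])
    have g2 := e' (leftMul k z.2 ζ - τ z.1 (θ z.1 (leftMul k z.2 ζ))) (by rw [map_sub, e, sub_self])
    simp only [map_sub, leftMul_leftMul_of_sq hb, map_neg] at g1 g2
    have g3 := congrArg (leftMul k z.2) g2
    rw [f1, f2]
    simp only [map_sub, map_neg, leftMul_leftMul_of_sq hb] at g3 ⊢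
    linear_combination (norm := module) g1 + g3

theorem mlieBracket_prod (A B : ∀ p : M × ℍ[ℝ], TangentSpace ((𝓡 n).prod 𝓘(ℝ, ℍ[ℝ])) p)
    (p : M × ℍ[ℝ]) :
    VectorField.mlieBracket ((𝓡 n).prod 𝓘(ℝ, ℍ[ℝ])) A B p =
      VectorField.lieBracket ℝ (fieldRep ((𝓡 n).prod 𝓘(ℝ, ℍ[ℝ])) A p)
        (fieldRep ((𝓡 n).prod 𝓘(ℝ, ℍ[ℝ])) B p) (extChartAt (𝓡 n) p.1 p.1, p.2) := by
  rw [mlieBracket_eq_lieBracket_fieldRep, extChartAt_prod_apply]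

theorem fieldRep_prod_self (A : ∀ p : M × ℍ[ℝ], TangentSpace ((𝓡 n).prod 𝓘(ℝ, ℍ[ℝ])) p)
    (p : M × ℍ[ℝ]) :
    fieldRep ((𝓡 n).prod 𝓘(ℝ, ℍ[ℝ])) A p (extChartAt (𝓡 n) p.1 p.1, p.2) = A p := by
  rw [fieldRep_prod A (mem_extChartAt_target p.1)]
  dsimp only
  rw [extChartAt_to_inv]
  exact Prod.ext (toChart_self (x := p.1) (A p).1) rfl

theorem sub_commutator (f g b : ℍ[ℝ]) :
    (f * b - b * f) - (g * b - b * g) = (f - g) * b - b * (f - g) := by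
  noncomm_ring

theorem add_commutator (f g b : ℍ[ℝ]) :
    (f * b - b * f) + (g * b - b * g) = (f + g) * b - b * (f + g) := by
  noncomm_ring

theorem anticomm_sub (b f g : ℍ[ℝ]) :
    b * (f - g) + (f - g) * b = (b * f + f * b) - (b * g + g * b) := by
  noncomm_ring

variable [T2Space M] [CovariantDerivative.ContMDiffCovariantDerivative nabla ∞]
  {D : CovariantDerivative (𝓡 n) (EuclideanSpace ℝ (Fin n)) (TangentSpace (𝓡 n) : M → Type _)}

/-- The bracket of two sections of `𝒞` lies in `𝒞` at `p` if and only if the torsion and the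
curvature of `∇` satisfy the conditions of integrability on their projections to `M`. -/
theorem IsDistributionSection.bracket_mem_iff (h : S.IsInducedConnection D nabla)
    (hu : S.toQuaternionicStructure.IsLocalFrame U u) (hW : IsOpen W)
    (hWU : ∀ p ∈ W, p.1 ∈ U) (hp : p ∈ W) (hb : p.2 * p.2 = -1)
    (hA : IsDistributionSection nabla S.toQuaternionicStructure S.ρ u W A₁ A₂)
    (hB : IsDistributionSection nabla S.toQuaternionicStructure S.ρ u W B₁ B₂) :
    cBilin (fun A B => VectorField.mlieBracket ((𝓡 n).prod 𝓘(ℝ, ℍ[ℝ])) A B p) (A₁, A₂) (B₁, B₂)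
        ∈ S.toQuaternionicStructure.coCRDistribution nabla S.ρ u p ↔
      cBilin (fun v w => D.torsion p.1 v w) ((A₁ p).1, (A₂ p).1) ((B₁ p).1, (B₂ p).1)
        ∈ S.rhoE (frameConj (u p.1) p.2) ∧
      ∀ J' J'', S.toQuaternionicStructure.IsPositiveOrthonormal (frameConj (u p.1) p.2) J' J'' →
        qInnerC k (cBilin (fun v w => S.toQuaternionicStructure.curvQ nabla v w
          (frameConj (u p.1) p.2)) ((A₁ p).1, (A₂ p).1) ((B₁ p).1, (B₂ p).1)) (J', J'') = 0 := by
  have hf : IsSmoothFrame n U u := ⟨hu.1, hu.2.2⟩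
  have hpU := hWU p hp
  have vA := hA.isVerticalZeroOneNear h.compatible hu hW hWU hp
  have vB := hB.isVerticalZeroOneNear h.compatible hu hW hWU hp
  obtain ⟨ξ₁, ξ₂, aA⟩ := hA.isAnchoredNear h.compatible hu hW hWU hp
  obtain ⟨η₁, η₂, aB⟩ := hB.isAnchoredNear h.compatible hu hW hWU hp
  set z₀ := (extChartAt (𝓡 n) p.1 p.1, p.2) with hz₀
  have hα : DifferentiableAt ℝ (chartForm nabla u p.1) z₀.1 := differentiableAt_chartForm hf hpU
  have hΓ : ∀ (X : EuclideanSpace ℝ (Fin n)) (b : ℍ[ℝ]) (η : HVec k),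
      connForm nabla u p.1 X (leftMul k b η) = leftMul k b (connForm nabla u p.1 X η) +
        leftMul k (chartForm nabla u p.1 z₀.1 X * b - b * chartForm nabla u p.1 z₀.1 X) η := by
    intro X b η
    have := connForm_leftMul (h.compatible U u hu p.1 hpU X) b η
    have e : chartForm nabla u p.1 z₀.1 X = connFormQ nabla u p.1 X :=
      chartForm_extChartAt_self (x := p.1) X
    rw [e]
    exact this
  obtain ⟨ζ, hζ₁, hζ₂⟩ := aA.lieBracket_fst (differentiableAt_anchorRep S hf hpU) hΓ hb aB vA vB
  obtain ⟨R, hR, hR₁, hR₂⟩ := vA.formVertical_bracket hα hb vB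
  have hF : ∀ A : ∀ q : M × ℍ[ℝ], TangentSpace ((𝓡 n).prod 𝓘(ℝ, ℍ[ℝ])) q,
      fieldRep ((𝓡 n).prod 𝓘(ℝ, ℍ[ℝ])) A p z₀ = A p := fun A => fieldRep_prod_self A p
  have hθ : ∀ ξ, anchorRep S.ρ u p.1 ((extChartAt (𝓡 n) p.1).symm z₀.1) ξ = S.ρ p.1 (u p.1 ξ) := by
    intro ξ
    have e : (extChartAt (𝓡 n) p.1).symm z₀.1 = p.1 := extChartAt_to_inv p.1
    rw [e]
    exact anchorRep_self S ξ
  have hL : cBilin (fun A B => VectorField.mlieBracket ((𝓡 n).prod 𝓘(ℝ, ℍ[ℝ])) A B p)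
      (A₁, A₂) (B₁, B₂) = cBilin (fun A B => VectorField.lieBracket ℝ A B z₀)
      (fieldRep ((𝓡 n).prod 𝓘(ℝ, ℍ[ℝ])) A₁ p, fieldRep ((𝓡 n).prod 𝓘(ℝ, ℍ[ℝ])) A₂ p)
      (fieldRep ((𝓡 n).prod 𝓘(ℝ, ℍ[ℝ])) B₁ p, fieldRep ((𝓡 n).prod 𝓘(ℝ, ℍ[ℝ])) B₂ p) := by
    simp only [cBilin, mlieBracket_prod]
    rfl
  have xA₁ : (A₁ p).1 = S.ρ p.1 (u p.1 (ξ₁ z₀)) := by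
    have := aA.anchor₁.self_of_nhds
    rw [hF] at this
    exact this.trans (hθ _)
  have xA₂ : (A₂ p).1 = S.ρ p.1 (u p.1 (ξ₂ z₀)) := by
    have := aA.anchor₂.self_of_nhds
    rw [hF] at this
    exact this.trans (hθ _)
  have xB₁ : (B₁ p).1 = S.ρ p.1 (u p.1 (η₁ z₀)) := by
    have := aB.anchor₁.self_of_nhds
    rw [hF] at this
    exact this.trans (hθ _)
  have xB₂ : (B₂ p).1 = S.ρ p.1 (u p.1 (η₂ z₀)) := by
    have := aB.anchor₂.self_of_nhds
    rw [hF] at this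
    exact this.trans (hθ _)
  set T₀ := cBilin (formTorsion (fun z => anchorRep S.ρ u p.1 ((extChartAt (𝓡 n) p.1).symm z))
    (connForm nabla u p.1) z₀.1) (ξ₁ z₀, ξ₂ z₀) (η₁ z₀, η₂ z₀) with hTdef
  let T : TangentSpace (𝓡 n) p.1 × TangentSpace (𝓡 n) p.1 := T₀
  have hT : cBilin (fun v w => D.torsion p.1 v w) ((A₁ p).1, (A₂ p).1) ((B₁ p).1, (B₂ p).1) = T := by
    change _ = T₀
    rw [hTdef, xA₁, xA₂, xB₁, xB₂]
    simp only [cBilin, torsion_eq_formTorsion S hf hpU h]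
    rfl
  set F := cBilin (fun X Y => formCurv (chartForm nabla u p.1) z₀.1 X Y)
    ((A₁ p).1, (A₂ p).1) ((B₁ p).1, (B₂ p).1) with hFdef
  have hC : cBilin (fun v w => S.toQuaternionicStructure.curvQ nabla v w (frameConj (u p.1) p.2))
      ((A₁ p).1, (A₂ p).1) ((B₁ p).1, (B₂ p).1) =
      (frameConj (u p.1) (F.1 * p.2 - p.2 * F.1), frameConj (u p.1) (F.2 * p.2 - p.2 * F.2)) := by
    have e := fun v w => curvQ_frameConj S.toQuaternionicStructure h.compatible hu hpU v w p.2
    refine Prod.ext ((congrArg₂ (· - ·) (e _ _) (e _ _)).trans ?_)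
      ((congrArg₂ (· + ·) (e _ _) (e _ _)).trans ?_)
    · refine (frameConj_sub _ _ _).symm.trans (congrArg (frameConj (u p.1)) ?_)
      exact sub_commutator _ _ _
    · refine (frameConj_add _ _ _).symm.trans (congrArg (frameConj (u p.1)) ?_)
      exact add_commutator _ _ _
  set L := cBilin (fun A B => VectorField.mlieBracket ((𝓡 n).prod 𝓘(ℝ, ℍ[ℝ])) A B p)
      (A₁, A₂) (B₁, B₂) with hLdef
  have c₁ : L.1.1 = S.ρ p.1 (u p.1 ζ) - T.1 := by
    rw [hθ] at hζ₁
    exact (congrArg (fun l => l.1.1) hL).trans hζ₁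
  have c₂ : L.2.1 = S.ρ p.1 (u p.1 (leftMul k p.2 ζ)) - T.2 := by
    rw [hθ] at hζ₂
    exact (congrArg (fun l => l.2.1) hL).trans hζ₂
  have hv : ∀ v : EuclideanSpace ℝ (Fin n) × ℍ[ℝ], formVertical (chartForm nabla u p.1) z₀ v =
      v.2 + (connFormQ nabla u p.1 v.1 * p.2 - p.2 * connFormQ nabla u p.1 v.1) := by
    intro v
    have e : chartForm nabla u p.1 z₀.1 v.1 = connFormQ nabla u p.1 v.1 :=
      chartForm_extChartAt_self (x := p.1) v.1
    rw [formVertical, e]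
  rw [hF, hF, hF, hF, ← hL, hv] at hR₁ hR₂
  have k₁ := anticomm_commutator hb F.1
  have k₂ := anticomm_commutator hb F.2
  rw [hT, hC]
  refine (mem_coCRDistribution_iff (ζ := L) S.toQuaternionicStructure hu h.compatible hpU hb).trans
    (and_congr ((?_ : _ ↔ _).trans (mem_image_eigenJ_iff hb).symm) ?_)
  -- The projection of the bracket is `ρ` of the vector `(ζ, bζ)` of `E^J`, minus the torsion. The
  -- substitution `ξ ↦ ζ - ξ` exchanges lifts of the bracket with lifts of the torsion.
  · constructor
    · rintro ⟨ξ, e₁, e₂⟩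
      refine ⟨ζ - ξ, ?_, ?_⟩
      · rw [map_sub, map_sub, ← e₁, c₁, sub_sub_cancel]
      · rw [map_sub, map_sub, map_sub, ← e₂, c₂, sub_sub_cancel]
    · rintro ⟨ξ, e₁, e₂⟩
      refine ⟨ζ - ξ, ?_, ?_⟩
      · rw [map_sub, map_sub, ← e₁, c₁]
      · rw [map_sub, map_sub, map_sub, ← e₂, c₂]
  · constructor
    · rintro ⟨V₁, V₂, e₁, e₂, -, e⟩ J' J'' hJ
      rw [QuaternionicStructure.qInnerC_eq_zero_iff _ (hu.2.1 _ hpU) k₁ k₂ hJ]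
      have e₁' := e₁.trans hR₁
      have e₂' := e₂.trans hR₂
      rw [e₁', e₂', mul_sub] at e
      exact sub_right_injective e
    -- One adapted frame `(J, J', J'')` suffices to recover the `(0,1)` condition on the curvature
    -- term; subtracting that term from `R + ibR` then stays of type `(0,1)`.
    · intro H
      obtain ⟨J', J'', hJ⟩ := S.toQuaternionicStructure.exists_isPositiveOrthonormal (hu.2.1 _ hpU) hb
      have e := (QuaternionicStructure.qInnerC_eq_zero_iff _ (hu.2.1 _ hpU) k₁ k₂ hJ).1 (H J' J'' hJ)
      refine ⟨_, _, rfl, rfl, ?_, ?_⟩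
      · refine (congrArg₂ (· + ·) (congrArg (p.2 * ·) hR₁) (congrArg (· * p.2) hR₁)).trans ?_
        have := congrArg₂ (· - ·) hR k₁
        refine Eq.trans ?_ (this.trans (sub_zero _))
        exact anticomm_sub _ _ _
      · refine hR₂.trans (Eq.trans ?_ (congrArg (p.2 * ·) hR₁).symm)
        exact (congrArg (p.2 * R - ·) e).trans (mul_sub _ _ _).symm

end Distribution

/-! ## Horizontal sections of the distribution -/

section Horizontal

variable {n k : ℕ} [NeZero k] {M : Type*} [TopologicalSpace M]
  [ChartedSpace (EuclideanSpace ℝ (Fin n)) M] [IsManifold (𝓡 n) ∞ M]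
  {E : M → Type*} [TopologicalSpace (TotalSpace (HVec k) E)]
  [∀ x, AddCommGroup (E x)] [∀ x, Module ℝ (E x)] [∀ x, TopologicalSpace (E x)]
  [∀ x, IsTopologicalAddGroup (E x)] [∀ x, ContinuousSMul ℝ (E x)]
  [FiberBundle (HVec k) E] [VectorBundle ℝ (HVec k) E]
  [ContMDiffVectorBundle ∞ (HVec k) E (𝓡 n)]
  (nabla : CovariantDerivative (𝓡 n) (HVec k) E)
  (S : AlmostFQuaternionicStructure n k E) (u : ∀ x, HVec k ≃L[ℝ] E x)
  {U : Set M}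

/-- The horizontal lift of the field `ρ (u (c + b d))`, at the points `(x, b)`. -/
def horizontalField (c d : HVec k) (p : M × ℍ[ℝ]) : TangentSpace ((𝓡 n).prod 𝓘(ℝ, ℍ[ℝ])) p :=
  (S.ρ p.1 (u p.1 (c + leftMul k p.2 d)),
    -(connFormQ nabla u p.1 (S.ρ p.1 (u p.1 (c + leftMul k p.2 d))) * p.2
      - p.2 * connFormQ nabla u p.1 (S.ρ p.1 (u p.1 (c + leftMul k p.2 d)))))

variable {nabla S u}

/-- A vector field on `M × ℍ` is smooth if its components are. -/
theorem contMDiffAt_prod_field {X : ∀ p : M × ℍ[ℝ], TangentSpace (𝓡 n) p.1} {w : M × ℍ[ℝ] → ℍ[ℝ]}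
    {p : M × ℍ[ℝ]}
    (hX : ContMDiffAt ((𝓡 n).prod 𝓘(ℝ, ℍ[ℝ])) (𝓡 n).tangent ∞
      (fun p => (⟨p.1, X p⟩ : TangentBundle (𝓡 n) M)) p)
    (hw : ContMDiffAt ((𝓡 n).prod 𝓘(ℝ, ℍ[ℝ])) 𝓘(ℝ, ℍ[ℝ]) ∞ w p) :
    ContMDiffAt ((𝓡 n).prod 𝓘(ℝ, ℍ[ℝ])) ((𝓡 n).prod 𝓘(ℝ, ℍ[ℝ])).tangent ∞
      (fun p => (⟨p, (X p, w p)⟩ : TangentBundle ((𝓡 n).prod 𝓘(ℝ, ℍ[ℝ])) (M × ℍ[ℝ]))) p := by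
  have h2 : ContMDiffAt ((𝓡 n).prod 𝓘(ℝ, ℍ[ℝ])) 𝓘(ℝ, ℍ[ℝ]).tangent ∞
      (fun p : M × ℍ[ℝ] => (⟨p.2, w p⟩ : TangentBundle 𝓘(ℝ, ℍ[ℝ]) ℍ[ℝ])) p := by
    rw [ModelWithCorners.tangent, contMDiffAt_totalSpace]
    refine ⟨contMDiffAt_snd, ?_⟩
    simpa only [trivializationAt_model_space_apply] using hw
  exact (contMDiff_equivTangentBundleProd_symm (n := ∞) (I := 𝓡 n) (M := M) (I' := 𝓘(ℝ, ℍ[ℝ]))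
    (M' := ℍ[ℝ])).contMDiffAt.comp p (hX.prodMk h2)

theorem contMDiffAt_commutator {f g : M × ℍ[ℝ] → ℍ[ℝ]} {p : M × ℍ[ℝ]}
    (hf : ContMDiffAt ((𝓡 n).prod 𝓘(ℝ, ℍ[ℝ])) 𝓘(ℝ, ℍ[ℝ]) ∞ f p)
    (hg : ContMDiffAt ((𝓡 n).prod 𝓘(ℝ, ℍ[ℝ])) 𝓘(ℝ, ℍ[ℝ]) ∞ g p) :
    ContMDiffAt ((𝓡 n).prod 𝓘(ℝ, ℍ[ℝ])) 𝓘(ℝ, ℍ[ℝ]) ∞ (fun q => -(f q * g q - g q * f q)) p := by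
  have h : ContDiff ℝ ∞ (fun a : ℍ[ℝ] × ℍ[ℝ] => -(a.1 * a.2 - a.2 * a.1)) :=
    ((contDiff_fst.mul contDiff_snd).sub (contDiff_snd.mul contDiff_fst)).neg
  exact ContMDiffAt.comp (g := fun a : ℍ[ℝ] × ℍ[ℝ] => -(a.1 * a.2 - a.2 * a.1))
    (f := fun q => (f q, g q)) p (h.contMDiff.contMDiffAt (x := (f p, g p))) (hf.prodMk_space hg)

set_option synthInstance.maxHeartbeats 200000 in
theorem contMDiffAt_horizontalField [T2Space M] (hu : IsSmoothFrame n U u) (c d : HVec k) {p : M × ℍ[ℝ]}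
    [CovariantDerivative.ContMDiffCovariantDerivative nabla ∞] (hp : p.1 ∈ U) :
    ContMDiffAt ((𝓡 n).prod 𝓘(ℝ, ℍ[ℝ])) ((𝓡 n).prod 𝓘(ℝ, ℍ[ℝ])).tangent ∞
      (fun p => (⟨p, horizontalField nabla S u c d p⟩ :
        TangentBundle ((𝓡 n).prod 𝓘(ℝ, ℍ[ℝ])) (M × ℍ[ℝ]))) p := by
  have hb : ContMDiffAt ((𝓡 n).prod 𝓘(ℝ, ℍ[ℝ])) 𝓘(ℝ, ℍ[ℝ]) ∞ (fun q : M × ℍ[ℝ] => q.2) p :=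
    contMDiffAt_snd
  have hξ : ContMDiffAt ((𝓡 n).prod 𝓘(ℝ, ℍ[ℝ])) 𝓘(ℝ, HVec k) ∞
      (fun q : M × ℍ[ℝ] => c + leftMul k q.2 d) p := by
    have h : ContDiff ℝ ∞ (fun b : ℍ[ℝ] => c + leftMulL k b d) :=
      contDiff_const.add ((leftMulL k).contDiff.clm_apply contDiff_const)
    exact h.contMDiff.contMDiffAt.comp p hb
  have hX : ContMDiffAt ((𝓡 n).prod 𝓘(ℝ, ℍ[ℝ])) (𝓡 n).tangent ∞
      (fun q : M × ℍ[ℝ] =>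
        (⟨q.1, S.ρ q.1 (u q.1 (c + leftMul k q.2 d))⟩ : TangentBundle (𝓡 n) M)) p :=
    (S.smooth_ρ.contMDiffAt (x := TotalSpace.mk' (HVec k) p.1
      (u p.1 (c + leftMul k p.2 d)))).comp p (hu.contMDiffAt_apply hp contMDiffAt_fst hξ)
  have hα : ContMDiffAt ((𝓡 n).prod 𝓘(ℝ, ℍ[ℝ])) 𝓘(ℝ, ℍ[ℝ]) ∞
      (fun q : M × ℍ[ℝ] => connFormQ nabla u q.1 (S.ρ q.1 (u q.1 (c + leftMul k q.2 d)))) p := by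
    have h1 : ContMDiffAt ((𝓡 n).prod 𝓘(ℝ, ℍ[ℝ])) 𝓘(ℝ, EuclideanSpace ℝ (Fin n) →L[ℝ] ℍ[ℝ]) ∞
        (fun q : M × ℍ[ℝ] => connFormQRep nabla u p.1 q.1) p :=
      (contMDiffAt_connFormQRep hu hp).comp p contMDiffAt_fst
    have h2 := hX
    rw [ModelWithCorners.tangent, contMDiffAt_totalSpace] at h2
    refine (h1.clm_apply h2.2).congr_of_eventuallyEq ?_
    filter_upwards [continuousAt_fst.eventually (eventually_mem_source (n := n) p.1)] with q hq
    have e1 := (toChart_eq hq (S.ρ q.1 (u q.1 (c + leftMul k q.2 d)))).symm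
    have e2 := ofChart_toChart hq (S.ρ q.1 (u q.1 (c + leftMul k q.2 d)))
    refine Eq.trans ?_ (congrArg (connFormQRep nabla u p.1 q.1) e1).symm
    exact congrArg (connFormQ nabla u q.1) e2.symm
  exact contMDiffAt_prod_field hX (contMDiffAt_commutator hα hb)

/-- Any vector of `E^J` extends to a section of `𝒞`. -/
theorem isDistributionSection_horizontalField [T2Space M]
    [CovariantDerivative.ContMDiffCovariantDerivative nabla ∞]
    (hS : S.toQuaternionicStructure.IsCompatible nabla)
    (hu : S.toQuaternionicStructure.IsLocalFrame U u) (b : ℍ[ℝ]) (ξ : HVec k) :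
    IsDistributionSection nabla S.toQuaternionicStructure S.ρ u (U ×ˢ univ)
      (horizontalField nabla S u ((1 / 2 : ℝ) • ξ) (-((1 / 2 : ℝ) • leftMul k b ξ)))
      (horizontalField nabla S u ((1 / 2 : ℝ) • leftMul k b ξ) ((1 / 2 : ℝ) • ξ)) := by
  have hf : IsSmoothFrame n U u := ⟨hu.1, hu.2.2⟩
  refine ⟨fun p hp => (contMDiffAt_horizontalField hf _ _ hp.1).contMDiffWithinAt,
    fun p hp => (contMDiffAt_horizontalField hf _ _ hp.1).contMDiffWithinAt, fun p hp hb => ?_⟩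
  rw [mem_coCRDistribution_iff S.toQuaternionicStructure hu hS hp.1 hb]
  -- At `(x, b')` the two fields lift the real and imaginary parts of `½(1 + ib')(ξ + ibξ)`, the
  -- projection of `ξ + ibξ` to `ker(b' + i)`; at `b' = b` it is `ξ + ibξ` itself. Being horizontal,
  -- the fields have vertical parts `0`.
  refine ⟨⟨(1 / 2 : ℝ) • ξ + leftMul k p.2 (-((1 / 2 : ℝ) • leftMul k b ξ)), rfl, ?_⟩,
    0, 0, ?_, ?_, by simp, by simp⟩
  · refine congrArg (fun ζ => S.ρ p.1 (u p.1 ζ)) ?_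
    rw [map_add, leftMul_leftMul_of_sq hb, neg_neg, add_comm]
  · exact (neg_add_cancel _).symm
  · exact (neg_add_cancel _).symm

end Horizontal

end

/-! ## Integrability -/

theorem corollary3p1 {n k : ℕ} [NeZero k]
    {M : Type*} [TopologicalSpace M] [ChartedSpace (EuclideanSpace ℝ (Fin n)) M]
    [IsManifold (𝓡 n) ∞ M] [T2Space M] [SecondCountableTopology M]
    {E : M → Type*} [TopologicalSpace (TotalSpace (HVec k) E)]
    [∀ x, AddCommGroup (E x)] [∀ x, Module ℝ (E x)] [∀ x, TopologicalSpace (E x)]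
    [∀ x, IsTopologicalAddGroup (E x)] [∀ x, ContinuousSMul ℝ (E x)]
    [FiberBundle (HVec k) E] [VectorBundle ℝ (HVec k) E]
    [ContMDiffVectorBundle ∞ (HVec k) E (𝓡 n)]
    (S : AlmostFQuaternionicStructure n k E)
    (D : CovariantDerivative (𝓡 n) (EuclideanSpace ℝ (Fin n)) (TangentSpace (𝓡 n) : M → Type _))
    (nabla : CovariantDerivative (𝓡 n) (HVec k) E)
    [CovariantDerivative.ContMDiffCovariantDerivative D ∞]
    [CovariantDerivative.ContMDiffCovariantDerivative nabla ∞]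
    (h : S.IsInducedConnection D nabla) :
    S.toQuaternionicStructure.IsIntegrable nabla S.ρ ↔
      ∀ (x : M), ∀ J ∈ S.toQuaternionicStructure.Z x,
        (∀ X ∈ S.rhoE J, ∀ Y ∈ S.rhoE J,
          cBilin (fun v w => D.torsion x v w) X Y ∈ S.rhoE J) ∧
        (∀ X ∈ S.rhoE J, ∀ Y ∈ S.rhoE J, ∀ J' J'' : E x →L[ℝ] E x,
          S.toQuaternionicStructure.IsPositiveOrthonormal J J' J'' →
          qInnerC k (cBilin (fun v w => S.toQuaternionicStructure.curvQ nabla v w J) X Y)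
            (J', J'') = 0) := by
  constructor
  · intro H x J hJ
    obtain ⟨U, u, hU, hxU, hu, hus⟩ := S.exists_local x
    have hf : S.toQuaternionicStructure.IsLocalFrame U u := ⟨hU, hu, hus⟩
    obtain ⟨b, hb, rfl⟩ := (S.toQuaternionicStructure.mem_Z_iff (hu x hxU)).1 hJ
    -- Torsion and curvature conditions are proved together, since a single bracket of extensions of
    -- `X` and `Y` yields both.
    rw [← forall₂_and]
    intro X hX
    rw [← forall₂_and]
    intro Y hY
    obtain ⟨ξ, hξ₁, hξ₂⟩ := (mem_image_eigenJ_iff hb).1 hX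
    obtain ⟨η, hη₁, hη₂⟩ := (mem_image_eigenJ_iff hb).1 hY
    have sA := isDistributionSection_horizontalField h.compatible hf b ξ
    have sB := isDistributionSection_horizontalField h.compatible hf b η
    have hW : IsOpen (U ×ˢ (univ : Set ℍ[ℝ])) := hU.prod isOpen_univ
    have hp : (x, b) ∈ U ×ˢ (univ : Set ℍ[ℝ]) := ⟨hxU, trivial⟩
    have key := (sA.bracket_mem_iff h hf hW (fun p hp => hp.1) hp hb sB).1
      (H U u hf _ hW (fun p hp => hp.1) _ _ _ _ (by
        rintro V (rfl | rfl | rfl | rfl)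
        exacts [sA.smooth₁, sA.smooth₂, sB.smooth₁, sB.smooth₂]) sA.mem sB.mem (x, b) hp hb)
    have e : ∀ ξ : HVec k, (1 / 2 : ℝ) • ξ + leftMul k b (-((1 / 2 : ℝ) • leftMul k b ξ)) = ξ := by
      intro ξ
      rw [map_neg, map_smul, leftMul_leftMul_of_sq hb, smul_neg, neg_neg, ← add_smul]
      norm_num
    have e' : ∀ ξ : HVec k,
        (1 / 2 : ℝ) • leftMul k b ξ + leftMul k b ((1 / 2 : ℝ) • ξ) = leftMul k b ξ := by
      intro ξ
      rw [map_smul, ← add_smul]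
      norm_num
    -- At the point `(x, b)` the horizontal sections project exactly to the prescribed vectors of
    -- `ρ(E^J)`.
    have q : ∀ (ξ : HVec k) (X : TangentSpace (𝓡 n) x × TangentSpace (𝓡 n) x),
        X.1 = S.ρ x (u x ξ) → X.2 = S.ρ x (u x (leftMul k b ξ)) →
        ((horizontalField nabla S u ((1 / 2 : ℝ) • ξ) (-((1 / 2 : ℝ) • leftMul k b ξ)) (x, b)).1,
          (horizontalField nabla S u ((1 / 2 : ℝ) • leftMul k b ξ) ((1 / 2 : ℝ) • ξ) (x, b)).1)
          = X := by
      intro ξ X h₁ h₂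
      exact Prod.ext ((congrArg (fun ζ => S.ρ x (u x ζ)) (e ξ)).trans h₁.symm)
        ((congrArg (fun ζ => S.ρ x (u x ζ)) (e' ξ)).trans h₂.symm)
    have qX := q ξ X hξ₁ hξ₂
    have qY := q η Y hη₁ hη₂
    rw [← qX, ← qY]
    exact key
  · intro H U u hu W hW hWU A₁ A₂ B₁ B₂ hs hA hB p hp hb
    have sA : IsDistributionSection nabla S.toQuaternionicStructure S.ρ u W A₁ A₂ :=
      ⟨hs A₁ (by simp), hs A₂ (by simp), hA⟩
    have sB : IsDistributionSection nabla S.toQuaternionicStructure S.ρ u W B₁ B₂ :=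
      ⟨hs B₁ (by simp), hs B₂ (by simp), hB⟩
    have hpU := hWU p hp
    -- The hypotheses are pointwise, so all that is needed of the sections is that their projections
    -- at `p` lie in `ρ(E^J)`.
    have r : ∀ A₁ A₂, IsDistributionSection nabla S.toQuaternionicStructure S.ρ u W A₁ A₂ →
        ((A₁ p).1, (A₂ p).1) ∈ S.rhoE (frameConj (u p.1) p.2) := fun A₁ A₂ s =>
      (mem_image_eigenJ_iff hb).2 ((mem_coCRDistribution_iff S.toQuaternionicStructure hu
        h.compatible hpU hb).1 (s.mem p hp hb)).1
    obtain ⟨H₁, H₂⟩ := H p.1 (frameConj (u p.1) p.2) ⟨u p.1, hu.2.1 _ hpU, p.2, hb, rfl⟩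
    exact (sA.bracket_mem_iff h hu hW hWU hp hb sB).2
      ⟨H₁ _ (r _ _ sA) _ (r _ _ sB), H₂ _ (r _ _ sA) _ (r _ _ sB)⟩
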